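/- **Setting.** A *genus-zero spectral curve* is a pair of rational functions $x,y$ on $\mathbb P^1$ (global coordinate $z$), with $B=\frac{dz_1dz_2}{(z_1-z_2)^2}$, such that the ramification points of $x$ and of $y$ (zeros of $dx$, resp. $dy$) are simple and lie at finite $z$, and such that each of $x,y$ is regular and unramified at the ramification points of the other. Its genus-zero correlators are given by topological recursion: $\omega^{(0)}_{1,0}=y\,dx$, $\omega^{(0)}_{2,0}=B$, and for $n\ge2$ $$\omega^{(0)}_{n+1,0}(I,z)=\sum_{\alpha:\,dx(\alpha)=0}\operatorname{Res}_{q\to\alpha}\frac{\tfrac12\int_{\sigma_\alpha(q)}^{q}B(z,\cdot)}{\omega^{(0)}_{1,0}(q)-\omega^{(0)}_{1,0}(\sigma_\alpha(q))}\sum_{\substack{I_1\uplus I_2=I\\ I_1,I_2\ne\emptyset}}\omega^{(0)}_{|I_1|+1,0}(I_1,q)\,\omega^{(0)}_{|I_2|+1,0}(I_2,\sigma_\alpha(q)),$$ where $I=\{z_1,\dots,z_n\}$ and $\sigma_\alpha$ is the local Galois involution of $x$ at $\alpha$. The forms $\omega^{(0)}_{0,m}$ are defined in the same way with $x$ and $y$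 interchanged. Let $(x_t,y_t)_{t\in T}$ be a family of such curves over a moduli space $T$. For each $t$ let $P_t\subset\mathbb C$ be an open set on which $x_t$ and $y_t$ are regular, unramified and injective. It fixes branches $z(x),z(y)\in P_t$ of the inverses of $x_t$ and $y_t$, and $Y(x)=y_t(z(x))$, $X(y)=x_t(z(y))$. Put $$W^{(0)}_{n,0}(x_1,\dots,x_n)=\frac{\omega^{(0)}_{n,0}(z_1,\dots,z_n)}{dx(z_1)\cdots dx(z_n)}\Big|_{z_i=z(x_i)},\qquad W^{(0)}_{0,m}(y_1,\dots,y_m)=\frac{\omega^{(0)}_{0,m}(z_1,\dots,z_m)}{dy(z_1)\cdots dy(z_m)}\Big|_{z_j=z(y_j)},$$ so that $W^{(0)}_{1,0}=Y$ and $W^{(0)}_{0,1}=X$. Functions of $t,x_1,\dots,x_n,y_1,\dots,y_m$ are considered on the domain where $x_i\in x_t(P_t)$, $y_j\in y_t(P_t)$ and the $n+m$ points $z(x_i),z(y_j)$ are pairwise distinct. Fix a class of such functions, for all $n,m$, that are analytic in the variables. The class is closed under sums, products, derivatives in the variables and substitution, and contains the constants, the variables and all $W^{(0)}_{k,0},W^{(0)}_{0,k}$.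 *Loop insertion operators* $D_x,\tilde D_y$ on this class are linear operators that add one new variable $x$ (resp. $y$), satisfy the Leibniz rule and the chain rule, treat all variables as fixed ($D_xx_i=D_xy_j=\tilde D_yx_i=\tilde D_yy_j=0$, and they commute with the derivatives in these variables), and satisfy $$D_xW^{(0)}_{k,0}(x_1,\dots,x_k)=W^{(0)}_{k+1,0}(x,x_1,\dots,x_k),\qquad \tilde D_yW^{(0)}_{0,k}(y_1,\dots,y_k)=W^{(0)}_{0,k+1}(y,y_1,\dots,y_k)\qquad(k\ge1).$$ The intermediate correlators are $$W^{(0)}_{n,m}(x_1,\dots,x_n|y_1,\dots,y_m)=D_{x_2}\cdots D_{x_n}\tilde D_{y_1}\cdots\tilde D_{y_m}W^{(0)}_{1,0}(x_1)=D_{x_1}\cdots D_{x_n}\tilde D_{y_2}\cdots\tilde D_{y_m}W^{(0)}_{0,1}(y_1),$$ where the first expression is used for $n\ge1$ and the second for $m\ge1$. Let $\mathcal G_{n,m}$ be the set of isomorphism classes of trees $T$ (connected, acyclic graphs) with $n$ $\Box$-vertices labelled $1,\dots,n$, $m$ $\circ$-vertices labelled $1,\dots,m$ and unlabelled $\bullet$-vertices,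 such that every edge joins a $\bullet$-vertex to a $\Box$- or $\circ$-vertex, every $\bullet$-vertex has valence at least $2$ and every $\Box$-vertex has valence one. Isomorphisms preserve the labels, and $\mathrm{Aut}(T)$ is the number of automorphisms of $T$. Let $r_j(T)$ be the valence of the $j$-th $\circ$-vertex. Let $\mathcal I(T)$ be the set of pairs $(I,J)$ of label sets of the $\Box$- and $\circ$-vertices adjacent to a $\bullet$-vertex of $T$. **Theorem (Main Theorem).** Assume that $D_x\tilde D_y=\tilde D_yD_x$. Then for all $n,m\ge0$ with $n+m\ge2$, on the domain above, $$W^{(0)}_{n,m}(x_1,\dots,x_n|y_1,\dots,y_m)=\sum_{T\in\mathcal G_{n,m}}\frac1{\mathrm{Aut}(T)}\prod_{j=1}^m\Big(-\frac{d}{dy_j}\Big)^{r_j(T)-1}\bigg(\prod_{k=1}^m\Big(-\frac{dX(y_k)}{dy_k}\Big)\prod_{(I,J)\in\mathcal I(T)}W^{(0)}_{|I|+|J|,0}\big(x_I,X(y_J)\big)\bigg),$$ where $x_I=(x_i)_{i\in I}$ and $X(y_J)=(X(y_j))_{j\in J}$. This holds for the first expression defining $W^{(0)}_{n,m}$ whenever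 $n\ge1$ and for the second whenever $m\ge1$; in particular the two agree when $n,m\ge1$. -/

import Mathlib

open scoped Topology

noncomputable section

namespace XYSymmetry

/-! ### Genus-zero topological recursion on `ℙ¹` with global coordinate `z` -/

/-- The value of a rational function at a complex number. -/
def ev (f : RatFunc ℂ) (z : ℂ) : ℂ := f.eval (RingHom.id ℂ) z

/-- `f` is regular (has no pole) at `z`. -/
def Regular (f : RatFunc ℂ) (z : ℂ) : Prop := f.denom.eval z ≠ 0

/-- The ramification points `α` of `f`: zeros of `df`. -/
def ram (f : RatFunc ℂ) : Set ℂ := {α | Regular f α ∧ deriv (ev f) α = 0}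

/-- A genus-zero spectral curve `(ℙ¹, x, y, dz₁dz₂/(z₁-z₂)²)`. The ramification points of `x` and
of `y` are simple, each of the two functions is regular and unramified at the ramification points
of the other one, and the coordinate `z` is chosen so that `dx` and `dy` do not vanish at `∞`. -/
structure SpectralCurve where
  x : RatFunc ℂ
  y : RatFunc ℂ
  x_simple : ∀ α ∈ ram x, deriv (deriv (ev x)) α ≠ 0
  y_simple : ∀ β ∈ ram y, deriv (deriv (ev y)) β ≠ 0
  y_regular : ∀ α ∈ ram x, Regular y α ∧ deriv (ev y) α ≠ 0
  x_regular : ∀ β ∈ ram y, Regular x β ∧ deriv (ev x) β ≠ 0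
  x_infty : ¬ Filter.Tendsto (fun z => z ^ 2 * deriv (ev x) z) (Bornology.cobounded ℂ) (𝓝 0)
  y_infty : ¬ Filter.Tendsto (fun z => z ^ 2 * deriv (ev y) z) (Bornology.cobounded ℂ) (𝓝 0)

/-- `σ` is the local Galois involution of `x` near the ramification point `α`. -/
def IsGaloisInvolution (x : RatFunc ℂ) (α : ℂ) (σ : ℂ → ℂ) : Prop :=
  AnalyticAt ℂ σ α ∧ σ α = α ∧ (∀ᶠ q in 𝓝 α, ev x (σ q) = ev x q) ∧ ¬ ∀ᶠ q in 𝓝 α, σ q = q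

/-- The local Galois involution near a simple ramification point (unique as a germ). -/
def galois (x : RatFunc ℂ) (α : ℂ) : ℂ → ℂ := Classical.epsilon (IsGaloisInvolution x α)

/-- The residue at `α` of the differential `f(q) dq`. -/
def residue (f : ℂ → ℂ) (α : ℂ) : ℂ :=
  Filter.limUnder (𝓝[>] (0 : ℝ)) fun r => (2 * Real.pi * Complex.I)⁻¹ * ∮ q in C(α, r), f q

/-- The recursion kernel `K(z,q) = ½ ∫_{σ(q)}^{q} B(z,·) / (ω₁(q) - ω₁(σ(q)))` with `ω₁ = y dx`, in
the coordinate `z`. The integral of `dz dq'/(z-q')²` is `dz (1/(z-q) - 1/(z-σ(q)))`. -/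
def kernel (x y : RatFunc ℂ) (α z q : ℂ) : ℂ :=
  (1 / 2) * (1 / (z - q) - 1 / (z - galois x α q)) /
    (ev y q * deriv (ev x) q -
      ev y (galois x α q) * deriv (ev x) (galois x α q) * deriv (galois x α) q)

open Classical in
/-- The decompositions `I = I₁ ⊎ I₂` with both parts nonempty. The multiset counts each ordered
decomposition of the labelled family of points `I` once. -/
def splits (I : Multiset ℂ) : Multiset (Multiset ℂ × Multiset ℂ) :=
  I.antidiagonal.filter fun p => p.1 ≠ 0 ∧ p.2 ≠ 0

theorem card_lt_of_mem_splits {I : Multiset ℂ} {p : Multiset ℂ × Multiset ℂ}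
    (hp : p ∈ splits I) : p.1.card < I.card ∧ p.2.card < I.card := by
  classical
  obtain ⟨h, h1, h2⟩ := Multiset.mem_filter.1 hp
  have h := congrArg Multiset.card (Multiset.mem_antidiagonal.1 h)
  rw [Multiset.card_add] at h
  have h1 := Multiset.card_pos.2 h1
  have h2 := Multiset.card_pos.2 h2
  omega

/-- Topological recursion in genus zero for the spectral curve `(x, y)`: `omega x y I z` is the
coefficient of `dz₁ … dzₙ dz` in `ω⁽⁰⁾_{n+1,0}(z₁,…,zₙ,z)`, where `I = {z₁,…,zₙ}`. -/
def omega (x y : RatFunc ℂ) (I : Multiset ℂ) (z : ℂ) : ℂ :=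
  if I.card = 0 then ev y z * deriv (ev x) z
  else if I.card = 1 then (I.map fun z₁ => 1 / (z₁ - z) ^ 2).sum
  else ∑ᶠ α ∈ ram x, residue (fun q => kernel x y α z q *
    ((splits I).attach.map fun p =>
      omega x y p.1.1 q * (omega x y p.1.2 (galois x α q) * deriv (galois x α) q)).sum) α
termination_by I.card
decreasing_by
  · exact (card_lt_of_mem_splits p.2).1
  · exact (card_lt_of_mem_splits p.2).2

/-- The branch, with values in `P`, of the inverse of the covering `f`. -/
def branch (f : RatFunc ℂ) (P : Set ℂ) : ℂ → ℂ := Function.invFunOn (ev f) P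

/-- `W⁽⁰⁾_{k,0}(x₁,…,x_k) = ω⁽⁰⁾_{k,0}(z₁,…,z_k) / (dx(z₁) … dx(z_k))` at `zᵢ = z(xᵢ) ∈ P`. -/
def corr (x y : RatFunc ℂ) (P : Set ℂ) : (k : ℕ) → (Fin k → ℂ) → ℂ
  | 0, _ => 0
  | k + 1, v =>
      omega x y (Multiset.map (fun i : Fin k => branch x P (v i.castSucc)) Finset.univ.val)
          (branch x P (v (Fin.last k))) /
        ∏ i, deriv (ev x) (branch x P (v i))

/-! ### Functions of the moduli and of the variables -/

/-- Functions of the moduli `t`, of `x₁,…,xₙ` and of `y₁,…,y_m`. Only the values on the domain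
`CurveFamily.InDom` below are meaningful. -/
abbrev Fun (T : Type*) (n m : ℕ) := T → (Fin n → ℂ) → (Fin m → ℂ) → ℂ

/-- The derivative with respect to the variable `xᵢ`. -/
def dX {T : Type*} {n m : ℕ} (i : Fin n) (f : Fun T n m) : Fun T n m :=
  fun t x y => deriv (fun s => f t (Function.update x i s) y) (x i)

/-- The derivative with respect to the variable `y_j`. -/
def dY {T : Type*} {n m : ℕ} (j : Fin m) (f : Fun T n m) : Fun T n m :=
  fun t x y => deriv (fun s => f t x (Function.update y j s)) (y j)

/-- Substitution of functions `a₁,…,aₙ` for `x₁,…,xₙ` and `b₁,…,b_m` for `y₁,…,y_m`. -/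
def subst {T : Type*} {n m n' m' : ℕ} (f : Fun T n m) (a : Fin n → Fun T n' m')
    (b : Fin m → Fun T n' m') : Fun T n' m' :=
  fun t x y => f t (fun i => a i t x y) (fun j => b j t x y)

/-- A family of genus-zero spectral curves, indexed by a moduli space `T`, with an open region
`P t` of the curve on which both coverings `x` and `y` are regular, unramified and injective. The
region fixes the branches `z(x)` and `z(y)` and hence the functions `Y(x)` and `X(y)`. -/
structure CurveFamily (T : Type*) where
  curve : T → SpectralCurve
  P : T → Set ℂ
  isOpen_P : ∀ t, IsOpen (P t)
  x_unramified : ∀ t, ∀ z ∈ P t, Regular (curve t).x z ∧ deriv (ev (curve t).x) z ≠ 0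
  y_unramified : ∀ t, ∀ z ∈ P t, Regular (curve t).y z ∧ deriv (ev (curve t).y) z ≠ 0
  x_injOn : ∀ t, Set.InjOn (ev (curve t).x) (P t)
  y_injOn : ∀ t, Set.InjOn (ev (curve t).y) (P t)

namespace CurveFamily

variable {T : Type*} (F : CurveFamily T)

/-- The local inverse `z(x)` of the covering `x`. -/
def zx (t : T) : ℂ → ℂ := branch (F.curve t).x (F.P t)

/-- The local inverse `z(y)` of the covering `y`. -/
def zy (t : T) : ℂ → ℂ := branch (F.curve t).y (F.P t)

/-- `X(y)`. -/
def X (t : T) (y : ℂ) : ℂ := ev (F.curve t).x (F.zy t y)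

/-- `W⁽⁰⁾_{k,0}`, from topological recursion on `(ℙ¹, x, y, B)`; in particular `W⁽⁰⁾_{1,0} = Y`. -/
def W (k : ℕ) (t : T) (x : Fin k → ℂ) : ℂ := corr (F.curve t).x (F.curve t).y (F.P t) k x

/-- `W⁽⁰⁾_{0,k}`, from topological recursion on `(ℙ¹, y, x, B)`; in particular `W⁽⁰⁾_{0,1} = X`. -/
def W' (k : ℕ) (t : T) (y : Fin k → ℂ) : ℂ := corr (F.curve t).y (F.curve t).x (F.P t) k y

/-- The domain of functions of `x₁,…,xₙ` and `y₁,…,y_m`: the variables lie in the ranges of the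
coverings on `P t`, and the `n + m` corresponding points of the curve are pairwise distinct. -/
def InDom {n m : ℕ} (t : T) (x : Fin n → ℂ) (y : Fin m → ℂ) : Prop :=
  (∀ i, x i ∈ ev (F.curve t).x '' F.P t) ∧ (∀ j, y j ∈ ev (F.curve t).y '' F.P t) ∧
    Function.Injective (Sum.elim (fun i => F.zx t (x i)) (fun j => F.zy t (y j)))

/-- Equality on the domain. -/
def EqDom {n m : ℕ} (f g : Fun T n m) : Prop :=
  ∀ t x y, F.InDom t x y → f t x y = g t x y

end CurveFamily

/-- A class of functions on which loop insertion operators may act: functions analytic in the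
variables `xᵢ`, `y_j` on the domain, closed under the algebra operations, the derivatives with
respect to the variables and substitution, and containing the constants, the variables and the
correlators `W⁽⁰⁾_{k,0}`, `W⁽⁰⁾_{0,k}`. -/
structure FunctionClass {T : Type*} (F : CurveFamily T) where
  Adm : {n m : ℕ} → Fun T n m → Prop
  analytic : ∀ {n m : ℕ} (f : Fun T n m), Adm f → ∀ t x y, F.InDom t x y →
    AnalyticAt ℂ (fun p : (Fin n → ℂ) × (Fin m → ℂ) => f t p.1 p.2) (x, y)
  congr : ∀ {n m : ℕ} (f g : Fun T n m), Adm f → F.EqDom f g → Adm g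
  const : ∀ {n m : ℕ} (c : ℂ), Adm (fun _ _ _ => c : Fun T n m)
  varX : ∀ {n m : ℕ} (i : Fin n), Adm (fun _ x _ => x i : Fun T n m)
  varY : ∀ {n m : ℕ} (j : Fin m), Adm (fun _ _ y => y j : Fun T n m)
  add : ∀ {n m : ℕ} (f g : Fun T n m), Adm f → Adm g → Adm (fun t x y => f t x y + g t x y)
  mul : ∀ {n m : ℕ} (f g : Fun T n m), Adm f → Adm g → Adm (fun t x y => f t x y * g t x y)
  dX : ∀ {n m : ℕ} (i : Fin n) (f : Fun T n m), Adm f → Adm (dX i f)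
  dY : ∀ {n m : ℕ} (j : Fin m) (f : Fun T n m), Adm f → Adm (dY j f)
  subst : ∀ {n m n' m' : ℕ} (f : Fun T n m) (a : Fin n → Fun T n' m') (b : Fin m → Fun T n' m'),
    Adm f → (∀ i, Adm (a i)) → (∀ j, Adm (b j)) →
    (∀ t x y, F.InDom t x y → F.InDom t (fun i => a i t x y) (fun j => b j t x y)) →
    Adm (subst f a b)
  W : ∀ k, Adm (fun t x _ => F.W (k + 1) t x : Fun T (k + 1) 0)
  W' : ∀ k, Adm (fun t _ y => F.W' (k + 1) t y : Fun T 0 (k + 1))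

/-- A loop insertion operator `D_x`. It sends a function of `x₁,…,xₙ | y₁,…,y_m` to a function of
`x,x₁,…,xₙ | y₁,…,y_m` (the new variable `x` comes first), is linear, satisfies the Leibniz and the
chain rule, regards the variables `xᵢ`, `y_j` as fixed (hence commutes with the derivatives with
respect to them), and maps `W⁽⁰⁾_{k,0}` to `W⁽⁰⁾_{k+1,0}`. -/
structure LoopInsertionX {T : Type*} {F : CurveFamily T} (A : FunctionClass F) where
  D : {n m : ℕ} → Fun T n m → Fun T (n + 1) m
  adm : ∀ {n m : ℕ} (f : Fun T n m), A.Adm f → A.Adm (D f)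
  congr : ∀ {n m : ℕ} (f g : Fun T n m), A.Adm f → A.Adm g → F.EqDom f g → F.EqDom (D f) (D g)
  const : ∀ {n m : ℕ} (c : ℂ), F.EqDom (D (fun _ _ _ => c : Fun T n m)) (fun _ _ _ => 0)
  add : ∀ {n m : ℕ} (f g : Fun T n m), A.Adm f → A.Adm g →
    F.EqDom (D fun t x y => f t x y + g t x y) (fun t x y => D f t x y + D g t x y)
  leibniz : ∀ {n m : ℕ} (f g : Fun T n m), A.Adm f → A.Adm g →
    F.EqDom (D fun t x y => f t x y * g t x y)
      (fun t x y => D f t x y * g t (Fin.tail x) y + f t (Fin.tail x) y * D g t x y)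
  chain : ∀ {n m n' m' : ℕ} (f : Fun T n m) (a : Fin n → Fun T n' m') (b : Fin m → Fun T n' m'),
    A.Adm f → (∀ i, A.Adm (a i)) → (∀ j, A.Adm (b j)) →
    (∀ t x y, F.InDom t x y → F.InDom t (fun i => a i t x y) (fun j => b j t x y)) →
    ∀ (t : T) (ξ : ℂ) (x : Fin n' → ℂ) (y : Fin m' → ℂ), F.InDom t (Fin.cons ξ x : Fin (n' + 1) → ℂ) y →
      F.InDom t (Fin.cons ξ (fun i => a i t x y) : Fin (n + 1) → ℂ) (fun j => b j t x y) →
      D (subst f a b) t (Fin.cons ξ x) y =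
        D f t (Fin.cons ξ (fun i => a i t x y)) (fun j => b j t x y) +
        ∑ i, subst (dX i f) a b t x y * D (a i) t (Fin.cons ξ x) y +
        ∑ j, subst (dY j f) a b t x y * D (b j) t (Fin.cons ξ x) y
  varX : ∀ {n m : ℕ} (i : Fin n), F.EqDom (D (fun _ x _ => x i : Fun T n m)) (fun _ _ _ => 0)
  varY : ∀ {n m : ℕ} (j : Fin m), F.EqDom (D (fun _ _ y => y j : Fun T n m)) (fun _ _ _ => 0)
  comm_dX : ∀ {n m : ℕ} (i : Fin n) (f : Fun T n m), A.Adm f →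
    F.EqDom (D (dX i f)) (dX i.succ (D f))
  comm_dY : ∀ {n m : ℕ} (j : Fin m) (f : Fun T n m), A.Adm f →
    F.EqDom (D (dY j f)) (dY j (D f))
  insertion : ∀ k, F.EqDom (D (fun t x _ => F.W (k + 1) t x : Fun T (k + 1) 0))
    (fun t x _ => F.W (k + 2) t x)

/-- A loop insertion operator `D̃_y`: the same with the roles of `x` and `y` interchanged. -/
structure LoopInsertionY {T : Type*} {F : CurveFamily T} (A : FunctionClass F) where
  D : {n m : ℕ} → Fun T n m → Fun T n (m + 1)
  adm : ∀ {n m : ℕ} (f : Fun T n m), A.Adm f → A.Adm (D f)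
  congr : ∀ {n m : ℕ} (f g : Fun T n m), A.Adm f → A.Adm g → F.EqDom f g → F.EqDom (D f) (D g)
  const : ∀ {n m : ℕ} (c : ℂ), F.EqDom (D (fun _ _ _ => c : Fun T n m)) (fun _ _ _ => 0)
  add : ∀ {n m : ℕ} (f g : Fun T n m), A.Adm f → A.Adm g →
    F.EqDom (D fun t x y => f t x y + g t x y) (fun t x y => D f t x y + D g t x y)
  leibniz : ∀ {n m : ℕ} (f g : Fun T n m), A.Adm f → A.Adm g →
    F.EqDom (D fun t x y => f t x y * g t x y)
      (fun t x y => D f t x y * g t x (Fin.tail y) + f t x (Fin.tail y) * D g t x y)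
  chain : ∀ {n m n' m' : ℕ} (f : Fun T n m) (a : Fin n → Fun T n' m') (b : Fin m → Fun T n' m'),
    A.Adm f → (∀ i, A.Adm (a i)) → (∀ j, A.Adm (b j)) →
    (∀ t x y, F.InDom t x y → F.InDom t (fun i => a i t x y) (fun j => b j t x y)) →
    ∀ (t : T) (η : ℂ) (x : Fin n' → ℂ) (y : Fin m' → ℂ), F.InDom t x (Fin.cons η y : Fin (m' + 1) → ℂ) →
      F.InDom t (fun i => a i t x y) (Fin.cons η (fun j => b j t x y) : Fin (m + 1) → ℂ) →
      D (subst f a b) t x (Fin.cons η y) =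
        D f t (fun i => a i t x y) (Fin.cons η (fun j => b j t x y)) +
        ∑ i, subst (dX i f) a b t x y * D (a i) t x (Fin.cons η y) +
        ∑ j, subst (dY j f) a b t x y * D (b j) t x (Fin.cons η y)
  varX : ∀ {n m : ℕ} (i : Fin n), F.EqDom (D (fun _ x _ => x i : Fun T n m)) (fun _ _ _ => 0)
  varY : ∀ {n m : ℕ} (j : Fin m), F.EqDom (D (fun _ _ y => y j : Fun T n m)) (fun _ _ _ => 0)
  comm_dX : ∀ {n m : ℕ} (i : Fin n) (f : Fun T n m), A.Adm f →
    F.EqDom (D (dX i f)) (dX i (D f))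
  comm_dY : ∀ {n m : ℕ} (j : Fin m) (f : Fun T n m), A.Adm f →
    F.EqDom (D (dY j f)) (dY j.succ (D f))
  insertion : ∀ k, F.EqDom (D (fun t _ y => F.W' (k + 1) t y : Fun T 0 (k + 1)))
    (fun t _ y => F.W' (k + 2) t y)

section Correlators

variable {T : Type*} {F : CurveFamily T} {A : FunctionClass F}

/-- The loop insertion operators commute: `D_x D̃_y = D̃_y D_x`. -/
def LoopCommute (D : LoopInsertionX A) (D' : LoopInsertionY A) : Prop :=
  ∀ {n m : ℕ} (f : Fun T n m), A.Adm f → F.EqDom (D.D (D'.D f)) (D'.D (D.D f))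

/-- `D̃_{y₁} … D̃_{y_m} W⁽⁰⁾_{1,0}(x)`. -/
def iterYX (D' : LoopInsertionY A) : (m : ℕ) → Fun T 1 m
  | 0 => fun t x _ => F.W 1 t x
  | m + 1 => D'.D (iterYX D' m)

/-- `D_{x₁} … D_{xₙ} D̃_{y₁} … D̃_{y_m} W⁽⁰⁾_{1,0}(x)`, as a function of `x₁,…,xₙ,x | y₁,…,y_m`. -/
def iterX (D : LoopInsertionX A) (D' : LoopInsertionY A) (m : ℕ) : (n : ℕ) → Fun T (n + 1) m
  | 0 => iterYX D' m
  | n + 1 => D.D (iterX D D' m n)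

/-- `W⁽⁰⁾_{n+1,m}(x₁,…,x_{n+1} | y₁,…,y_m) = D_{x₂} … D_{x_{n+1}} D̃_{y₁} … D̃_{y_m} W⁽⁰⁾_{1,0}(x₁)`. -/
def corrFromX (D : LoopInsertionX A) (D' : LoopInsertionY A) (n m : ℕ) : Fun T (n + 1) m :=
  fun t x y => iterX D D' m n t (fun i => x (finRotate (n + 1) i)) y

/-- `D̃_{y₁} … D̃_{y_m} W⁽⁰⁾_{0,1}(y)`, as a function of `y₁,…,y_m,y`. -/
def iterYY (D' : LoopInsertionY A) : (m : ℕ) → Fun T 0 (m + 1)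
  | 0 => fun t _ y => F.W' 1 t y
  | m + 1 => D'.D (iterYY D' m)

/-- `D_{x₁} … D_{xₙ} D̃_{y₁} … D̃_{y_m} W⁽⁰⁾_{0,1}(y)`, as a function of `x₁,…,xₙ | y₁,…,y_m,y`. -/
def iterY (D : LoopInsertionX A) (D' : LoopInsertionY A) (m : ℕ) : (n : ℕ) → Fun T n (m + 1)
  | 0 => iterYY D' m
  | n + 1 => D.D (iterY D D' m n)

/-- `W⁽⁰⁾_{n,m+1}(x₁,…,xₙ | y₁,…,y_{m+1}) = D_{x₁} … D_{xₙ} D̃_{y₂} … D̃_{y_{m+1}} W⁽⁰⁾_{0,1}(y₁)`. -/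
def corrFromY (D : LoopInsertionX A) (D' : LoopInsertionY A) (n m : ℕ) : Fun T n (m + 1) :=
  fun t x y => iterY D D' m n t x (fun j => y (finRotate (m + 1) j))

end Correlators

/-! ### Trees -/

/-- Vertices: `n` labelled `□`-vertices, `m` labelled `○`-vertices, and `b` `●`-vertices. -/
inductive Vertex (n m b : ℕ) where
  | box (i : Fin n)
  | circ (j : Fin m)
  | bullet (k : Fin b)

/-- `●`-vertices are black, `□`- and `○`-vertices are white. -/
def Vertex.IsBlack {n m b : ℕ} : Vertex n m b → Prop
  | .bullet _ => True
  | _ => False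

/-- A decorated tree with labelled `□`- and `○`-vertices (on a numbered set of `●`-vertices). -/
structure DecoratedTree (n m : ℕ) where
  b : ℕ
  graph : SimpleGraph (Vertex n m b)
  isTree : graph.IsTree
  two_le_valence : ∀ k, 2 ≤ (graph.neighborSet (.bullet k)).ncard
  bipartite : ∀ u v, graph.Adj u v → (u.IsBlack ↔ ¬ v.IsBlack)
  box_valence : ∀ i, (graph.neighborSet (.box i)).ncard = 1

namespace DecoratedTree

variable {n m : ℕ}

/-- Isomorphisms of decorated trees: graph isomorphisms that preserve the labels. -/
def Iso (S S' : DecoratedTree n m) : Type :=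
  {e : S.graph ≃g S'.graph // (∀ i, e (.box i) = .box i) ∧ ∀ j, e (.circ j) = .circ j}

/-- The isomorphism relation. -/
instance setoid (n m : ℕ) : Setoid (DecoratedTree n m) where
  r S S' := Nonempty (Iso S S')
  iseqv :=
    { refl := fun _ => ⟨⟨RelIso.refl _, fun _ => rfl, fun _ => rfl⟩⟩
      symm := fun ⟨e, h1, h2⟩ => ⟨⟨e.symm, fun i => (RelIso.symm_apply_eq e).2 (h1 i).symm,
        fun j => (RelIso.symm_apply_eq e).2 (h2 j).symm⟩⟩
      trans := fun ⟨e, h1, h2⟩ ⟨e', h1', h2'⟩ => ⟨⟨e.trans e',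
        fun i => by rw [RelIso.trans_apply, h1, h1'], fun j => by rw [RelIso.trans_apply, h2, h2']⟩⟩ }

/-- `Aut(S)`, the number of automorphisms. -/
def aut (S : DecoratedTree n m) : ℕ := Nat.card (Iso S S)

/-- `r_j(S)`, the valence of the `j`-th `○`-vertex. -/
def r (S : DecoratedTree n m) (j : Fin m) : ℕ := (S.graph.neighborSet (.circ j)).ncard

open Classical in
/-- The set `𝓘(S)` of the pairs `(I, J)` of the label sets of the `□`- and of the `○`-vertices
connected to a `●`-vertex. -/
def doubleSets (S : DecoratedTree n m) : Finset (Finset (Fin n) × Finset (Fin m)) :=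
  Finset.univ.image fun k : Fin S.b =>
    (Finset.univ.filter fun i => S.graph.Adj (.box i) (.bullet k),
      Finset.univ.filter fun j => S.graph.Adj (.circ j) (.bullet k))

end DecoratedTree

/-- The set `𝓖_{n,m}` of decorated trees (up to isomorphism). -/
abbrev Trees (n m : ℕ) := Quotient (DecoratedTree.setoid n m)

namespace CurveFamily

variable {T : Type*} (F : CurveFamily T) {n m : ℕ}

/-- `∏_k (-dX(y_k)/dy_k) ∏_{(I,J) ∈ 𝓘(S)} W⁽⁰⁾_{|I|+|J|,0}(x_I, X(y_J))`. -/
def preweight (S : DecoratedTree n m) : Fun T n m := fun t x y =>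
  (∏ k, -deriv (F.X t) (y k)) *
    ∏ p ∈ S.doubleSets, F.W (p.1.card + p.2.card) t
      (Fin.append (fun i => x (p.1.orderEmbOfFin rfl i))
        (fun j => F.X t (y (p.2.orderEmbOfFin rfl j))))

/-- The weight `φ(S) = ∏_j (-d/dy_j)^{r_j(S)-1} (preweight)`. -/
def weight (S : DecoratedTree n m) : Fun T n m :=
  (List.finRange m).foldr (fun j g => (fun h : Fun T n m => -dY j h)^[S.r j - 1] g) (F.preweight S)

/-- `∑_{S ∈ 𝓖_{n,m}} φ(S) / Aut(S)`, evaluated on a representative of each isomorphism class. -/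
def treeSum (n m : ℕ) : Fun T n m := fun t x y =>
  ∑ᶠ S : Trees n m, 1 / (S.out.aut : ℂ) * F.weight S.out t x y

end CurveFamily

end XYSymmetry

end

/-!
Since an automorphism that fixes the labels of a tree in `𝓖_{n,m}` is the identity, such a tree is
the same thing as a *hypertree* on the `n + m` labelled vertices, the hyperedges being the
neighbourhoods of the `●`-vertices (`DecoratedTree.finsum_trees`). A set `H` of hyperedges of size
at least two is a hypertree if it is connected and `∑_{E ∈ H} |E| + 1 = |V| + |H|`. In these terms
the right-hand side is the sum over hypertrees, with `□`-vertices of degree one, of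
`∏_j (-∂_j)^{deg j - 1} (∏_k (-X'(y_k)) ∏_{E ∈ H} W_E)`, where `W_E` is `W_{|E|,0}` at the
`x`-coordinates of the points of `E` (`treeFun`). The theorem follows by induction on the number of
variables, in which the `○`-vertices are added first and then the `□`-vertices, once each loop
insertion operator is shown to add one vertex to this sum.

*Base.* `W_{0,2}(y₁,y₂) = X'(y₁) X'(y₂) W_{2,0}(X(y₁),X(y₂))`, since both are the Bergman kernel.
Applying `D_x` to `Y(X(y)) = y` gives `D_x X(y) = -X'(y) W_{2,0}(x, X(y))` (`D_XF_one`), and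
applying `D̃_y` to `X(Y(x)) = x` gives `D̃_y Y(x) = D_x X(y)` (`D'_W_one`); the latter, with
`D_x D̃_y = D̃_y D_x`, shows that the two expressions for `W_{n,m}` agree up to the order of the
variables.

*Insertion of `x`.* Put `M_j = W_{2,0}(x, X(y_j))`. By the chain rule the derivation
`Δ = D_x + ∑_j M_j ∂_j` maps `W_E` to `W_{E ∪ x}`, and it maps `-X'(y_k)` to `(∂_k M_k) X'(y_k)`.
The Leibniz rule for `Δ` then gives `D_x` of a product as the sum of the products with one `W_E`
replaced by `W_{E ∪ x}`, plus `∑_j (-∂_j)(M_j · product)` (`IsInsertion.prod_mul_prod`). The former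
attach `x` to an existing hyperedge, the latter add the hyperedge `{x, y_j}`, and the additional
derivative accounts for the raised degree of `y_j`. These are all the ways in which a vertex of
degree one can be added to a hypertree (`sum_boxTrees_succ`), so `D_x` adds a `□`-vertex
(`D_treeFun`).

*Insertion of `y`.* The same computation applies with `M_j = -X'(y) W_{2,0}(X(y), X(y_j))`, but now
`Δ` maps `W_E` to `D̃_y W_{|E|,0}` at the points of `E`. As `D̃_y` commutes with the operators that
generate `W_{k,0}` from `Y`, this is the sum over hypertrees with `k` `□`-vertices and one
`○`-vertex (`D'_W`), that is, a sum over the partitions `π` of `E` of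
`(-∂_y)^{|π| - 1} (-X'(y) ∏_{B ∈ π} W_{B ∪ y})` (`treeFun_one_coord`). Splitting a hyperedge along a
partition and joining the blocks to `y`, or adding a hyperedge `{y, y_j}`, are all the ways in which
a vertex can be added to a hypertree (`sum_hypertrees_insert`), so `D̃_y` adds a `○`-vertex
(`D'_treeFun`).

The symmetry of the correlators, which makes `W_E` independent of the order of the points, follows
from the chain rule for permutations of the variables and from the form of the recursion
(`W_symm`).
-/

noncomputable section

namespace XYSymmetry

/-! ### Hypertrees -/

section Hypertree

variable {α β ι : Type*}

/-- The bipartite incidence graph of a family `N` of subsets of `α`: the point `a` is joined to the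
index `k` if `a ∈ N k`. -/
def incidence (N : ι → Finset α) : SimpleGraph (α ⊕ ι) where
  Adj
    | .inl a, .inr k => a ∈ N k
    | .inr k, .inl a => a ∈ N k
    | _, _ => False
  symm := ⟨by rintro (a | k) (b | l) h <;> exact h⟩
  loopless := ⟨by rintro (a | k) h <;> exact h⟩

/-- A family of subsets is connecting if every predicate that is constant along its members is
constant. -/
def Connecting (N : ι → Finset α) : Prop :=
  ∀ p : α → Prop, (∀ k, ∀ a ∈ N k, ∀ b ∈ N k, p a → p b) → ∀ a b, p a → p b

theorem incidence_connected_iff [Nonempty α] {N : ι → Finset α} (hN : ∀ k, (N k).Nonempty) :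
    (incidence N).Connected ↔ Connecting N := by
  constructor
  · intro h p hp a b ha
    let q : α ⊕ ι → Prop := Sum.elim p fun k => ∃ c ∈ N k, p c
    have step : ∀ u v, (incidence N).Adj u v → q u → q v := by
      rintro (u | k) (w | l) huv hu
      · exact huv.elim
      · exact ⟨u, huv, hu⟩
      · obtain ⟨c, hc, hpc⟩ := hu
        exact hp k c hc w huv hpc
      · exact huv.elim
    obtain ⟨w⟩ := h.preconnected (.inl a) (.inl b)
    have key : ∀ u v, (incidence N).Walk u v → q u → q v := by
      intro u v w
      induction w with
      | nil => exact id
      | cons hadj _ ih => exact fun hu => ih (step _ _ hadj hu)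
    exact key _ _ w ha
  · intro h
    obtain ⟨a₀⟩ := ‹Nonempty α›
    have hreach : ∀ a, (incidence N).Reachable (.inl a₀) (.inl a) := by
      intro a
      refine h (fun a => (incidence N).Reachable (.inl a₀) (.inl a)) ?_ a₀ a (.refl _)
      intro k a ha b hb hra
      have h1 : (incidence N).Adj (.inl a) (.inr k) := ha
      have h2 : (incidence N).Adj (.inr k) (.inl b) := hb
      exact (hra.trans h1.reachable).trans h2.reachable
    refine SimpleGraph.connected_iff_exists_forall_reachable _ |>.2 ⟨.inl a₀, ?_⟩
    rintro (a | k)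
    · exact hreach a
    · obtain ⟨a, ha⟩ := hN k
      have h1 : (incidence N).Adj (.inl a) (.inr k) := ha
      exact (hreach a).trans h1.reachable

/-- The number of edges of the incidence graph is the number of incidences. -/
theorem card_edgeSet_incidence [Fintype ι] (N : ι → Finset α) :
    Nat.card (incidence N).edgeSet = ∑ k, (N k).card := by
  classical
  have e : (Σ k, N k) ≃ (incidence N).edgeSet := by
    refine Equiv.ofBijective
      (fun p => ⟨s(.inl p.2.1, .inr p.1), (SimpleGraph.mem_edgeSet _).2 p.2.2⟩) ⟨?_, ?_⟩
    · rintro ⟨k, a, ha⟩ ⟨l, b, hb⟩ h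
      have h := congrArg Subtype.val h
      simp only [Sym2.eq_iff, Sum.inl.injEq, Sum.inr.injEq, reduceCtorEq, or_false,
        and_self] at h
      obtain ⟨rfl, rfl⟩ := h
      rfl
    · rintro ⟨s, hs⟩
      induction s using Sym2.ind with
      | _ u v =>
        rcases u with a | k <;> rcases v with b | l
        · exact hs.elim
        · exact ⟨⟨l, a, hs⟩, rfl⟩
        · exact ⟨⟨k, b, hs⟩, Subtype.ext Sym2.eq_swap⟩
        · exact hs.elim
  rw [← Nat.card_congr e, Nat.card_eq_fintype_card, Fintype.card_sigma]
  simp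

theorem incidence_isTree_iff [Fintype α] [Nonempty α] [Fintype ι] {N : ι → Finset α}
    (hN : ∀ k, (N k).Nonempty) :
    (incidence N).IsTree ↔
      Connecting N ∧ ∑ k, (N k).card + 1 = Fintype.card α + Fintype.card ι := by
  rw [SimpleGraph.isTree_iff_connected_and_card, incidence_connected_iff hN,
    card_edgeSet_incidence, Nat.card_eq_fintype_card, Fintype.card_sum]

theorem Connecting.card_le [Fintype α] [Nonempty α] [Fintype ι] {N : ι → Finset α}
    (hN : ∀ k, (N k).Nonempty) (h : Connecting N) :
    Fintype.card α + Fintype.card ι ≤ ∑ k, (N k).card + 1 := by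
  have h1 := ((incidence_connected_iff hN).2 h).card_vert_le_card_edgeSet_add_one
  rwa [card_edgeSet_incidence, Nat.card_eq_fintype_card, Fintype.card_sum] at h1

/-- A set `H` of hyperedges on the vertex set `α` is a hypertree if all hyperedges have at least
two elements and its incidence graph is a tree. The latter is encoded by connectedness and by the
value of the Euler characteristic. -/
structure IsHypertree [Fintype α] (H : Finset (Finset α)) : Prop where
  two_le : ∀ E ∈ H, 2 ≤ E.card
  conn : ∀ p : α → Prop, (∀ E ∈ H, ∀ a ∈ E, ∀ b ∈ E, p a → p b) → ∀ a b, p a → p b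
  card : ∑ E ∈ H, E.card + 1 = Fintype.card α + H.card

theorem card_le_of_conn [Fintype α] [Nonempty α] {H : Finset (Finset α)}
    (hH : ∀ E ∈ H, 2 ≤ E.card)
    (h : ∀ p : α → Prop, (∀ E ∈ H, ∀ a ∈ E, ∀ b ∈ E, p a → p b) → ∀ a b, p a → p b) :
    Fintype.card α + H.card ≤ ∑ E ∈ H, E.card + 1 := by
  have h1 := Connecting.card_le (N := fun k : H => k.1)
    (fun k => Finset.card_pos.1 (by have := hH _ k.2; omega))
    (fun p hp => h p fun E hE => hp ⟨E, hE⟩)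
  rw [Finset.sum_coe_sort H fun E => E.card] at h1
  simpa using h1

variable [DecidableEq α] [DecidableEq β]

/-- The number of hyperedges that contain `a`. -/
def deg (H : Finset (Finset α)) (a : α) : ℕ := (H.filter fun E => a ∈ E).card

theorem IsHypertree.deg_pos [Fintype α] [Nontrivial α] {H : Finset (Finset α)}
    (hH : IsHypertree H) (a : α) : 0 < deg H a := by
  by_contra h0
  have h0 : ∀ E ∈ H, a ∉ E := by
    simpa [deg, Finset.filter_eq_empty_iff] using h0
  obtain ⟨b, hb⟩ := exists_ne a
  refine hb (hH.conn (fun c => c = a) ?_ a b rfl)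
  rintro E hE c hc _ _ rfl
  exact (h0 E hE hc).elim

open Classical in
/-- The hypertrees on the vertex set `α`. -/
def hypertrees (α : Type*) [Fintype α] : Finset (Finset (Finset α)) :=
  Finset.univ.filter IsHypertree

omit [DecidableEq α] in
theorem mem_hypertrees [Fintype α] {H : Finset (Finset α)} : H ∈ hypertrees α ↔ IsHypertree H := by
  simp [hypertrees]

/-- The partitions of `E` into nonempty blocks. -/
def parts (E : Finset α) : Finset (Finset (Finset α)) :=
  E.powerset.powerset.filter fun π => ∅ ∉ π ∧ ∀ a ∈ E, deg π a = 1

theorem mem_parts {E : Finset α} {π : Finset (Finset α)} :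
    π ∈ parts E ↔ (∀ B ∈ π, B ⊆ E) ∧ ∅ ∉ π ∧ ∀ a ∈ E, deg π a = 1 := by
  simp [parts, Finset.subset_iff]

/-- Double counting of the incidences of the members of `π` and the points of `E`. -/
theorem sum_deg {E : Finset α} {π : Finset (Finset α)} (h : ∀ B ∈ π, B ⊆ E) :
    ∑ a ∈ E, deg π a = ∑ B ∈ π, B.card := by
  simp_rw [deg, Finset.card_filter]
  rw [Finset.sum_comm]
  refine Finset.sum_congr rfl fun B hB => ?_
  rw [← Finset.card_filter, Finset.filter_mem_eq_inter, Finset.inter_eq_right.2 (h B hB)]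

theorem singleton_mem_parts {E : Finset α} (hE : E.Nonempty) : {E} ∈ parts E := by
  refine mem_parts.2 ⟨by simp, by simpa using hE.ne_empty.symm, fun a ha => ?_⟩
  simp [deg, Finset.filter_singleton, ha]

theorem exists_mem_of_mem_parts {E : Finset α} {π : Finset (Finset α)} (hπ : π ∈ parts E)
    {a : α} (ha : a ∈ E) : ∃ B ∈ π, a ∈ B := by
  have h := (mem_parts.1 hπ).2.2 a ha
  have h : (π.filter fun B => a ∈ B).Nonempty := Finset.card_pos.1 (by rw [deg] at h; omega)
  obtain ⟨B, hB⟩ := h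
  exact ⟨B, Finset.mem_filter.1 hB⟩

theorem card_parts_eq_one_iff {E : Finset α} {π : Finset (Finset α)} (hπ : π ∈ parts E) :
    π.card = 1 ↔ π = {E} := by
  refine ⟨fun h => ?_, fun h => by simp [h]⟩
  obtain ⟨B, rfl⟩ := Finset.card_eq_one.1 h
  congr 1
  refine ((mem_parts.1 hπ).1 B (by simp)).antisymm fun a ha => ?_
  obtain ⟨B', hB', hab⟩ := exists_mem_of_mem_parts hπ ha
  rwa [← Finset.mem_singleton.1 hB']

theorem deg_image_map (ι : α ↪ β) (H : Finset (Finset α)) (a : α) :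
    deg (H.image fun E => E.map ι) (ι a) = deg H a := by
  rw [deg, deg, Finset.filter_image, Finset.card_image_of_injective _ (Finset.map_injective ι)]
  simp

end Hypertree

/-! ### Adding one vertex to a hypertree -/

section Insertion

variable {α β : Type*} [DecidableEq β] (ι : α ↪ β) (v : β)

/-- The family of subsets of `β` obtained from `K` by the embedding `ι`, together with the blocks of
`π`, to each of which the vertex `v` is added. -/
def build (K π : Finset (Finset α)) : Finset (Finset β) :=
  K.image (fun B => B.map ι) ∪ π.image fun B => insert v (B.map ι)

variable {ι v}

theorem mem_build {K π : Finset (Finset α)} {e : Finset β} :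
    e ∈ build ι v K π ↔ (∃ B ∈ K, B.map ι = e) ∨ ∃ B ∈ π, insert v (B.map ι) = e := by
  simp [build]

variable (hv : ∀ a, ι a ≠ v)

include hv

omit [DecidableEq β] in
theorem notMem_map (B : Finset α) : v ∉ B.map ι := by
  simpa using fun a _ => hv a

theorem grow_injective : Function.Injective fun B : Finset α => insert v (B.map ι) := by
  intro B B' h
  have h := congrArg (fun e => e.erase v) h
  simp only [Finset.erase_insert (notMem_map hv _)] at h
  exact Finset.map_injective ι h

theorem disjoint_build (K π : Finset (Finset α)) :
    Disjoint (K.image fun B => B.map ι) (π.image fun B => insert v (B.map ι)) := by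
  rw [Finset.disjoint_left]
  rintro _ h h'
  obtain ⟨B, -, rfl⟩ := Finset.mem_image.1 h
  obtain ⟨B', -, h'⟩ := Finset.mem_image.1 h'
  exact notMem_map hv B (h' ▸ Finset.mem_insert_self _ _)

theorem sum_build {M : Type*} [AddCommMonoid M] (K π : Finset (Finset α)) (f : Finset β → M) :
    ∑ e ∈ build ι v K π, f e = ∑ B ∈ K, f (B.map ι) + ∑ B ∈ π, f (insert v (B.map ι)) := by
  rw [build, Finset.sum_union (disjoint_build hv K π),
    Finset.sum_image (Finset.map_injective ι).injOn, Finset.sum_image (grow_injective hv).injOn]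

theorem prod_build {M : Type*} [CommMonoid M] (K π : Finset (Finset α)) (f : Finset β → M) :
    ∏ e ∈ build ι v K π, f e = (∏ B ∈ K, f (B.map ι)) * ∏ B ∈ π, f (insert v (B.map ι)) := by
  rw [build, Finset.prod_union (disjoint_build hv K π),
    Finset.prod_image (Finset.map_injective ι).injOn, Finset.prod_image (grow_injective hv).injOn]

theorem card_build (K π : Finset (Finset α)) : (build ι v K π).card = K.card + π.card := by
  simpa [-Finset.sum_const, Finset.card_eq_sum_ones] using sum_build hv K π fun _ => 1

theorem deg_build [DecidableEq α] (K π : Finset (Finset α)) (a : α) :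
    deg (build ι v K π) (ι a) = deg K a + deg π a := by
  simp only [deg, Finset.card_filter]
  rw [sum_build hv]
  simp [hv]

theorem deg_build_new (K π : Finset (Finset α)) : deg (build ι v K π) v = π.card := by
  simp only [deg, Finset.card_filter]
  rw [sum_build hv]
  simp [hv]

theorem build_injective {K K' π π' : Finset (Finset α)}
    (h : build ι v K π = build ι v K' π') : K = K' ∧ π = π' := by
  constructor <;> ext B
  · have h1 := Finset.ext_iff.1 h (B.map ι)
    simp only [mem_build, Finset.map_inj, exists_eq_right] at h1
    have h2 : ∀ π : Finset (Finset α), ¬ ∃ B' ∈ π, insert v (B'.map ι) = B.map ι :=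
      fun π ⟨B', _, h⟩ => notMem_map hv B (h ▸ Finset.mem_insert_self _ _)
    simpa [h2] using h1
  · have h1 := Finset.ext_iff.1 h (insert v (B.map ι))
    simp only [mem_build] at h1
    have h2 : ∀ K : Finset (Finset α), ¬ ∃ B' ∈ K, B'.map ι = insert v (B.map ι) :=
      fun K ⟨B', _, h⟩ => notMem_map hv B' (h ▸ Finset.mem_insert_self _ _)
    simpa [h2, (grow_injective hv).eq_iff] using h1

variable [Fintype α] [Fintype β] (hc : ∀ b, b = v ∨ ∃ a, ι a = b)

include hc

theorem card_eq_card_add_one : Fintype.card β = Fintype.card α + 1 := by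
  have h : (Finset.univ : Finset β) = insert v (Finset.univ.map ι) := by
    ext b
    simpa using hc b
  rw [← Finset.card_univ, h, Finset.card_insert_of_notMem (notMem_map hv _)]
  simp

omit [Fintype β] in
theorem exists_build_eq (H : Finset (Finset β)) : ∃ K π, build ι v K π = H := by
  classical
  let down : Finset β → Finset α := fun e => Finset.univ.filter fun a => ι a ∈ e
  have h1 : ∀ e, v ∉ e → (down e).map ι = e := by
    intro e he
    ext b
    rcases hc b with rfl | ⟨a, rfl⟩
    · simp [he, hv]
    · simp [down]
  have h2 : ∀ e, v ∈ e → insert v ((down e).map ι) = e := by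
    intro e he
    ext b
    rcases hc b with rfl | ⟨a, rfl⟩
    · simp [he]
    · simp [down, hv]
  refine ⟨(H.filter fun e => v ∉ e).image down, (H.filter fun e => v ∈ e).image down, ?_⟩
  ext e
  simp only [mem_build, Finset.mem_image, Finset.mem_filter]
  constructor
  · rintro (⟨_, ⟨e, ⟨he, hve⟩, rfl⟩, rfl⟩ | ⟨_, ⟨e, ⟨he, hve⟩, rfl⟩, rfl⟩)
    · rwa [h1 e hve]
    · rwa [h2 e hve]
  · intro he
    by_cases hve : v ∈ e
    · exact .inr ⟨_, ⟨e, ⟨he, hve⟩, rfl⟩, h2 e hve⟩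
    · exact .inl ⟨_, ⟨e, ⟨he, hve⟩, rfl⟩, h1 e hve⟩

/-- A new vertex may be attached to any old vertex by a hyperedge with two elements. -/
theorem isHypertree_build_singleton {K : Finset (Finset α)} (u : α) :
    IsHypertree (build ι v K {{u}}) ↔ IsHypertree K := by
  have hcard := card_eq_card_add_one hv hc
  have hs := sum_build hv K {{u}} Finset.card
  have hk := card_build hv K {{u}}
  have huv : ({u} : Finset α).map ι = {ι u} := by simp
  simp only [Finset.card_map, Finset.sum_singleton, Finset.card_singleton,
    Finset.card_insert_of_notMem (notMem_map hv _)] at hs hk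
  constructor
  · intro h
    refine ⟨fun E hE => ?_, fun p hp a b ha => ?_, by have := h.card; omega⟩
    · simpa using h.two_le (E.map ι) (mem_build.2 (.inl ⟨E, hE, rfl⟩))
    · have := h.conn (fun b => (b = v ∧ p u) ∨ ∃ a, ι a = b ∧ p a) ?_ (ι a) (ι b)
        (.inr ⟨a, rfl, ha⟩)
      · simpa [hv] using this
      · intro e he
        rcases mem_build.1 he with ⟨B, hB, rfl⟩ | ⟨B, hB, rfl⟩
        · simp only [Finset.mem_map, forall_exists_index, and_imp]
          rintro _ c hc rfl _ d hd rfl hq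
          have hq : p c := by simpa [hv] using hq
          exact .inr ⟨d, rfl, hp B hB c hc d hd hq⟩
        · obtain rfl := Finset.mem_singleton.1 hB
          simp [huv, hv]
  · intro h
    refine ⟨fun e he => ?_, fun p hp => ?_, by have := h.card; omega⟩
    · rcases mem_build.1 he with ⟨B, hB, rfl⟩ | ⟨B, hB, rfl⟩
      · simpa using h.two_le B hB
      · obtain rfl := Finset.mem_singleton.1 hB
        rw [Finset.card_insert_of_notMem (notMem_map hv _)]
        simp
    · have h1 := h.conn (fun a => p (ι a)) fun E hE a ha b hb hpa =>
        hp _ (mem_build.2 (.inl ⟨E, hE, rfl⟩)) _ (Finset.mem_map_of_mem ι ha) _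
          (Finset.mem_map_of_mem ι hb) hpa
      have hedge := hp (insert v (({u} : Finset α).map ι))
        (mem_build.2 (.inr ⟨{u}, by simp, rfl⟩))
      have h2 : p v → p (ι u) := hedge v (by simp) (ι u) (by simp)
      have h3 : p (ι u) → p v := hedge (ι u) (by simp) v (by simp)
      intro a b ha
      rcases hc a with rfl | ⟨a, rfl⟩ <;> rcases hc b with rfl | ⟨b, rfl⟩
      · exact ha
      · exact h1 u b (h2 ha)
      · exact h3 (h1 a u ha)
      · exact h1 a b ha

/-- Splitting a hyperedge `E` into blocks that are joined by the new vertex gives a hypertree. -/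
theorem isHypertree_build [DecidableEq α] {H : Finset (Finset α)} (hH : IsHypertree H)
    {E : Finset α} (hE : E ∈ H) {π : Finset (Finset α)} (hπ : π ∈ parts E) :
    IsHypertree (build ι v (H.erase E) π) := by
  have hcard := card_eq_card_add_one hv hc
  obtain ⟨hsub, hne, hdeg⟩ := mem_parts.1 hπ
  have hs := sum_build hv (H.erase E) π Finset.card
  have hk := card_build hv (H.erase E) π
  have hd : ∑ B ∈ π, B.card = E.card := by
    rw [← sum_deg hsub, Finset.sum_congr rfl hdeg]; simp
  have he := Finset.sum_erase_add H Finset.card hE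
  have hc' := Finset.card_erase_add_one hE
  simp only [Finset.card_map, Finset.card_insert_of_notMem (notMem_map hv _),
    Finset.sum_add_distrib, hd, Finset.sum_const, smul_eq_mul, mul_one] at hs
  refine ⟨fun e he => ?_, fun p hp => ?_, by have := hH.card; omega⟩
  · rcases mem_build.1 he with ⟨B, hB, rfl⟩ | ⟨B, hB, rfl⟩
    · simpa using hH.two_le B (Finset.mem_of_mem_erase hB)
    · rw [Finset.card_insert_of_notMem (notMem_map hv _), Finset.card_map]
      have : 0 < B.card := Finset.card_pos.2 (Finset.nonempty_iff_ne_empty.2 fun h => hne (h ▸ hB))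
      omega
  · have hedge : ∀ a ∈ E, p (ι a) ↔ p v := by
      intro a ha
      obtain ⟨B, hB, hab⟩ := exists_mem_of_mem_parts hπ ha
      have hedge := hp (insert v (B.map ι)) (mem_build.2 (.inr ⟨B, hB, rfl⟩))
      have h1 : ι a ∈ insert v (B.map ι) := Finset.mem_insert_of_mem (Finset.mem_map_of_mem ι hab)
      exact ⟨hedge _ h1 _ (by simp), hedge _ (by simp) _ h1⟩
    have h1 := hH.conn (fun a => p (ι a)) fun E' hE' a ha b hb hpa => by
      by_cases h : E' = E
      · subst h
        exact (hedge b hb).2 ((hedge a ha).1 hpa)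
      · exact hp _ (mem_build.2 (.inl ⟨E', Finset.mem_erase.2 ⟨h, hE'⟩, rfl⟩)) _
          (Finset.mem_map_of_mem ι ha) _ (Finset.mem_map_of_mem ι hb) hpa
    obtain ⟨u, hu⟩ : E.Nonempty := Finset.card_pos.1 (by have := hH.two_le E hE; omega)
    intro a b ha
    rcases hc a with rfl | ⟨a, rfl⟩ <;> rcases hc b with rfl | ⟨b, rfl⟩
    · exact ha
    · exact h1 u b ((hedge u hu).2 ha)
    · exact (hedge u hu).1 (h1 a u ha)
    · exact h1 a b ha

/-- Contraction of the vertex `v` of a hypertree. The hyperedges at `v` are merged into one. The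
bound of the Euler characteristic of connected families forces their blocks to be disjoint. -/
theorem exists_of_isHypertree_build [DecidableEq α] [Nonempty α] {K π : Finset (Finset α)}
    (h : IsHypertree (build ι v K π)) (hns : ∀ u, π ≠ {{u}}) :
    ∃ E ∉ K, IsHypertree (insert E K) ∧ π ∈ parts E := by
  have hcard := card_eq_card_add_one hv hc
  have hs := sum_build hv K π Finset.card
  have hk := card_build hv K π
  simp only [Finset.card_map, Finset.card_insert_of_notMem (notMem_map hv _),
    Finset.sum_add_distrib, Finset.sum_const, smul_eq_mul, mul_one] at hs
  -- The merged hyperedge.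
  set E := π.biUnion id with hE
  have hsub : ∀ B ∈ π, B ⊆ E := fun B hB => Finset.subset_biUnion_of_mem id hB
  have hne : ∅ ∉ π := fun h0 => by
    have := h.two_le (insert v ((∅ : Finset α).map ι)) (mem_build.2 (.inr ⟨∅, h0, rfl⟩))
    simp at this
  have hπ : π.Nonempty := by
    by_contra h0
    rw [Finset.not_nonempty_iff_eq_empty] at h0
    obtain ⟨a⟩ := ‹Nonempty α›
    refine hv a (h.conn (fun b => b = v) ?_ v (ι a) rfl)
    rintro e he _ hve _ _ rfl
    rcases mem_build.1 he with ⟨B, hB, rfl⟩ | ⟨B, hB, rfl⟩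
    · exact (notMem_map hv B hve).elim
    · simp [h0] at hB
  have hpos : ∀ B ∈ π, B.Nonempty := fun B hB =>
    Finset.nonempty_iff_ne_empty.2 fun h => hne (h ▸ hB)
  have hEtwo : 2 ≤ E.card := by
    by_contra hlt
    obtain ⟨B, hB⟩ := hπ
    obtain ⟨a, ha⟩ := hpos B hB
    have hEa : E ⊆ {a} := fun b hb => by
      have := Finset.card_le_one.1 (by omega : E.card ≤ 1) b hb a (hsub B hB ha)
      simp [this]
    have hall : ∀ B ∈ π, B = {a} := fun B hB =>
      ((hpos B hB).subset_singleton_iff).1 ((hsub B hB).trans hEa)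
    refine hns a (Finset.eq_singleton_iff_unique_mem.2 ⟨?_, hall⟩)
    rwa [← hall B hB]
  have hconn : ∀ p : α → Prop, (∀ e ∈ insert E K, ∀ a ∈ e, ∀ b ∈ e, p a → p b) →
      ∀ a b, p a → p b := by
    intro p hp a b ha
    have := h.conn (fun b => (b = v ∧ ∃ a ∈ E, p a) ∨ ∃ a, ι a = b ∧ p a) ?_ (ι a) (ι b)
      (.inr ⟨a, rfl, ha⟩)
    · simpa [hv] using this
    · have hpE := hp E (Finset.mem_insert_self _ _)
      intro e he
      rcases mem_build.1 he with ⟨B, hB, rfl⟩ | ⟨B, hB, rfl⟩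
      · simp only [Finset.mem_map, forall_exists_index, and_imp]
        rintro _ c hc rfl _ d hd rfl hq
        have hq : p c := by simpa [hv] using hq
        exact .inr ⟨d, rfl, hp B (Finset.mem_insert_of_mem hB) c hc d hd hq⟩
      · have key : ∀ x ∈ insert v (B.map ι),
            ((x = v ∧ ∃ a ∈ E, p a) ∨ ∃ a, ι a = x ∧ p a) ↔ ∃ a ∈ E, p a := by
          intro x hx
          rcases Finset.mem_insert.1 hx with rfl | hx
          · simp [hv]
          · obtain ⟨c, hc, rfl⟩ := Finset.mem_map.1 hx
            simp only [hv, false_and, EmbeddingLike.apply_eq_iff_eq, exists_eq_left, false_or]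
            exact ⟨fun h => ⟨c, hsub B hB hc, h⟩,
              fun ⟨a, ha, hpa⟩ => hpE a ha c (hsub B hB hc) hpa⟩
        intro x hx y hy hq
        exact (key y hy).2 ((key x hx).1 hq)
  have hKtwo : ∀ B ∈ K, 2 ≤ B.card := fun B hB => by
    simpa using h.two_le (B.map ι) (mem_build.2 (.inl ⟨B, hB, rfl⟩))
  have htwo : ∀ e ∈ insert E K, 2 ≤ e.card := by
    simpa using ⟨hEtwo, hKtwo⟩
  -- Merging loses incidences at every overlap of the blocks; connectedness leaves no room for that.
  have hbound := card_le_of_conn htwo hconn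
  have hdc := sum_deg hsub
  have hdeg1 : ∀ a ∈ E, 1 ≤ deg π a := fun a ha => by
    obtain ⟨B, hB, hab⟩ := Finset.mem_biUnion.1 ha
    exact Finset.card_pos.2 ⟨B, Finset.mem_filter.2 ⟨hB, hab⟩⟩
  have hle : E.card ≤ ∑ a ∈ E, deg π a := by
    simpa using Finset.sum_le_sum hdeg1
  have hcrd := h.card
  have hEK : E ∉ K := fun hEK => by
    rw [Finset.insert_eq_of_mem hEK] at hbound
    omega
  rw [Finset.sum_insert hEK, Finset.card_insert_of_notMem hEK] at hbound
  refine ⟨E, hEK, ⟨htwo, hconn, ?_⟩, mem_parts.2 ⟨hsub, hne, fun a ha => ?_⟩⟩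
  · rw [Finset.sum_insert hEK, Finset.card_insert_of_notMem hEK]
    omega
  · have heq : ∑ a ∈ E, 1 = ∑ a ∈ E, deg π a :=
      le_antisymm (Finset.sum_le_sum hdeg1) (by simp; omega)
    exact ((Finset.sum_eq_sum_iff_of_le hdeg1).1 heq a ha).symm

/-- The hypertrees on `β = ι(α) ∪ {v}` arise in a unique way from a hypertree on `α`, by
splitting one hyperedge into blocks joined by `v`, or by attaching `v` to a vertex. -/
theorem sum_hypertrees_insert [DecidableEq α] [Nonempty α] {M : Type*} [AddCommMonoid M]
    (f : Finset (Finset β) → M) :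
    ∑ H ∈ hypertrees β, f H = ∑ H ∈ hypertrees α,
      (∑ E ∈ H, ∑ π ∈ parts E, f (build ι v (H.erase E) π) +
        ∑ u, f (build ι v H {{u}})) := by
  classical
  -- The hypertrees on `β` in which `v` lies only in a hyperedge with two elements.
  let P : Finset (Finset β) → Prop := fun H => ∃ K u, build ι v K {{u}} = H
  have hparts : ∀ (E : Finset α) (u : α), 2 ≤ E.card → {{u}} ∉ parts E := by
    intro E u hE hmem
    have := (card_parts_eq_one_iff hmem).1 (by simp)
    rw [Finset.singleton_inj] at this
    rw [← this] at hE
    simp at hE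
  rw [Finset.sum_add_distrib, ← Finset.sum_filter_not_add_sum_filter (hypertrees β) P]
  congr 1
  · have hsig : ∀ H : Finset (Finset α), ∑ E ∈ H, ∑ π ∈ parts E, f (build ι v (H.erase E) π) =
        ∑ x ∈ H.sigma fun E => parts E, f (build ι v (H.erase x.1) x.2) :=
      fun H => Finset.sum_sigma' _ _ _
    rw [Finset.sum_congr rfl fun H _ => hsig H, Finset.sum_sigma']
    refine (Finset.sum_bij (fun x _ => build ι v (x.1.erase x.2.1) x.2.2) ?_ ?_ ?_ ?_).symm
    · rintro ⟨H, E, π⟩ hx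
      simp only [Finset.mem_sigma, mem_hypertrees] at hx
      refine Finset.mem_filter.2 ⟨mem_hypertrees.2 (isHypertree_build hv hc hx.1 hx.2.1 hx.2.2), ?_⟩
      rintro ⟨K, u, hKu⟩
      have := (build_injective hv hKu).2
      exact hparts E u (hx.1.two_le E hx.2.1) (this ▸ hx.2.2)
    · rintro ⟨H, E, π⟩ hx ⟨H', E', π'⟩ hx' heq
      simp only [Finset.mem_sigma, mem_hypertrees] at hx hx'
      obtain ⟨h1, rfl⟩ := build_injective hv heq
      have hEE : ∀ E E' : Finset α, π ∈ parts E → π ∈ parts E' → E ⊆ E' := by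
        intro E E' h h' a ha
        obtain ⟨B, hB, hab⟩ := exists_mem_of_mem_parts h ha
        exact (mem_parts.1 h').1 B hB hab
      obtain rfl : E = E' := (hEE _ _ hx.2.2 hx'.2.2).antisymm (hEE _ _ hx'.2.2 hx.2.2)
      have h2 := congrArg (insert E) h1
      dsimp only at h2
      rw [Finset.insert_erase hx.2.1, Finset.insert_erase hx'.2.1] at h2
      subst h2
      rfl
    · intro H hH
      obtain ⟨hH, hP⟩ := Finset.mem_filter.1 hH
      obtain ⟨K, π, rfl⟩ := exists_build_eq hv hc H
      obtain ⟨E, hEK, hT, hπ⟩ := exists_of_isHypertree_build hv hc (mem_hypertrees.1 hH)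
        fun u hu => hP ⟨K, u, by rw [hu]⟩
      refine ⟨⟨insert E K, E, π⟩, ?_, ?_⟩
      · simpa [mem_hypertrees] using ⟨hT, hπ⟩
      · simp [Finset.erase_insert hEK]
    · intros; rfl
  · rw [Finset.sum_sigma']
    refine (Finset.sum_bij (fun x _ => build ι v x.1 {{x.2}}) ?_ ?_ ?_ ?_).symm
    · rintro ⟨H, u⟩ hx
      simp only [Finset.mem_sigma, mem_hypertrees, Finset.mem_univ, and_true] at hx
      exact Finset.mem_filter.2
        ⟨mem_hypertrees.2 ((isHypertree_build_singleton hv hc u).2 hx), H, u, rfl⟩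
    · rintro ⟨H, u⟩ - ⟨H', u'⟩ - heq
      obtain ⟨rfl, h⟩ := build_injective hv heq
      simp only [Finset.singleton_inj] at h
      subst h
      rfl
    · intro H hH
      obtain ⟨hH, K, u, rfl⟩ := Finset.mem_filter.1 hH
      refine ⟨⟨K, u⟩, ?_, rfl⟩
      simpa [mem_hypertrees] using
        (isHypertree_build_singleton hv hc u).1 (mem_hypertrees.1 hH)
    · intros; rfl

end Insertion

/-! ### Hypertrees with two kinds of vertices -/

section BoxTrees

/-- The hypertrees on `n` `□`-vertices and `m` `○`-vertices such that every `□`-vertex lies in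
exactly one hyperedge. -/
def boxTrees (n m : ℕ) : Finset (Finset (Finset (Fin n ⊕ Fin m))) :=
  (hypertrees (Fin n ⊕ Fin m)).filter fun H => ∀ i, deg H (.inl i) = 1

theorem mem_boxTrees {n m : ℕ} {H : Finset (Finset (Fin n ⊕ Fin m))} :
    H ∈ boxTrees n m ↔ IsHypertree H ∧ ∀ i, deg H (.inl i) = 1 := by
  rw [boxTrees, Finset.mem_filter, mem_hypertrees]

/-- The embedding of the old vertices that leaves room for a new first `□`-vertex. -/
def succBox (n m : ℕ) : Fin n ⊕ Fin m ↪ Fin (n + 1) ⊕ Fin m :=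
  ⟨Sum.map Fin.succ id, Sum.map_injective.2 ⟨Fin.succ_injective n, Function.injective_id⟩⟩

/-- The embedding of the old vertices that leaves room for a new first `○`-vertex. -/
def succCirc (n m : ℕ) : Fin n ⊕ Fin m ↪ Fin n ⊕ Fin (m + 1) :=
  ⟨Sum.map id Fin.succ, Sum.map_injective.2 ⟨Function.injective_id, Fin.succ_injective m⟩⟩

/-- The `□`-vertices among all vertices. -/
def boxes (n m : ℕ) : Fin n ↪ Fin n ⊕ Fin m := ⟨Sum.inl, Sum.inl_injective⟩

theorem succBox_inl {n m : ℕ} (i : Fin n) : succBox n m (.inl i) = .inl i.succ := rfl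

theorem succBox_inr {n m : ℕ} (j : Fin m) : succBox n m (.inr j) = .inr j := rfl

theorem succCirc_inl {n m : ℕ} (i : Fin n) : succCirc n m (.inl i) = .inl i := rfl

theorem succCirc_inr {n m : ℕ} (j : Fin m) : succCirc n m (.inr j) = .inr j.succ := rfl

theorem succBox_ne {n m : ℕ} (a) : succBox n m a ≠ .inl 0 := by
  rcases a with i | j
  · simp [succBox_inl, Fin.succ_ne_zero]
  · simp [succBox_inr]

theorem succCirc_ne {n m : ℕ} (a) : succCirc n m a ≠ .inr 0 := by
  rcases a with i | j
  · simp [succCirc_inl]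
  · simp [succCirc_inr, Fin.succ_ne_zero]

theorem boxes_ne {n m : ℕ} (a) (j : Fin m) : boxes n m a ≠ .inr j := Sum.inl_ne_inr

theorem succBox_cover {n m : ℕ} (b) : b = .inl 0 ∨ ∃ a, succBox n m a = b := by
  rcases b with i | j
  · exact i.cases (.inl rfl) fun i => .inr ⟨.inl i, rfl⟩
  · exact .inr ⟨.inr j, rfl⟩

theorem succCirc_cover {n m : ℕ} (b) : b = .inr 0 ∨ ∃ a, succCirc n m a = b := by
  rcases b with i | j
  · exact .inr ⟨.inl i, rfl⟩
  · exact j.cases (.inl rfl) fun j => .inr ⟨.inr j, rfl⟩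

theorem boxes_cover {n : ℕ} (b) : b = .inr 0 ∨ ∃ a, boxes n 1 a = b := by
  rcases b with i | j
  · exact .inr ⟨i, rfl⟩
  · exact .inl (by rw [Subsingleton.elim j 0])

theorem nontrivial_vertices {n m : ℕ} (h : 2 ≤ n + m) : Nontrivial (Fin n ⊕ Fin m) :=
  Fintype.one_lt_card_iff_nontrivial.1 (by simp; omega)

theorem deg_split {α : Type*} [DecidableEq α] {H : Finset (Finset α)} {E : Finset α}
    (hE : E ∈ H) {π : Finset (Finset α)} (hπ : π ∈ parts E) (a : α) :
    deg (H.erase E) a + deg π a = deg H a := by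
  have h : deg H a = deg (H.erase E) a + if a ∈ E then 1 else 0 := by
    conv_lhs => rw [← Finset.insert_erase hE]
    simp only [deg, Finset.card_filter]
    rw [Finset.sum_insert (Finset.notMem_erase _ _), add_comm]
  rw [h]
  congr 1
  split_ifs with ha
  · exact (mem_parts.1 hπ).2.2 a ha
  · rw [deg, Finset.card_eq_zero, Finset.filter_eq_empty_iff]
    exact fun B hB haB => ha ((mem_parts.1 hπ).1 B hB haB)

theorem deg_singleton_singleton {α : Type*} [DecidableEq α] (u a : α) :
    deg {{u}} a = if a = u then 1 else 0 := by
  rw [deg, Finset.card_filter, Finset.sum_singleton]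
  simp

/-- A new `□`-vertex either enlarges a hyperedge or is attached to a `○`-vertex. -/
theorem sum_boxTrees_succ {n m : ℕ} (h : 2 ≤ n + m) {M : Type*} [AddCommMonoid M]
    (f : Finset (Finset (Fin (n + 1) ⊕ Fin m)) → M) :
    ∑ H ∈ boxTrees (n + 1) m, f H = ∑ H ∈ boxTrees n m,
      (∑ E ∈ H, f (build (succBox n m) (.inl 0) (H.erase E) {E}) +
        ∑ j, f (build (succBox n m) (.inl 0) H {{.inr j}})) := by
  have := nontrivial_vertices h
  rw [boxTrees, boxTrees, Finset.sum_filter, Finset.sum_filter,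
    sum_hypertrees_insert succBox_ne succBox_cover]
  refine Finset.sum_congr rfl fun H hH => ?_
  have hH := mem_hypertrees.1 hH
  have hsplit : ∀ E ∈ H, ∀ π ∈ parts E,
      (∀ i, deg (build (succBox n m) (.inl 0) (H.erase E) π) (.inl i) = 1) ↔
        (∀ i, deg H (.inl i) = 1) ∧ π = {E} := by
    intro E hE π hπ
    rw [Fin.forall_fin_succ, deg_build_new succBox_ne, card_parts_eq_one_iff hπ, and_comm]
    refine and_congr_left fun _ => forall_congr' fun i => ?_
    rw [← succBox_inl, deg_build succBox_ne, deg_split hE hπ]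
  have hgraft : ∀ u, (∀ i, deg (build (succBox n m) (.inl 0) H {{u}}) (.inl i) = 1) ↔
        (∀ i, deg H (.inl i) = 1) ∧ ∃ j, u = .inr j := by
    intro u
    rw [Fin.forall_fin_succ, deg_build_new succBox_ne]
    have h1 : ∀ i : Fin n, deg (build (succBox n m) (.inl 0) H {{u}}) (.inl i.succ) =
        deg H (.inl i) + if .inl i = u then 1 else 0 := fun i => by
      rw [← succBox_inl, deg_build succBox_ne, deg_singleton_singleton]
    simp only [h1, Finset.card_singleton, true_and]
    rcases u with i | j
    · simp only [reduceCtorEq, exists_false, and_false, iff_false]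
      intro hall
      have := hall i
      have := hH.deg_pos (.inl i)
      simp only [if_true] at *
      omega
    · simp
  have hpos : ∀ E ∈ H, E.Nonempty := fun E hE =>
    Finset.card_pos.1 (by have := hH.two_le E hE; omega)
  rw [Finset.sum_congr rfl fun E hE => Finset.sum_congr rfl fun π hπ =>
      if_congr (hsplit E hE π hπ) rfl rfl, Finset.sum_congr rfl fun u _ =>
      if_congr (hgraft u) rfl rfl]
  split_ifs with hbox
  · congr 1
    · refine Finset.sum_congr rfl fun E hE => ?_
      simp [hbox, singleton_mem_parts (hpos E hE)]
    · simp [hbox]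
  · simp [hbox]

/-- A new `○`-vertex either splits a hyperedge into blocks or is attached to a vertex. -/
theorem sum_boxTrees_zero_succ {m : ℕ} (h : 1 ≤ m) {M : Type*} [AddCommMonoid M]
    (f : Finset (Finset (Fin 0 ⊕ Fin (m + 1))) → M) :
    ∑ H ∈ boxTrees 0 (m + 1), f H = ∑ H ∈ boxTrees 0 m,
      (∑ E ∈ H, ∑ π ∈ parts E, f (build (succCirc 0 m) (.inr 0) (H.erase E) π) +
        ∑ j, f (build (succCirc 0 m) (.inr 0) H {{.inr j}})) := by
  have : Nonempty (Fin 0 ⊕ Fin m) := ⟨.inr ⟨0, h⟩⟩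
  rw [boxTrees, boxTrees, Finset.filter_true_of_mem fun H _ i => i.elim0,
    Finset.filter_true_of_mem fun H _ i => i.elim0,
    sum_hypertrees_insert succCirc_ne succCirc_cover]
  simp

/-- If every vertex of a hypertree has degree one, then there is only one hyperedge. -/
theorem IsHypertree.eq_singleton_univ {α : Type*} [DecidableEq α] [Fintype α] [Nontrivial α]
    {H : Finset (Finset α)} (hH : IsHypertree H) (hdeg : ∀ a, deg H a = 1) :
    H = {Finset.univ} := by
  have huniv : ∀ E ∈ H, E = Finset.univ := by
    intro E hE
    obtain ⟨a, ha⟩ : E.Nonempty := Finset.card_pos.1 (by have := hH.two_le E hE; omega)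
    refine Finset.eq_univ_of_forall fun b => hH.conn (fun c => c ∈ E) ?_ a b ha
    intro E' hE' c hc d hd hcE
    have := Finset.card_le_one.1 (hdeg c).le E' (by simp [hE', hc]) E (by simp [hE, hcE])
    rwa [← this]
  obtain ⟨a⟩ := (inferInstance : Nonempty α)
  obtain ⟨E, hE⟩ := Finset.card_pos.1 (hH.deg_pos a)
  have hE := (Finset.mem_filter.1 hE).1
  exact Finset.eq_singleton_iff_unique_mem.2 ⟨huniv E hE ▸ hE, huniv⟩

theorem isHypertree_singleton_univ {α : Type*} [DecidableEq α] [Fintype α] [Nontrivial α] :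
    IsHypertree {(Finset.univ : Finset α)} := by
  refine ⟨?_, fun p hp a b => hp Finset.univ (by simp) a (by simp) b (by simp), by simp⟩
  intro E hE
  rw [Finset.mem_singleton.1 hE, Finset.card_univ]
  exact Fintype.one_lt_card

/-- With a single `○`-vertex, the hypertrees correspond to the partitions of the set of
`□`-vertices. -/
theorem sum_boxTrees_one {k : ℕ} (hk : 2 ≤ k) {M : Type*} [AddCommMonoid M]
    (f : Finset (Finset (Fin k ⊕ Fin 1)) → M) :
    ∑ H ∈ boxTrees k 1, f H =
      ∑ π ∈ parts (Finset.univ : Finset (Fin k)), f (build (boxes k 1) (.inr 0) ∅ π) := by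
  have : Nontrivial (Fin k) := Fin.nontrivial_iff_two_le.2 hk
  rw [boxTrees, Finset.sum_filter,
    sum_hypertrees_insert (fun a => boxes_ne a 0) boxes_cover]
  -- The insertion of the `○`-vertex does not lower degrees, so it has to start from the hypertree
  -- without vertices of higher degree.
  rw [Finset.sum_eq_single_of_mem {Finset.univ} (mem_hypertrees.2 isHypertree_singleton_univ)]
  · rw [Finset.sum_singleton]
    have hdeg : ∀ (K π : Finset (Finset (Fin k))) (i : Fin k),
        deg (build (boxes k 1) (.inr 0) K π) (.inl i) = deg K i + deg π i :=
      fun K π i => deg_build (fun a => boxes_ne a 0) K π i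
    have h2 : ∑ u, (if ∀ i, deg (build (boxes k 1) (.inr 0) {Finset.univ} {{u}}) (.inl i) = 1 then
        f (build (boxes k 1) (.inr 0) {Finset.univ} {{u}}) else 0) = 0 := by
      refine Finset.sum_eq_zero fun u _ => if_neg fun hall => ?_
      have := hall u
      rw [hdeg] at this
      simp [deg, Finset.filter_singleton] at this
    rw [h2, add_zero]
    refine Finset.sum_congr rfl fun π hπ => ?_
    have he : ({Finset.univ} : Finset (Finset (Fin k))).erase Finset.univ = ∅ := by simp
    rw [he, if_pos]
    intro i
    rw [hdeg, (mem_parts.1 hπ).2.2 i (Finset.mem_univ i)]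
    simp [deg]
  · intro H hH hne
    have hH := mem_hypertrees.1 hH
    have hex : ∃ a, 2 ≤ deg H a := by
      by_contra! hall
      exact hne (hH.eq_singleton_univ fun a => by
        have := hH.deg_pos a
        have := hall a
        omega)
    obtain ⟨a, ha⟩ := hex
    have hdeg : ∀ (K π : Finset (Finset (Fin k))) (i : Fin k),
        deg (build (boxes k 1) (.inr 0) K π) (.inl i) = deg K i + deg π i :=
      fun K π i => deg_build (fun a => boxes_ne a 0) K π i
    rw [Finset.sum_eq_zero, Finset.sum_eq_zero, add_zero]
    · intro u _
      refine if_neg fun hall => ?_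
      have := hall a
      rw [hdeg] at this
      omega
    · intro E hE
      refine Finset.sum_eq_zero fun π hπ => if_neg fun hall => ?_
      have := hall a
      rw [hdeg, deg_split hE hπ] at this
      omega

/-- On two vertices there is only one hypertree. -/
theorem boxTrees_of_two {n m : ℕ} (h : n + m = 2) : boxTrees n m = {{Finset.univ}} := by
  have := nontrivial_vertices h.ge
  refine Finset.eq_singleton_iff_unique_mem.2 ⟨mem_boxTrees.2 ⟨isHypertree_singleton_univ, ?_⟩, ?_⟩
  · simp [deg, Finset.filter_singleton]
  · intro H hH
    have hH := (mem_boxTrees.1 hH).1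
    have huniv : ∀ E ∈ H, E = Finset.univ := fun E hE =>
      (Finset.card_eq_iff_eq_univ E).1
        (le_antisymm (Finset.card_le_univ E) (by simpa [h] using hH.two_le E hE))
    obtain ⟨a⟩ := (inferInstance : Nonempty (Fin n ⊕ Fin m))
    obtain ⟨E, hE⟩ := Finset.card_pos.1 (hH.deg_pos a)
    have hE := (Finset.mem_filter.1 hE).1
    exact Finset.eq_singleton_iff_unique_mem.2 ⟨huniv E hE ▸ hE, huniv⟩

end BoxTrees

/-! ### Decorated trees as hypertrees -/

section DecoratedTrees

variable {n m b : ℕ}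

/-- The inclusion of the labels into the vertices of a decorated tree. -/
def white : Fin n ⊕ Fin m → Vertex n m b := Sum.elim .box .circ

/-- The vertices of a decorated tree are the labels and the `●`-vertices. -/
def vertexEquiv (n m b : ℕ) : Vertex n m b ≃ (Fin n ⊕ Fin m) ⊕ Fin b where
  toFun
    | .box i => .inl (.inl i)
    | .circ j => .inl (.inr j)
    | .bullet k => .inr k
  invFun := Sum.elim white .bullet
  left_inv v := by cases v <;> rfl
  right_inv v := by rcases v with (i | j) | k <;> rfl

theorem white_injective : Function.Injective (white : Fin n ⊕ Fin m → Vertex n m b) := by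
  rintro (i | j) (i' | j') h <;> simp_all [white]

theorem bullet_injective : Function.Injective (Vertex.bullet : Fin b → Vertex n m b) :=
  fun _ _ h => by simpa using h

theorem vertex_cases (v : Vertex n m b) : (∃ a, v = white a) ∨ ∃ k, v = .bullet k := by
  rcases v with i | j | k
  · exact .inl ⟨.inl i, rfl⟩
  · exact .inl ⟨.inr j, rfl⟩
  · exact .inr ⟨k, rfl⟩

theorem not_isBlack_white (a : Fin n ⊕ Fin m) : ¬ (white a : Vertex n m b).IsBlack := by
  rcases a with i | j <;> exact id

open Classical in
/-- The labels of the neighbours of a `●`-vertex. -/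
def nbhd (G : SimpleGraph (Vertex n m b)) (k : Fin b) : Finset (Fin n ⊕ Fin m) :=
  Finset.univ.filter fun a => G.Adj (white a) (.bullet k)

theorem mem_nbhd {G : SimpleGraph (Vertex n m b)} {k : Fin b} {a : Fin n ⊕ Fin m} :
    a ∈ nbhd G k ↔ G.Adj (white a) (.bullet k) := by
  simp [nbhd]

section Bipartite

variable {G : SimpleGraph (Vertex n m b)} (hG : ∀ u v, G.Adj u v → (u.IsBlack ↔ ¬ v.IsBlack))

include hG

theorem neighborSet_bullet (k : Fin b) :
    G.neighborSet (.bullet k) = white '' (nbhd G k : Set (Fin n ⊕ Fin m)) := by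
  ext v
  constructor
  · intro h
    rcases vertex_cases v with ⟨a, rfl⟩ | ⟨l, rfl⟩
    · exact ⟨a, mem_nbhd.2 h.symm, rfl⟩
    · exact ((hG _ _ h).1 trivial trivial).elim
  · rintro ⟨a, ha, rfl⟩
    exact (mem_nbhd.1 ha).symm

theorem neighborSet_white (a : Fin n ⊕ Fin m) :
    G.neighborSet (white a) =
      Vertex.bullet '' ((Finset.univ.filter fun k => a ∈ nbhd G k : Finset (Fin b)) : Set _) := by
  ext v
  constructor
  · intro h
    rcases vertex_cases v with ⟨c, rfl⟩ | ⟨l, rfl⟩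
    · exact (not_isBlack_white a ((hG _ _ h).2 (not_isBlack_white c))).elim
    · exact ⟨l, by simpa [mem_nbhd] using h, rfl⟩
  · rintro ⟨k, hk, rfl⟩
    exact mem_nbhd.1 (by simpa using hk)

theorem ncard_neighborSet_bullet (k : Fin b) :
    (G.neighborSet (.bullet k)).ncard = (nbhd G k).card := by
  rw [neighborSet_bullet hG, Set.ncard_image_of_injective _ white_injective, Set.ncard_coe_finset]

theorem ncard_neighborSet_white (a : Fin n ⊕ Fin m) :
    (G.neighborSet (white a)).ncard = (Finset.univ.filter fun k => a ∈ nbhd G k).card := by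
  rw [neighborSet_white hG, Set.ncard_image_of_injective _ bullet_injective, Set.ncard_coe_finset]

/-- A bipartite graph on the vertices of a decorated tree is the incidence graph of the family of
the neighbourhoods of its `●`-vertices. -/
def isoIncidence : G ≃g incidence (nbhd G) where
  toEquiv := vertexEquiv n m b
  map_rel_iff' := by
    intro u v
    rcases vertex_cases u with ⟨a, rfl⟩ | ⟨k, rfl⟩ <;>
      rcases vertex_cases v with ⟨c, rfl⟩ | ⟨l, rfl⟩
    · have h1 : vertexEquiv n m b (white a) = .inl a := by rcases a with i | j <;> rfl
      have h2 : vertexEquiv n m b (white c) = .inl c := by rcases c with i | j <;> rfl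
      rw [h1, h2]
      exact ⟨fun h => h.elim, fun h =>
        (not_isBlack_white a ((hG _ _ h).2 (not_isBlack_white c))).elim⟩
    · have h1 : vertexEquiv n m b (white a) = .inl a := by rcases a with i | j <;> rfl
      rw [h1]
      exact mem_nbhd
    · have h2 : vertexEquiv n m b (white c) = .inl c := by rcases c with i | j <;> rfl
      rw [h2]
      exact mem_nbhd.trans (SimpleGraph.adj_comm _ _ _)
    · exact ⟨fun h => h.elim, fun h => ((hG _ _ h).1 trivial trivial).elim⟩

end Bipartite

namespace DecoratedTree

variable (S : DecoratedTree n m)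

theorem two_le_card_nbhd (k : Fin S.b) : 2 ≤ (nbhd S.graph k).card := by
  rw [← ncard_neighborSet_bullet S.bipartite]
  exact S.two_le_valence k

theorem connecting_nbhd [Nonempty (Fin n ⊕ Fin m)] : Connecting (nbhd S.graph) ∧
    ∑ k, (nbhd S.graph k).card + 1 = Fintype.card (Fin n ⊕ Fin m) + S.b := by
  have h := (incidence_isTree_iff fun k => Finset.card_pos.1
    (by have := S.two_le_card_nbhd k; omega)).1
    ((SimpleGraph.Iso.isTree_iff (isoIncidence S.bipartite)).1 S.isTree)
  rwa [Fintype.card_fin] at h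

/-- Two `●`-vertices with the same neighbours would give a cycle, since they have at least two
neighbours. -/
theorem nbhd_injective [Nonempty (Fin n ⊕ Fin m)] : Function.Injective (nbhd S.graph) := by
  intro k l hkl
  by_contra hne
  obtain ⟨hconn, hcard⟩ := S.connecting_nbhd
  have h1 := Connecting.card_le (N := fun i : {i : Fin S.b // i ≠ l} => nbhd S.graph i.1)
    (fun i => Finset.card_pos.1 (by have := S.two_le_card_nbhd i; omega)) fun p hp =>
      hconn p fun i => by
        by_cases hi : i = l
        · rw [hi, ← hkl]
          exact hp ⟨k, hne⟩
        · exact hp ⟨i, hi⟩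
  have h2 := Fintype.sum_eq_add_sum_subtype_ne (fun i => (nbhd S.graph i).card) l
  have h3 : Fintype.card {i : Fin S.b // i ≠ l} = S.b - 1 := by
    simp [Fintype.card_subtype_compl]
  have := S.two_le_card_nbhd l
  have := l.2
  omega

/-- The hyperedges of a decorated tree are the label sets of the neighbours of its `●`-vertices. -/
def hyperedges : Finset (Finset (Fin n ⊕ Fin m)) := Finset.univ.image (nbhd S.graph)

theorem mem_hyperedges {E : Finset (Fin n ⊕ Fin m)} :
    E ∈ S.hyperedges ↔ ∃ k, nbhd S.graph k = E := by
  simp [hyperedges]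

theorem deg_hyperedges [Nonempty (Fin n ⊕ Fin m)] (a : Fin n ⊕ Fin m) :
    deg S.hyperedges a = (S.graph.neighborSet (white a)).ncard := by
  rw [ncard_neighborSet_white S.bipartite, deg, hyperedges, Finset.filter_image,
    Finset.card_image_of_injective _ S.nbhd_injective]

theorem hyperedges_mem_boxTrees [Nonempty (Fin n ⊕ Fin m)] : S.hyperedges ∈ boxTrees n m := by
  refine mem_boxTrees.2 ⟨⟨?_, ?_, ?_⟩, fun i => ?_⟩
  · intro E hE
    obtain ⟨k, rfl⟩ := S.mem_hyperedges.1 hE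
    exact S.two_le_card_nbhd k
  · exact fun p hp => S.connecting_nbhd.1 p fun k => hp _ (S.mem_hyperedges.2 ⟨k, rfl⟩)
  · rw [hyperedges, Finset.sum_image S.nbhd_injective.injOn,
      Finset.card_image_of_injective _ S.nbhd_injective, Finset.card_univ, Fintype.card_fin,
      S.connecting_nbhd.2]
  · rw [deg_hyperedges]
    exact S.box_valence i

variable {S} in
theorem Iso.apply_white {S' : DecoratedTree n m} (e : Iso S S') (a : Fin n ⊕ Fin m) :
    e.1 (white a) = white a := by
  rcases a with i | j
  · exact e.2.1 i
  · exact e.2.2 j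

variable {S} in
theorem Iso.exists_bullet {S' : DecoratedTree n m} (e : Iso S S') (k : Fin S.b) :
    ∃ l, e.1 (.bullet k) = .bullet l ∧ nbhd S'.graph l = nbhd S.graph k := by
  rcases vertex_cases (e.1 (.bullet k)) with ⟨a, ha⟩ | ⟨l, hl⟩
  · rw [← e.apply_white a] at ha
    have := e.1.injective ha
    rcases a with i | j <;> simp [white] at this
  · refine ⟨l, hl, ?_⟩
    ext a
    rw [mem_nbhd, mem_nbhd, ← hl, ← e.apply_white a]
    exact e.1.map_adj_iff

/-- An automorphism fixes the labels, and the `●`-vertices are determined by their neighbours. -/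
theorem aut_eq_one [Nonempty (Fin n ⊕ Fin m)] : S.aut = 1 := by
  have : Subsingleton (Iso S S) := by
    have hid : ∀ (e : Iso S S) (v), e.1 v = v := by
      intro e v
      rcases vertex_cases v with ⟨a, rfl⟩ | ⟨k, rfl⟩
      · exact e.apply_white a
      · obtain ⟨l, hl, hlk⟩ := e.exists_bullet k
        rw [hl, S.nbhd_injective hlk]
    exact ⟨fun e e' => Subtype.ext (RelIso.ext fun v => by rw [hid, hid])⟩
  have : Nonempty (Iso S S) := ⟨⟨RelIso.refl _, fun _ => rfl, fun _ => rfl⟩⟩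
  exact Nat.card_eq_one_iff_unique.2 ⟨inferInstance, inferInstance⟩

variable {S} in
theorem hyperedges_eq_iff [Nonempty (Fin n ⊕ Fin m)] {S' : DecoratedTree n m} :
    S.hyperedges = S'.hyperedges ↔ Nonempty (Iso S S') := by
  constructor
  · intro h
    have hex : ∀ k, ∃ l, nbhd S'.graph l = nbhd S.graph k := fun k =>
      S'.mem_hyperedges.1 (h ▸ S.mem_hyperedges.2 ⟨k, rfl⟩)
    have hex' : ∀ l, ∃ k, nbhd S.graph k = nbhd S'.graph l := fun l =>
      S.mem_hyperedges.1 (h ▸ S'.mem_hyperedges.2 ⟨l, rfl⟩)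
    choose f hf using hex
    choose g hg using hex'
    let e : Fin S.b ≃ Fin S'.b :=
      ⟨f, g, fun k => S.nbhd_injective (by rw [hg, hf]),
        fun l => S'.nbhd_injective (by rw [hf, hg])⟩
    let e' : incidence (nbhd S.graph) ≃g incidence (nbhd S'.graph) :=
      { toEquiv := Equiv.sumCongr (Equiv.refl _) e
        map_rel_iff' := by
          have hmem : ∀ a k, a ∈ nbhd S'.graph (e k) ↔ a ∈ nbhd S.graph k := fun a k => by
            rw [← hf k]; rfl
          rintro (a | k) (c | l)
          · exact Iff.rfl
          · exact hmem a l
          · exact hmem c k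
          · exact Iff.rfl }
    exact ⟨⟨((isoIncidence S.bipartite).trans e').trans (isoIncidence S'.bipartite).symm,
      fun _ => rfl, fun _ => rfl⟩⟩
  · rintro ⟨e⟩
    have key : ∀ {S S' : DecoratedTree n m}, Iso S S' → S.hyperedges ⊆ S'.hyperedges := by
      intro S S' e E hE
      obtain ⟨k, rfl⟩ := S.mem_hyperedges.1 hE
      obtain ⟨l, -, hl⟩ := e.exists_bullet k
      exact S'.mem_hyperedges.2 ⟨l, hl⟩
    have hsymm : Nonempty (Iso S' S) := (setoid n m).symm ⟨e⟩
    exact (key e).antisymm (key hsymm.some)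

/-- Every hypertree comes from a decorated tree. -/
theorem exists_hyperedges_eq [Nonempty (Fin n ⊕ Fin m)] {H : Finset (Finset (Fin n ⊕ Fin m))}
    (hH : H ∈ boxTrees n m) : ∃ S : DecoratedTree n m, S.hyperedges = H := by
  obtain ⟨hH, hbox⟩ := mem_boxTrees.1 hH
  let N : Fin H.card → Finset (Fin n ⊕ Fin m) := fun k => (H.equivFin.symm k).1
  have hNmem : ∀ k, N k ∈ H := fun k => (H.equivFin.symm k).2
  have hNex : ∀ E ∈ H, ∃ k, N k = E := fun E hE => ⟨H.equivFin ⟨E, hE⟩, by simp [N]⟩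
  have hNinj : Function.Injective N := Subtype.val_injective.comp H.equivFin.symm.injective
  have hNimg : Finset.univ.image N = H := by
    ext E
    simp only [Finset.mem_image, Finset.mem_univ, true_and]
    exact ⟨fun ⟨k, hk⟩ => hk ▸ hNmem k, hNex E⟩
  let G : SimpleGraph (Vertex n m H.card) := (incidence N).comap (vertexEquiv n m H.card)
  have hadj : ∀ a k, G.Adj (white a) (.bullet k) ↔ a ∈ N k := by
    rintro (i | j) k <;> exact Iff.rfl
  have hnb : nbhd G = N := by
    ext k a
    rw [mem_nbhd, hadj]
  have hbip : ∀ u v, G.Adj u v → (u.IsBlack ↔ ¬ v.IsBlack) := by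
    intro u v h
    rcases u with i | j | k <;> rcases v with i' | j' | k' <;>
      first | exact h.elim | simp [Vertex.IsBlack]
  have htree : (incidence N).IsTree := by
    refine (incidence_isTree_iff fun k => Finset.card_pos.1
      (by have := hH.two_le _ (hNmem k); omega)).2 ⟨fun p hp => hH.conn p fun E hE => ?_, ?_⟩
    · obtain ⟨k, rfl⟩ := hNex E hE
      exact hp k
    · have := hH.card
      have hsum := Finset.sum_image (f := Finset.card) (s := Finset.univ) hNinj.injOn
      rw [hNimg] at hsum
      rw [Fintype.card_fin, ← this, hsum]
  refine ⟨⟨H.card, G, (SimpleGraph.Iso.isTree_iff (SimpleGraph.Iso.comap _ _)).2 htree, fun k => ?_,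
    hbip, fun i => ?_⟩, ?_⟩
  · rw [ncard_neighborSet_bullet hbip, hnb]
    exact hH.two_le _ (hNmem k)
  · refine (ncard_neighborSet_white hbip (.inl i)).trans ?_
    rw [hnb, ← hbox i, deg, ← Finset.card_image_of_injective _ hNinj]
    congr 1
    conv_rhs => rw [← hNimg, Finset.filter_image]
  · exact (congrArg (fun N => Finset.univ.image N) hnb).trans hNimg

/-- A sum over the isomorphism classes of decorated trees is a sum over hypertrees. -/
theorem finsum_trees [Nonempty (Fin n ⊕ Fin m)] (g : DecoratedTree n m → ℂ)
    (f : Finset (Finset (Fin n ⊕ Fin m)) → ℂ) (h : ∀ S, g S = f S.hyperedges) :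
    ∑ᶠ S : Trees n m, g S.out = ∑ H ∈ boxTrees n m, f H := by
  let φ : Trees n m → boxTrees n m := fun S => ⟨S.out.hyperedges, S.out.hyperedges_mem_boxTrees⟩
  have hφ : Function.Bijective φ := by
    constructor
    · intro S S' hSS
      have h1 := hyperedges_eq_iff.1 (congrArg Subtype.val hSS)
      rw [← Quotient.out_eq S, ← Quotient.out_eq S']
      exact Quotient.sound h1
    · rintro ⟨H, hH⟩
      obtain ⟨S, rfl⟩ := exists_hyperedges_eq hH
      exact ⟨⟦S⟧, Subtype.ext
        (hyperedges_eq_iff.2 (Quotient.exact (Quotient.out_eq (⟦S⟧ : Trees n m))))⟩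
  rw [← Finset.sum_coe_sort, ← finsum_eq_sum_of_fintype]
  exact finsum_eq_of_bijective φ hφ fun S => h _

end DecoratedTree

end DecoratedTrees

/-! ### The domain of the variables -/

section Domain

theorem Regular.analyticAt {f : RatFunc ℂ} {z : ℂ} (h : Regular f z) : AnalyticAt ℂ (ev f) z := by
  have h1 : AnalyticAt ℂ (fun z => f.num.eval z) z :=
    (f.num.differentiable).analyticAt z
  have h2 : AnalyticAt ℂ (fun z => f.denom.eval z) z :=
    (f.denom.differentiable).analyticAt z
  exact h1.div h2 h

/-- An unramified covering maps the neighbourhoods of a point onto those of its image. -/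
theorem map_ev_nhds {f : RatFunc ℂ} {z : ℂ} (h : Regular f z) (h' : deriv (ev f) z ≠ 0) :
    Filter.map (ev f) (𝓝 z) = 𝓝 (ev f z) :=
  h.analyticAt.hasStrictDerivAt.map_nhds_eq h'

variable {f : RatFunc ℂ} {P : Set ℂ}

theorem branch_mem {a : ℂ} (h : a ∈ ev f '' P) : branch f P a ∈ P := Function.invFunOn_mem h

theorem ev_branch {a : ℂ} (h : a ∈ ev f '' P) : ev f (branch f P a) = a := Function.invFunOn_eq h

theorem branch_ev (hf : Set.InjOn (ev f) P) {z : ℂ} (hz : z ∈ P) : branch f P (ev f z) = z :=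
  hf.leftInvOn_invFunOn hz

theorem image_mem_nhds (hP : IsOpen P) (hu : ∀ z ∈ P, Regular f z ∧ deriv (ev f) z ≠ 0) {a : ℂ}
    (ha : a ∈ ev f '' P) : ev f '' P ∈ 𝓝 a := by
  obtain ⟨z, hz, rfl⟩ := ha
  rw [← map_ev_nhds (hu z hz).1 (hu z hz).2]
  exact Filter.image_mem_map (hP.mem_nhds hz)

theorem continuousAt_branch (hP : IsOpen P) (hf : Set.InjOn (ev f) P)
    (hu : ∀ z ∈ P, Regular f z ∧ deriv (ev f) z ≠ 0) {a : ℂ} (ha : a ∈ ev f '' P) :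
    ContinuousAt (branch f P) a := by
  obtain ⟨z, hz, rfl⟩ := ha
  rw [ContinuousAt, ← map_ev_nhds (hu z hz).1 (hu z hz).2, branch_ev hf hz, Filter.tendsto_map'_iff]
  refine Filter.tendsto_id.congr' ?_
  filter_upwards [hP.mem_nhds hz] with w hw
  exact (branch_ev hf hw).symm

end Domain

section Functions

variable {T : Type*} {F : CurveFamily T} {n m : ℕ}

namespace CurveFamily

variable {t : T}

theorem X_mem {y : ℂ} (hy : y ∈ ev (F.curve t).y '' F.P t) :
    F.X t y ∈ ev (F.curve t).x '' F.P t :=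
  Set.mem_image_of_mem _ (branch_mem hy)

theorem zx_X {y : ℂ} (hy : y ∈ ev (F.curve t).y '' F.P t) : F.zx t (F.X t y) = F.zy t y :=
  branch_ev (F.x_injOn t) (branch_mem hy)

variable (F) in
/-- The `x`-coordinates `x₁,…,xₙ,X(y₁),…,X(y_m)` of the `n + m` points. -/
def coord (t : T) (x : Fin n → ℂ) (y : Fin m → ℂ) : Fin n ⊕ Fin m → ℂ :=
  Sum.elim x fun j => F.X t (y j)

variable {x : Fin n → ℂ} {y : Fin m → ℂ}

theorem InDom.coord_mem (h : F.InDom t x y) (p) : F.coord t x y p ∈ ev (F.curve t).x '' F.P t := by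
  rcases p with i | j
  · exact h.1 i
  · exact X_mem (h.2.1 j)

theorem InDom.injective_coord (h : F.InDom t x y) :
    Function.Injective fun p => F.zx t (F.coord t x y p) := by
  convert h.2.2 using 1
  ext (i | j)
  · rfl
  · exact zx_X (h.2.1 j)

/-- The points of the curve with given pairwise different `x`-coordinates. -/
theorem inDom_of_injective {k : ℕ} {v : Fin k → ℂ} (h1 : ∀ i, v i ∈ ev (F.curve t).x '' F.P t)
    (h2 : Function.Injective fun i => F.zx t (v i)) (w : Fin 0 → ℂ) : F.InDom t v w := by
  refine ⟨h1, fun j => j.elim0, ?_⟩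
  rintro (i | j) (i' | j') h
  · exact congrArg _ (h2 h)
  · exact j'.elim0
  · exact j.elim0
  · exact j.elim0

/-- Any selection of different points among the `n + m` points stays in the domain. -/
theorem InDom.coord_comp (h : F.InDom t x y) {k : ℕ} {e : Fin k → Fin n ⊕ Fin m}
    (he : Function.Injective e) (w : Fin 0 → ℂ) :
    F.InDom t (fun i => F.coord t x y (e i)) w :=
  inDom_of_injective (fun i => h.coord_mem (e i)) (fun _ _ hij => he (h.injective_coord hij)) w

/-- A selection of different variables stays in the domain. -/
theorem InDom.comp (h : F.InDom t x y) {n' m' : ℕ} {a : Fin n' → Fin n} {b : Fin m' → Fin m}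
    (ha : Function.Injective a) (hb : Function.Injective b) :
    F.InDom t (fun i => x (a i)) (fun j => y (b j)) := by
  refine ⟨fun i => h.1 _, fun j => h.2.1 _, ?_⟩
  have h3 := h.2.2.comp (Sum.map_injective.2 ⟨ha, hb⟩)
  rwa [Sum.elim_comp_map] at h3

theorem InDom.permTailX {x : Fin (n + 1) → ℂ} (h : F.InDom t x y) (σ : Equiv.Perm (Fin n))
    (τ : Equiv.Perm (Fin m)) :
    F.InDom t (Fin.cons (x 0) fun i => Fin.tail x (σ i) : Fin (n + 1) → ℂ) fun j => y (τ j) := by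
  have h1 := h.comp (a := (Fin.cons 0 fun i => (σ i).succ : Fin (n + 1) → Fin (n + 1)))
    (Fin.cons_injective_iff.2 ⟨by simp [Fin.succ_ne_zero],
      (Fin.succ_injective n).comp σ.injective⟩) τ.injective
  convert h1 using 1
  ext i
  exact i.cases rfl fun _ => rfl

theorem InDom.permTailY {y : Fin (m + 1) → ℂ} (h : F.InDom t x y) (σ : Equiv.Perm (Fin n))
    (τ : Equiv.Perm (Fin m)) : F.InDom t (fun i => x (σ i))
      (Fin.cons (y 0) fun j => Fin.tail y (τ j) : Fin (m + 1) → ℂ) := by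
  have h1 := h.comp (b := (Fin.cons 0 fun j => (τ j).succ : Fin (m + 1) → Fin (m + 1)))
    σ.injective (Fin.cons_injective_iff.2 ⟨by simp [Fin.succ_ne_zero],
      (Fin.succ_injective m).comp τ.injective⟩)
  convert h1 using 1
  ext i
  exact i.cases rfl fun _ => rfl

theorem InDom.tailX {x : Fin (n + 1) → ℂ} (h : F.InDom t x y) : F.InDom t (Fin.tail x) y :=
  h.comp (Fin.succ_injective n) Function.injective_id

theorem InDom.tailY {y : Fin (m + 1) → ℂ} (h : F.InDom t x y) : F.InDom t x (Fin.tail y) :=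
  h.comp Function.injective_id (Fin.succ_injective m)

/-- The domain is open in the variables. -/
theorem InDom.eventually (h : F.InDom t x y) :
    ∀ᶠ p : (Fin n → ℂ) × (Fin m → ℂ) in 𝓝 (x, y), F.InDom t p.1 p.2 := by
  have hx : ∀ i, ContinuousAt (fun p : (Fin n → ℂ) × (Fin m → ℂ) => p.1 i) (x, y) := fun i => by
    fun_prop
  have hy : ∀ j, ContinuousAt (fun p : (Fin n → ℂ) × (Fin m → ℂ) => p.2 j) (x, y) := fun j => by
    fun_prop
  have h1 : ∀ᶠ p : (Fin n → ℂ) × (Fin m → ℂ) in 𝓝 (x, y), ∀ i, p.1 i ∈ ev (F.curve t).x '' F.P t :=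
    Filter.eventually_all.2 fun i =>
      (hx i) (image_mem_nhds (F.isOpen_P t) (F.x_unramified t) (h.1 i))
  have h2 : ∀ᶠ p : (Fin n → ℂ) × (Fin m → ℂ) in 𝓝 (x, y), ∀ j, p.2 j ∈ ev (F.curve t).y '' F.P t :=
    Filter.eventually_all.2 fun j =>
      (hy j) (image_mem_nhds (F.isOpen_P t) (F.y_unramified t) (h.2.1 j))
  let q : (Fin n → ℂ) × (Fin m → ℂ) → Fin n ⊕ Fin m → ℂ := fun p =>
    Sum.elim (fun i => F.zx t (p.1 i)) fun j => F.zy t (p.2 j)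
  have hq : ∀ a, ContinuousAt (fun p => q p a) (x, y) := by
    rintro (i | j)
    · exact ContinuousAt.comp (f := fun p : (Fin n → ℂ) × (Fin m → ℂ) => p.1 i)
        (continuousAt_branch (F.isOpen_P t) (F.x_injOn t) (F.x_unramified t) (h.1 i)) (hx i)
    · exact ContinuousAt.comp (f := fun p : (Fin n → ℂ) × (Fin m → ℂ) => p.2 j)
        (continuousAt_branch (F.isOpen_P t) (F.y_injOn t) (F.y_unramified t) (h.2.1 j)) (hy j)
  have h3 : ∀ᶠ p in 𝓝 (x, y), ∀ a b, a ≠ b → q p a ≠ q p b :=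
    Filter.eventually_all.2 fun a => Filter.eventually_all.2 fun b => by
      by_cases hab : a = b
      · simp [hab]
      · filter_upwards [((hq a).sub (hq b)).eventually_ne
          (sub_ne_zero.2 fun h' => hab (h.2.2 h'))] with p hp _
        exact sub_ne_zero.1 hp
  filter_upwards [h1, h2, h3] with p hp1 hp2 hp3
  exact ⟨hp1, hp2, fun a b hab => by_contra fun hne => hp3 a b hne hab⟩

theorem tendsto_update (x : Fin n → ℂ) (y : Fin m → ℂ) (j : Fin m) :
    Filter.Tendsto (fun s => (x, Function.update y j s)) (𝓝 (y j)) (𝓝 (x, y)) := by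
  have h : Continuous fun s => (x, Function.update y j s) := by fun_prop
  simpa using h.tendsto (y j)

theorem EqDom.refl (f : Fun T n m) : F.EqDom f f := fun _ _ _ _ => rfl

theorem EqDom.symm {f g : Fun T n m} (h : F.EqDom f g) : F.EqDom g f :=
  fun t x y hd => (h t x y hd).symm

theorem EqDom.trans {f g k : Fun T n m} (h : F.EqDom f g) (h' : F.EqDom g k) : F.EqDom f k :=
  fun t x y hd => (h t x y hd).trans (h' t x y hd)

theorem EqDom.dY {f g : Fun T n m} (h : F.EqDom f g) (j : Fin m) :
    F.EqDom (dY j f) (dY j g) := by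
  intro t x y hd
  refine Filter.EventuallyEq.deriv_eq ?_
  filter_upwards [(tendsto_update x y j).eventually hd.eventually] with s hs
  exact h t x _ hs

end CurveFamily

open CurveFamily

/-! ### The class of functions -/

variable {A : FunctionClass F}

namespace FunctionClass

theorem neg {f : Fun T n m} (hf : A.Adm f) : A.Adm (-f) := by
  have := A.mul _ f (A.const (-1)) hf
  refine A.congr _ _ this fun t x y _ => ?_
  simp

theorem sum {ι : Type*} {s : Finset ι} {f : ι → Fun T n m} (hf : ∀ i ∈ s, A.Adm (f i)) :
    A.Adm fun t x y => ∑ i ∈ s, f i t x y := by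
  classical
  induction s using Finset.induction_on with
  | empty => simpa using A.const 0
  | insert a s ha ih =>
    simp only [Finset.sum_insert ha]
    exact A.add _ _ (hf a (by simp)) (ih fun i hi => hf i (by simp [hi]))

theorem prod {ι : Type*} {s : Finset ι} {f : ι → Fun T n m} (hf : ∀ i ∈ s, A.Adm (f i)) :
    A.Adm fun t x y => ∏ i ∈ s, f i t x y := by
  classical
  induction s using Finset.induction_on with
  | empty => simpa using A.const 1
  | insert a s ha ih =>
    simp only [Finset.prod_insert ha]
    exact A.mul _ _ (hf a (by simp)) (ih fun i hi => hf i (by simp [hi]))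

/-- Selecting variables preserves the class. -/
theorem comp {f : Fun T n m} (hf : A.Adm f) {n' m' : ℕ} {a : Fin n → Fin n'} {b : Fin m → Fin m'}
    (ha : Function.Injective a) (hb : Function.Injective b) :
    A.Adm (fun t x y => f t (fun i => x (a i)) (fun j => y (b j))) :=
  A.subst f (fun i _ x _ => x (a i)) (fun j _ _ y => y (b j)) hf (fun _ => A.varX _)
    (fun _ => A.varY _) fun _ _ _ h => h.comp ha hb

theorem differentiableAt_dY {f : Fun T n m} (hf : A.Adm f) {t : T} {x : Fin n → ℂ} {y : Fin m → ℂ}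
    (h : F.InDom t x y) (j : Fin m) :
    DifferentiableAt ℂ (fun s => f t x (Function.update y j s)) (y j) := by
  have h1 := (A.analytic f hf t x y h).differentiableAt
  have h2 : DifferentiableAt ℂ (fun s => (x, Function.update y j s)) (y j) :=
    (differentiableAt_const _).prodMk (hasDerivAt_update y j (y j)).differentiableAt
  have h3 : (x, Function.update y j (y j)) = (x, y) := by simp
  exact DifferentiableAt.comp (y j) (g := fun p : (Fin n → ℂ) × (Fin m → ℂ) => f t p.1 p.2)
    (by rwa [h3]) h2

theorem dY_eq_fderiv {f : Fun T n m} (hf : A.Adm f) {t : T} {x : Fin n → ℂ} {y : Fin m → ℂ}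
    (h : F.InDom t x y) (j : Fin m) :
    XYSymmetry.dY j f t x y = fderiv ℂ (fun p : (Fin n → ℂ) × (Fin m → ℂ) => f t p.1 p.2) (x, y)
      (0, Pi.single j 1) := by
  have h1 := (A.analytic f hf t x y h).differentiableAt.hasFDerivAt
  have h2 : HasDerivAt (fun s => (x, Function.update y j s)) (0, Pi.single j 1) (y j) :=
    (hasDerivAt_const _ _).prodMk (hasDerivAt_update y j (y j))
  have h3 : (x, Function.update y j (y j)) = (x, y) := by simp
  exact (HasFDerivAt.comp_hasDerivAt (y j)
    (l := fun p : (Fin n → ℂ) × (Fin m → ℂ) => f t p.1 p.2) (by rwa [h3]) h2).deriv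

/-- The derivatives with respect to the variables commute. -/
theorem dY_comm {f : Fun T n m} (hf : A.Adm f) (i j : Fin m) :
    F.EqDom (XYSymmetry.dY i (XYSymmetry.dY j f)) (XYSymmetry.dY j (XYSymmetry.dY i f)) := by
  intro t x y h
  set g := fun p : (Fin n → ℂ) × (Fin m → ℂ) => f t p.1 p.2 with hg
  have han : AnalyticAt ℂ g (x, y) := A.analytic f hf t x y h
  have hsym : IsSymmSndFDerivAt ℂ g (x, y) :=
    (han.contDiffAt (n := ⊤)).isSymmSndFDerivAt le_top
  have key : ∀ i j : Fin m, XYSymmetry.dY i (XYSymmetry.dY j f) t x y =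
      fderiv ℂ (fderiv ℂ g) (x, y) (0, Pi.single i 1) (0, Pi.single j 1) := by
    intro i j
    have h2 : HasDerivAt (fun s => (x, Function.update y i s)) (0, Pi.single i 1) (y i) :=
      (hasDerivAt_const _ _).prodMk (hasDerivAt_update y i (y i))
    have h3 : (x, Function.update y i (y i)) = (x, y) := by simp
    have h4 : HasDerivAt (fun s => fderiv ℂ g (x, Function.update y i s))
        (fderiv ℂ (fderiv ℂ g) (x, y) (0, Pi.single i 1)) (y i) :=
      HasFDerivAt.comp_hasDerivAt (y i) (l := fderiv ℂ g)
        (by rw [h3]; exact han.fderiv.differentiableAt.hasFDerivAt) h2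
    have h5 := h4.clm_apply
      (hasDerivAt_const (y i) ((0, Pi.single j 1) : (Fin n → ℂ) × (Fin m → ℂ)))
    rw [map_zero, add_zero] at h5
    refine Filter.EventuallyEq.deriv_eq (f := fun s => fderiv ℂ g (x, Function.update y i s)
      (0, Pi.single j 1)) ?_ |>.trans h5.deriv
    filter_upwards [(tendsto_update x y i).eventually h.eventually] with s hs
    exact dY_eq_fderiv hf hs j
  rw [key, key]
  exact hsym _ _

variable {f g : Fun T n m}

theorem dY_mul (hf : A.Adm f) (hg : A.Adm g) (j : Fin m) :
    F.EqDom (XYSymmetry.dY j fun t x y => f t x y * g t x y)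
      (fun t x y => XYSymmetry.dY j f t x y * g t x y + f t x y * XYSymmetry.dY j g t x y) := by
  intro t x y h
  have := deriv_fun_mul (differentiableAt_dY hf h j) (differentiableAt_dY hg h j)
  simpa [XYSymmetry.dY] using this

theorem dY_neg (f : Fun T n m) (j : Fin m) : XYSymmetry.dY j (-f) = -XYSymmetry.dY j f := by
  ext t x y
  simp [XYSymmetry.dY]

end FunctionClass

end Functions

open CurveFamily FunctionClass

/-! ### Iterated derivatives -/

section IteratedDerivatives

variable {T : Type*} {F : CurveFamily T} {A : FunctionClass F} {n m : ℕ}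

/-- The operator `-d/dy_j`. -/
def negDY (j : Fin m) (f : Fun T n m) : Fun T n m := -dY j f

/-- The operator `∏_j (-d/dy_j)^{r_j}`, where the product is taken along a list of indices. -/
def iterNegDY (l : List (Fin m)) (r : Fin m → ℕ) (f : Fun T n m) : Fun T n m :=
  l.foldr (fun j g => (negDY j)^[r j] g) f

theorem negDY_adm {f : Fun T n m} (hf : A.Adm f) (j : Fin m) : A.Adm (negDY j f) :=
  A.neg (A.dY j f hf)

theorem negDY_congr {f g : Fun T n m} (h : F.EqDom f g) (j : Fin m) :
    F.EqDom (negDY j f) (negDY j g) := fun t x y hd => congrArg Neg.neg (h.dY j t x y hd)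

theorem iterate_negDY_adm {f : Fun T n m} (hf : A.Adm f) (j : Fin m) (k : ℕ) :
    A.Adm ((negDY j)^[k] f) := by
  induction k with
  | zero => exact hf
  | succ k ih => rw [Function.iterate_succ_apply']; exact negDY_adm ih j

theorem iterate_negDY_congr {f g : Fun T n m} (h : F.EqDom f g) (j : Fin m) (k : ℕ) :
    F.EqDom ((negDY j)^[k] f) ((negDY j)^[k] g) := by
  induction k with
  | zero => exact h
  | succ k ih => simp only [Function.iterate_succ_apply']; exact negDY_congr ih j

theorem iterNegDY_adm {f : Fun T n m} (hf : A.Adm f) (l : List (Fin m)) (r : Fin m → ℕ) :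
    A.Adm (iterNegDY l r f) := by
  induction l with
  | nil => exact hf
  | cons j l ih => exact iterate_negDY_adm ih j _

theorem iterNegDY_congr {f g : Fun T n m} (h : F.EqDom f g) (l : List (Fin m)) (r : Fin m → ℕ) :
    F.EqDom (iterNegDY l r f) (iterNegDY l r g) := by
  induction l with
  | nil => exact h
  | cons j l ih => exact iterate_negDY_congr ih j _

/-- A map of functions that intertwines the derivatives intertwines their products. -/
theorem iterNegDY_transfer {n' m' : ℕ} {Φ : Fun T n m → Fun T n' m'} {φ : Fin m → Fin m'}
    (hΦ : ∀ j f, A.Adm f → F.EqDom (Φ (negDY j f)) (negDY (φ j) (Φ f))) {r : Fin m → ℕ}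
    {r' : Fin m' → ℕ} (hr : ∀ j, r' (φ j) = r j) (l : List (Fin m)) {f : Fun T n m}
    (hf : A.Adm f) : F.EqDom (Φ (iterNegDY l r f)) (iterNegDY (l.map φ) r' (Φ f)) := by
  induction l with
  | nil => exact EqDom.refl _
  | cons j l ih =>
    have hg := iterNegDY_adm hf l r
    have key : ∀ k, F.EqDom (Φ ((negDY j)^[k] (iterNegDY l r f)))
        ((negDY (φ j))^[k] (Φ (iterNegDY l r f))) := by
      intro k
      induction k with
      | zero => exact EqDom.refl _
      | succ k ihk =>
        simp only [Function.iterate_succ_apply']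
        exact (hΦ j _ (iterate_negDY_adm hg j k)).trans (negDY_congr ihk _)
    refine (key (r j)).trans ?_
    change F.EqDom _ ((negDY (φ j))^[r' (φ j)] (iterNegDY (l.map φ) r' (Φ f)))
    rw [hr]
    exact iterate_negDY_congr ih _ _

theorem negDY_comm {f : Fun T n m} (hf : A.Adm f) (i j : Fin m) :
    F.EqDom (negDY i (negDY j f)) (negDY j (negDY i f)) := by
  intro t x y h
  simp only [negDY, dY_neg, neg_neg]
  exact dY_comm hf i j t x y h

theorem iterNegDY_congr_exponent {l : List (Fin m)} {r r' : Fin m → ℕ} (h : ∀ j ∈ l, r j = r' j)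
    (f : Fun T n m) : iterNegDY l r f = iterNegDY l r' f := by
  induction l with
  | nil => rfl
  | cons j l ih =>
    change (negDY j)^[r j] (iterNegDY l r f) = (negDY j)^[r' j] (iterNegDY l r' f)
    rw [ih fun i hi => h i (by simp [hi]), h j (by simp)]

/-- One of the derivatives with respect to `y_j` may be applied first. -/
theorem iterNegDY_negDY {l : List (Fin m)} (hl : l.Nodup) {j : Fin m} (hj : j ∈ l)
    {r r' : Fin m → ℕ} (hr : ∀ i, r i = r' i + if i = j then 1 else 0) {f : Fun T n m}
    (hf : A.Adm f) : F.EqDom (iterNegDY l r f) (iterNegDY l r' (negDY j f)) := by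
  induction l with
  | nil => simp at hj
  | cons i l ih =>
    obtain ⟨hil, hl⟩ := List.nodup_cons.1 hl
    change F.EqDom ((negDY i)^[r i] (iterNegDY l r f))
      ((negDY i)^[r' i] (iterNegDY l r' (negDY j f)))
    rw [hr i]
    by_cases h : i = j
    · subst h
      have h1 : iterNegDY l r f = iterNegDY l r' f :=
        iterNegDY_congr_exponent (fun k hk => by
          have : k ≠ i := fun h => hil (h ▸ hk)
          simp [hr k, this]) f
      rw [if_pos rfl, Function.iterate_add_apply, h1]
      refine iterate_negDY_congr ?_ _ _
      have := iterNegDY_transfer (A := A) (Φ := negDY i) (φ := id) (r := r') (r' := r')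
        (fun k g hg => negDY_comm hg i k) (fun _ => rfl) l hf
      rwa [List.map_id] at this
    · rw [if_neg h, add_zero]
      exact iterate_negDY_congr (ih hl (by simpa [Ne.symm h] using hj)) _ _

theorem iterNegDY_iterate {l : List (Fin m)} (hl : l.Nodup) {j : Fin m} (hj : j ∈ l) (k : ℕ)
    {r r' : Fin m → ℕ} (hr : ∀ i, r i = r' i + if i = j then k else 0) {f : Fun T n m}
    (hf : A.Adm f) : F.EqDom (iterNegDY l r f) (iterNegDY l r' ((negDY j)^[k] f)) := by
  induction k generalizing r f with
  | zero =>
    obtain rfl : r = r' := funext fun i => by simp [hr i]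
    exact EqDom.refl _
  | succ k ih =>
    rw [Function.iterate_succ_apply]
    refine (iterNegDY_negDY hl hj (r' := fun i => r' i + if i = j then k else 0) (fun i => ?_)
      hf).trans (ih (fun _ => rfl) (negDY_adm hf j))
    rw [hr i]
    split_ifs <;> omega

theorem negDY_sum {ι : Type*} {s : Finset ι} {f : ι → Fun T n m} (hf : ∀ i ∈ s, A.Adm (f i))
    (j : Fin m) : F.EqDom (negDY j fun t x y => ∑ i ∈ s, f i t x y)
      (fun t x y => ∑ i ∈ s, negDY j (f i) t x y) := by
  intro t x y h
  have := deriv_fun_sum (u := s) (A := fun i s => f i t x (Function.update y j s)) (x := y j)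
    fun i hi => differentiableAt_dY (hf i hi) h j
  simpa [negDY, dY] using congrArg Neg.neg this

theorem iterNegDY_sum {ι : Type*} {s : Finset ι} {f : ι → Fun T n m} (hf : ∀ i ∈ s, A.Adm (f i))
    (l : List (Fin m)) (r : Fin m → ℕ) :
    F.EqDom (iterNegDY l r fun t x y => ∑ i ∈ s, f i t x y)
      (fun t x y => ∑ i ∈ s, iterNegDY l r (f i) t x y) := by
  induction l with
  | nil => exact EqDom.refl _
  | cons j l ih =>
    refine (iterate_negDY_congr ih j (r j)).trans ?_
    have hg := fun i hi => iterNegDY_adm (hf i hi) l r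
    change F.EqDom _ (fun t x y => ∑ i ∈ s, (negDY j)^[r j] (iterNegDY l r (f i)) t x y)
    generalize r j = k
    induction k with
    | zero => exact EqDom.refl _
    | succ k ihk =>
      simp only [Function.iterate_succ_apply']
      exact (negDY_congr ihk j).trans (negDY_sum (fun i hi => iterate_negDY_adm (hg i hi) j k) j)

end IteratedDerivatives

/-! ### Insertion of one variable -/

section Insertion

variable {T : Type*} {F : CurveFamily T} {n m n' m' : ℕ}

/-- The properties common to the two kinds of loop insertion operators: `δ` is a derivation along
the pullback of functions, and `φ` renumbers the variables `y_j`. -/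
structure IsInsertion (A : FunctionClass F) (δ pull : Fun T n m → Fun T n' m')
    (φ : Fin m → Fin m') : Prop where
  const : ∀ c : ℂ, F.EqDom (δ fun _ _ _ => c) fun _ _ _ => 0
  add : ∀ f g, A.Adm f → A.Adm g →
    F.EqDom (δ fun t x y => f t x y + g t x y) fun t x y => δ f t x y + δ g t x y
  leibniz : ∀ f g, A.Adm f → A.Adm g → F.EqDom (δ fun t x y => f t x y * g t x y)
    fun t x y => δ f t x y * pull g t x y + pull f t x y * δ g t x y
  comm : ∀ j f, A.Adm f → F.EqDom (δ (dY j f)) (dY (φ j) (δ f))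
  pull_adm : ∀ f, A.Adm f → A.Adm (pull f)
  pull_one : pull (fun _ _ _ => 1) = fun _ _ _ => 1
  pull_mul : ∀ f g, pull (fun t x y => f t x y * g t x y) =
    fun t x y => pull f t x y * pull g t x y

variable {A : FunctionClass F} {δ pull : Fun T n m → Fun T n' m'} {φ : Fin m → Fin m'}
  (hδ : IsInsertion A δ pull φ)

namespace IsInsertion

include hδ

theorem neg {f : Fun T n m} (hf : A.Adm f) : F.EqDom (δ (-f)) (-δ f) := by
  intro t x y h
  have h1 := hδ.add f (-f) hf (A.neg hf) t x y h
  have h2 : (fun t x y => f t x y + (-f) t x y) = fun _ _ _ => (0 : ℂ) := by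
    ext t x y
    simp
  rw [h2, hδ.const 0 t x y h] at h1
  exact (neg_eq_of_add_eq_zero_right h1.symm).symm

theorem negDY {f : Fun T n m} (hf : A.Adm f) (j : Fin m) :
    F.EqDom (δ (negDY j f)) (XYSymmetry.negDY (φ j) (δ f)) :=
  (hδ.neg (A.dY j f hf)).trans fun t x y h => congrArg Neg.neg (hδ.comm j f hf t x y h)

theorem sum {ι : Type*} {s : Finset ι} {f : ι → Fun T n m} (hf : ∀ i ∈ s, A.Adm (f i)) :
    F.EqDom (δ fun t x y => ∑ i ∈ s, f i t x y) (fun t x y => ∑ i ∈ s, δ (f i) t x y) := by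
  classical
  induction s using Finset.induction_on with
  | empty => simpa using hδ.const 0
  | insert a s ha ih =>
    simp only [Finset.sum_insert ha]
    have hs : ∀ i ∈ s, A.Adm (f i) := fun i hi => hf i (by simp [hi])
    intro t x y h
    exact (hδ.add (f a) _ (hf a (by simp)) (A.sum hs) t x y h).trans
      (congrArg (δ (f a) t x y + ·) (ih hs t x y h))

/-- The derivation `δ + ∑_j M_j ∂_j` at a point. -/
theorem twisted_prod (M : Fin m → ℂ) {t : T} {x : Fin n' → ℂ} {y : Fin m' → ℂ}
    (h : F.InDom t x y) {ι : Type*} [DecidableEq ι] (s : Finset ι) {f : ι → Fun T n m}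
    (hf : ∀ i ∈ s, A.Adm (f i)) :
    δ (fun t x y => ∏ i ∈ s, f i t x y) t x y +
        ∑ j, M j * dY (φ j) (pull fun t x y => ∏ i ∈ s, f i t x y) t x y =
      ∑ i ∈ s, (δ (f i) t x y + ∑ j, M j * dY (φ j) (pull (f i)) t x y) *
        pull (fun t x y => ∏ k ∈ s.erase i, f k t x y) t x y := by
  induction s using Finset.induction_on with
  | empty =>
    simp only [Finset.prod_empty, hδ.pull_one, Finset.sum_empty]
    rw [hδ.const 1 t x y h]
    simp [dY]
  | insert a s ha ih =>
    have hs : ∀ i ∈ s, A.Adm (f i) := fun i hi => hf i (by simp [hi])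
    have hfa := hf a (by simp)
    have hp := A.prod hs
    simp only [Finset.prod_insert ha, hδ.pull_mul, Finset.sum_insert ha, Finset.erase_insert ha]
    rw [hδ.leibniz (f a) _ hfa hp t x y h]
    have h1 : ∀ j, dY (φ j) (fun t x y => pull (f a) t x y *
          pull (fun t x y => ∏ i ∈ s, f i t x y) t x y) t x y =
        dY (φ j) (pull (f a)) t x y * pull (fun t x y => ∏ i ∈ s, f i t x y) t x y +
        pull (f a) t x y * dY (φ j) (pull fun t x y => ∏ i ∈ s, f i t x y) t x y := fun j =>
      dY_mul (hδ.pull_adm _ hfa) (hδ.pull_adm _ hp) (φ j) t x y h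
    have h2 : ∑ i ∈ s, (δ (f i) t x y + ∑ j, M j * dY (φ j) (pull (f i)) t x y) *
        pull (fun t x y => ∏ k ∈ (insert a s).erase i, f k t x y) t x y =
        pull (f a) t x y * ∑ i ∈ s, (δ (f i) t x y + ∑ j, M j * dY (φ j) (pull (f i)) t x y) *
          pull (fun t x y => ∏ k ∈ s.erase i, f k t x y) t x y := by
      rw [Finset.mul_sum]
      refine Finset.sum_congr rfl fun i hi => ?_
      have hia : a ≠ i := fun h => ha (h ▸ hi)
      have h3 : a ∉ s.erase i := fun h => ha (Finset.mem_of_mem_erase h)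
      rw [Finset.erase_insert_of_ne hia]
      simp only [Finset.prod_insert h3, hδ.pull_mul]
      ring
    rw [h2, ← ih hs]
    simp only [h1, mul_add, add_mul, Finset.sum_add_distrib, Finset.mul_sum, Finset.sum_mul]
    have h4 : ∀ j, M j * (pull (f a) t x y *
        dY (φ j) (pull fun t x y => ∏ i ∈ s, f i t x y) t x y) = pull (f a) t x y *
        (M j * dY (φ j) (pull fun t x y => ∏ i ∈ s, f i t x y) t x y) := fun j => by ring
    simp only [h4, mul_assoc]
    ring

/-- The action of `δ` on a product of factors `a_k` and `w_E`. If `δ` acts on `w_E` as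
`-∑_j M_j ∂_j` up to a term `s_E` and on `a_k` as `-∂_k M_k`, then its action on the product is the
sum of the replacements of `w_E` by `s_E` and of the total derivatives `-∂_j M_j`. -/
theorem prod_mul_prod {ι : Type*} [DecidableEq ι] {a : Fin m → Fun T n m} {w : ι → Fun T n m}
    {H : Finset ι} {M : Fin m → Fun T n' m'} {s : ι → Fun T n' m'} (ha : ∀ k, A.Adm (a k))
    (hw : ∀ E ∈ H, A.Adm (w E)) (hM : ∀ j, A.Adm (M j))
    (hδa : ∀ k, F.EqDom (δ (a k)) (dY (φ k) fun t x y => -(M k t x y * pull (a k) t x y)))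
    (ha' : ∀ j k, j ≠ k → F.EqDom (dY (φ j) (pull (a k))) fun _ _ _ => 0)
    (hδw : ∀ E ∈ H, F.EqDom (fun t x y => δ (w E) t x y + ∑ j, M j t x y *
      dY (φ j) (pull (w E)) t x y) (s E)) :
    F.EqDom (δ fun t x y => (∏ k, a k t x y) * ∏ E ∈ H, w E t x y)
      fun t x y => ∑ E ∈ H, s E t x y *
        pull (fun t x y => (∏ k, a k t x y) * ∏ E' ∈ H.erase E, w E' t x y) t x y +
        ∑ j, XYSymmetry.negDY (φ j) (fun t x y => M j t x y *
          pull (fun t x y => (∏ k, a k t x y) * ∏ E ∈ H, w E t x y) t x y) t x y := by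
  intro t x y h
  have hpa : A.Adm fun t x y => ∏ k, a k t x y := A.prod fun k _ => ha k
  have hpw : A.Adm fun t x y => ∏ E ∈ H, w E t x y := A.prod hw
  have hpull := hδ.pull_adm _ (A.mul _ _ hpa hpw)
  -- The derivation `δ + ∑_j M_j ∂_j` on the two factors of the product.
  have ea := hδ.twisted_prod (fun j => M j t x y) h Finset.univ fun k _ => ha k
  have ew := hδ.twisted_prod (fun j => M j t x y) h H hw
  have hk : ∀ k, δ (a k) t x y + ∑ j, M j t x y * dY (φ j) (pull (a k)) t x y =
      -(dY (φ k) (M k) t x y * pull (a k) t x y) := by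
    intro k
    rw [Finset.sum_eq_single_of_mem k (Finset.mem_univ k)
      fun j _ hjk => by rw [ha' j k hjk t x y h, mul_zero], hδa k t x y h]
    have h1 := dY_neg (fun t x y => M k t x y * pull (a k) t x y) (φ k)
    have h2 := congrFun (congrFun (congrFun h1 t) x) y
    have h3 := dY_mul (hM k) (hδ.pull_adm _ (ha k)) (φ k) t x y h
    rw [Pi.neg_apply, Pi.neg_apply, Pi.neg_apply, h3] at h2
    refine (congrArg (· + _) h2).trans ?_
    ring
  have hprod : ∀ k, pull (a k) t x y *
      pull (fun t x y => ∏ i ∈ Finset.univ.erase k, a i t x y) t x y =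
        pull (fun t x y => ∏ i, a i t x y) t x y := by
    intro k
    have h1 : (fun t x y => a k t x y * ∏ i ∈ Finset.univ.erase k, a i t x y) =
        fun t x y => ∏ i, a i t x y := by
      funext t x y
      exact Finset.mul_prod_erase Finset.univ (fun i => a i t x y) (Finset.mem_univ k)
    rw [← h1, hδ.pull_mul]
  have ea' : δ (fun t x y => ∏ k, a k t x y) t x y +
      ∑ j, M j t x y * dY (φ j) (pull fun t x y => ∏ k, a k t x y) t x y =
      -∑ k, dY (φ k) (M k) t x y * pull (fun t x y => ∏ i, a i t x y) t x y := by
    rw [ea, ← Finset.sum_neg_distrib]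
    refine Finset.sum_congr rfl fun k _ => ?_
    rw [hk, ← hprod k]
    ring
  have hs : ∑ E ∈ H, (δ (w E) t x y + ∑ j, M j t x y * dY (φ j) (pull (w E)) t x y) *
      pull (fun t x y => ∏ k ∈ H.erase E, w k t x y) t x y = ∑ E ∈ H, s E t x y *
      pull (fun t x y => ∏ k ∈ H.erase E, w k t x y) t x y :=
    Finset.sum_congr rfl fun E hE => congrArg (· * _) (hδw E hE t x y h)
  rw [hs] at ew
  rw [hδ.leibniz _ _ hpa hpw t x y h]
  have hneg : ∀ j, XYSymmetry.negDY (φ j) (fun t x y => M j t x y *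
      pull (fun t x y => (∏ k, a k t x y) * ∏ E ∈ H, w E t x y) t x y) t x y =
      -(dY (φ j) (M j) t x y * (pull (fun t x y => ∏ k, a k t x y) t x y *
        pull (fun t x y => ∏ E ∈ H, w E t x y) t x y) + M j t x y *
        (dY (φ j) (pull fun t x y => ∏ k, a k t x y) t x y *
          pull (fun t x y => ∏ E ∈ H, w E t x y) t x y +
        pull (fun t x y => ∏ k, a k t x y) t x y *
          dY (φ j) (pull fun t x y => ∏ E ∈ H, w E t x y) t x y)) := by
    intro j
    have h1 := dY_mul (hM j) hpull (φ j) t x y h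
    have h2 := dY_mul (hδ.pull_adm _ hpa) (hδ.pull_adm _ hpw) (φ j) t x y h
    refine (congrArg Neg.neg h1).trans ?_
    simp only [hδ.pull_mul] at h2 ⊢
    rw [h2]
  simp only [hneg]
  simp only [hδ.pull_mul]
  have e1 := eq_sub_of_add_eq ea'
  have e2 := eq_sub_of_add_eq ew
  rw [e1, e2]
  simp only [Finset.sum_neg_distrib, mul_add, Finset.sum_add_distrib, sub_mul, mul_sub, neg_mul,
    Finset.mul_sum, Finset.sum_mul]
  have c1 : ∀ E, pull (fun t x y => ∏ k, a k t x y) t x y * (s E t x y *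
      pull (fun t x y => ∏ k ∈ H.erase E, w k t x y) t x y) = s E t x y *
      (pull (fun t x y => ∏ k, a k t x y) t x y *
        pull (fun t x y => ∏ k ∈ H.erase E, w k t x y) t x y) := fun E => by ring
  have c2 : ∀ j, pull (fun t x y => ∏ k, a k t x y) t x y * (M j t x y *
      dY (φ j) (pull fun t x y => ∏ E ∈ H, w E t x y) t x y) = M j t x y *
      (pull (fun t x y => ∏ k, a k t x y) t x y *
        dY (φ j) (pull fun t x y => ∏ E ∈ H, w E t x y) t x y) := fun j => by ring
  simp only [c1, c2, mul_assoc]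
  ring

end IsInsertion

end Insertion

/-! ### Loop insertion operators and symmetry of the correlators -/

section Loop

variable {T : Type*} {F : CurveFamily T} {A : FunctionClass F} {n m : ℕ}

theorem LoopInsertionX.isInsertion (D : LoopInsertionX A) :
    IsInsertion A (D.D : Fun T n m → Fun T (n + 1) m) (fun f t x y => f t (Fin.tail x) y) id where
  const := D.const
  add := D.add
  leibniz := D.leibniz
  comm := D.comm_dY
  pull_adm _ hf := FunctionClass.comp hf (Fin.succ_injective n) Function.injective_id
  pull_one := rfl
  pull_mul _ _ := rfl

theorem LoopInsertionY.isInsertion (D' : LoopInsertionY A) :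
    IsInsertion A (D'.D : Fun T n m → Fun T n (m + 1)) (fun f t x y => f t x (Fin.tail y))
      Fin.succ where
  const := D'.const
  add := D'.add
  leibniz := D'.leibniz
  comm := D'.comm_dY
  pull_adm _ hf := FunctionClass.comp hf Function.injective_id (Fin.succ_injective m)
  pull_one := rfl
  pull_mul _ _ := rfl

/-- The operators `D_x` preserve the symmetries of a function. -/
theorem LoopInsertionX.symm (D : LoopInsertionX A) {f : Fun T n m} (hf : A.Adm f)
    (σ : Equiv.Perm (Fin n)) (τ : Equiv.Perm (Fin m))
    (h : F.EqDom (fun t x y => f t (fun i => x (σ i)) fun j => y (τ j)) f) :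
    F.EqDom (fun t x y => D.D f t (Fin.cons (x 0) fun i => Fin.tail x (σ i)) fun j => y (τ j))
      (D.D f) := by
  intro t x y hd
  have hdom : ∀ (t : T) (x : Fin n → ℂ) (y : Fin m → ℂ), F.InDom t x y →
      F.InDom t (fun i => x (σ i)) fun j => y (τ j) :=
    fun t x y h => h.comp σ.injective τ.injective
  have hx : (Fin.cons (x 0) (Fin.tail x) : Fin (n + 1) → ℂ) = x := Fin.cons_self_tail x
  have h1 := D.chain f (fun i _ x _ => x (σ i)) (fun j _ _ y => y (τ j)) hf (fun _ => A.varX _)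
    (fun _ => A.varY _) hdom t (x 0) (Fin.tail x) y (by rwa [hx]) (hd.permTailX σ τ)
  have h2 := D.congr _ f (FunctionClass.comp hf σ.injective τ.injective) hf h t x y hd
  rw [hx] at h1
  -- The variables are fixed under the insertion, so only the first term of the chain rule remains.
  have h3 : ∀ i, D.D (fun _ x _ => x (σ i) : Fun T n m) t x y = 0 := fun i => D.varX _ t x y hd
  have h4 : ∀ j, D.D (fun _ _ y => y (τ j) : Fun T n m) t x y = 0 := fun j => D.varY _ t x y hd
  simp only [h3, h4, mul_zero, Finset.sum_const_zero, add_zero] at h1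
  exact h1.symm.trans h2

/-- The operators `D̃_y` preserve the symmetries of a function. -/
theorem LoopInsertionY.symm (D' : LoopInsertionY A) {f : Fun T n m} (hf : A.Adm f)
    (σ : Equiv.Perm (Fin n)) (τ : Equiv.Perm (Fin m))
    (h : F.EqDom (fun t x y => f t (fun i => x (σ i)) fun j => y (τ j)) f) :
    F.EqDom (fun t x y => D'.D f t (fun i => x (σ i)) (Fin.cons (y 0) fun j => Fin.tail y (τ j)))
      (D'.D f) := by
  intro t x y hd
  have hdom : ∀ (t : T) (x : Fin n → ℂ) (y : Fin m → ℂ), F.InDom t x y →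
      F.InDom t (fun i => x (σ i)) fun j => y (τ j) :=
    fun t x y h => h.comp σ.injective τ.injective
  have hy : (Fin.cons (y 0) (Fin.tail y) : Fin (m + 1) → ℂ) = y := Fin.cons_self_tail y
  have h1 := D'.chain f (fun i _ x _ => x (σ i)) (fun j _ _ y => y (τ j)) hf (fun _ => A.varX _)
    (fun _ => A.varY _) hdom t (y 0) x (Fin.tail y) (by rwa [hy]) (hd.permTailY σ τ)
  have h2 := D'.congr _ f (FunctionClass.comp hf σ.injective τ.injective) hf h t x y hd
  rw [hy] at h1
  -- The variables are fixed under the insertion, so only the first term of the chain rule remains.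
  have h3 : ∀ i, D'.D (fun _ x _ => x (σ i) : Fun T n m) t x y = 0 := fun i => D'.varX _ t x y hd
  have h4 : ∀ j, D'.D (fun _ _ y => y (τ j) : Fun T n m) t x y = 0 := fun j => D'.varY _ t x y hd
  simp only [h3, h4, mul_zero, Finset.sum_const_zero, add_zero] at h1
  exact h1.symm.trans h2

/-- A function that is symmetric in its first two arguments, and in all arguments but the first
one, is symmetric. -/
theorem symmetric_of_swap_of_tail {k : ℕ} {G : (Fin (k + 2) → ℂ) → ℂ} {S : Set (Fin (k + 2) → ℂ)}
    (hS : ∀ v ∈ S, ∀ σ : Equiv.Perm (Fin (k + 2)), v ∘ σ ∈ S)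
    (h01 : ∀ v ∈ S, G (v ∘ Equiv.swap 0 1) = G v)
    (htail : ∀ v ∈ S, ∀ σ : Equiv.Perm (Fin (k + 1)),
      G (Fin.cons (v 0) fun i => Fin.tail v (σ i)) = G v)
    (σ : Equiv.Perm (Fin (k + 2))) : ∀ v ∈ S, G (v ∘ σ) = G v := by
  have hmul : ∀ σ τ : Equiv.Perm (Fin (k + 2)), (∀ v ∈ S, G (v ∘ σ) = G v) →
      (∀ v ∈ S, G (v ∘ τ) = G v) → ∀ v ∈ S, G (v ∘ (σ * τ : Equiv.Perm (Fin (k + 2)))) = G v := by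
    intro σ τ hσ hτ v hv
    rw [Equiv.Perm.coe_mul, ← Function.comp_assoc, hτ _ (hS v hv σ), hσ v hv]
  have hsucc : ∀ i j : Fin (k + 1), ∀ v ∈ S, G (v ∘ Equiv.swap i.succ j.succ) = G v := by
    intro i j v hv
    rw [← htail v hv (Equiv.swap i j)]
    congr 1
    ext l
    refine l.cases ?_ fun l => ?_
    · simp [Equiv.swap_apply_of_ne_of_ne (Fin.succ_ne_zero i).symm (Fin.succ_ne_zero j).symm]
    · simp only [Function.comp_apply, Fin.cons_succ, Fin.tail]
      rw [(Fin.succ_injective _).swap_apply]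
  have hzero : ∀ j : Fin (k + 1), ∀ v ∈ S, G (v ∘ Equiv.swap 0 j.succ) = G v := by
    intro j
    by_cases hj : j = 0
    · subst hj
      exact h01
    -- Conjugation by a transposition of the arguments other than the first one.
    · have h1 : Equiv.swap (0 : Fin (k + 2)) j.succ =
          Equiv.swap 1 j.succ * Equiv.swap 0 1 * Equiv.swap 1 j.succ := by
        rw [Equiv.swap_mul_swap_mul_swap (by simp) (Fin.succ_ne_zero j).symm, Equiv.swap_comm]
      rw [h1]
      have h2 := hsucc 0 j
      exact hmul _ _ (hmul _ _ h2 h01) h2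
  induction σ using Equiv.Perm.swap_induction_on with
  | one => exact fun _ _ => rfl
  | swap_mul τ i j _ ih =>
    refine hmul _ _ ?_ ih
    refine i.cases (j.cases ?_ fun j => hzero j) fun i => j.cases ?_ fun j => hsucc i j
    · intro v _
      simp
    · rw [Equiv.swap_comm]
      exact hzero i

/-- The correlator does not depend on the order of the arguments other than the last one, since the
recursion takes their multiset. -/
theorem corr_congr {x y : RatFunc ℂ} {P : Set ℂ} {k : ℕ} {v v' : Fin (k + 1) → ℂ}
    (e : Equiv.Perm (Fin k)) (h : ∀ i : Fin k, v' i.castSucc = v (e i).castSucc)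
    (hl : v' (Fin.last k) = v (Fin.last k)) : corr x y P (k + 1) v' = corr x y P (k + 1) v := by
  have h1 : Multiset.map (fun i : Fin k => branch x P (v' i.castSucc)) Finset.univ.val =
      Multiset.map (fun i : Fin k => branch x P (v i.castSucc)) Finset.univ.val := by
    simp only [h]
    conv_rhs => rw [← Multiset.map_univ_val_equiv e, Multiset.map_map]
    rfl
  have h2 : ∏ i, deriv (ev x) (branch x P (v' i)) = ∏ i, deriv (ev x) (branch x P (v i)) := by
    rw [Fin.prod_univ_castSucc, Fin.prod_univ_castSucc, hl]
    simp only [h]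
    rw [Equiv.prod_comp e fun i => deriv (ev x) (branch x P (v i.castSucc))]
  rw [corr, corr, h1, h2, hl]

theorem corr_one (x y : RatFunc ℂ) (P : Set ℂ) (v : Fin 1 → ℂ)
    (h : deriv (ev x) (branch x P (v 0)) ≠ 0) : corr x y P 1 v = ev y (branch x P (v 0)) := by
  rw [corr, omega]
  simp [h]

theorem corr_two (x y : RatFunc ℂ) (P : Set ℂ) (v : Fin 2 → ℂ) : corr x y P 2 v =
    1 / (branch x P (v 0) - branch x P (v 1)) ^ 2 /
      (deriv (ev x) (branch x P (v 0)) * deriv (ev x) (branch x P (v 1))) := by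
  rw [corr, omega]
  simp [Fin.prod_univ_two]

/-- The first two arguments of `W_{k+3}` are among the labelled points of the recursion, which are
treated symmetrically. -/
theorem corr_swap (x y : RatFunc ℂ) (P : Set ℂ) {k : ℕ} (v : Fin (k + 3) → ℂ) :
    corr x y P (k + 3) (v ∘ Equiv.swap 0 1) = corr x y P (k + 3) v := by
  refine corr_congr (Equiv.swap 0 1) (fun i => ?_) ?_
  · have h := (Fin.castSucc_injective (k + 2)).swap_apply 0 1 i
    rw [Fin.castSucc_zero, Fin.castSucc_one] at h
    rw [← h, Function.comp_apply]
  · rw [Function.comp_apply, Equiv.swap_apply_of_ne_of_ne]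
    · simp [Fin.ext_iff]
    · simp [Fin.ext_iff]

theorem corr_two_swap (x y : RatFunc ℂ) (P : Set ℂ) (v : Fin 2 → ℂ) :
    corr x y P 2 (v ∘ Equiv.swap 0 1) = corr x y P 2 v := by
  rw [corr_two, corr_two]
  simp only [Function.comp_apply, Equiv.swap_apply_left, Equiv.swap_apply_right]
  rw [mul_comm, ← neg_sub, neg_sq]

/-- The correlators `W_{k,0}` are symmetric, because `D_x` preserves symmetries. -/
theorem W_symm (D : LoopInsertionX A) {k : ℕ} (σ : Equiv.Perm (Fin k)) {t : T} {v : Fin k → ℂ}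
    {w : Fin 0 → ℂ} (h : F.InDom t v w) : F.W k t (v ∘ σ) = F.W k t v := by
  rcases k with _ | k
  · rfl
  induction k generalizing t w with
  | zero => exact congrArg _ (funext fun i => congrArg v (Subsingleton.elim (α := Fin 1) _ _))
  | succ k ih =>
    refine symmetric_of_swap_of_tail (G := F.W (k + 2) t) (S := {v | F.InDom t v w})
      (fun v hv σ => hv.comp σ.injective Function.injective_id) ?_ ?_ σ v h
    · intro v _
      rcases k with _ | k
      · exact corr_two_swap _ _ _ v
      · exact corr_swap _ _ _ v
    · intro v hv σ
      have h1 := D.symm (A.W k) σ 1 (fun t x y h => ih σ h) t v w hv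
      have h2 := D.insertion k
      exact (h2 t _ w (InDom.permTailX hv σ 1)).symm.trans (h1.trans (h2 t v w hv))

/-- The correlators `W_{0,k}` are symmetric, because `D̃_y` preserves symmetries. -/
theorem W'_symm (D' : LoopInsertionY A) {k : ℕ} (σ : Equiv.Perm (Fin k)) {t : T} {v : Fin k → ℂ}
    {w : Fin 0 → ℂ} (h : F.InDom t w v) : F.W' k t (v ∘ σ) = F.W' k t v := by
  rcases k with _ | k
  · rfl
  induction k generalizing t w with
  | zero => exact congrArg _ (funext fun i => congrArg v (Subsingleton.elim (α := Fin 1) _ _))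
  | succ k ih =>
    refine symmetric_of_swap_of_tail (G := F.W' (k + 2) t) (S := {v | F.InDom t w v})
      (fun v hv σ => hv.comp Function.injective_id σ.injective) ?_ ?_ σ v h
    · intro v _
      rcases k with _ | k
      · exact corr_two_swap _ _ _ v
      · exact corr_swap _ _ _ v
    · intro v hv σ
      have h1 := D'.symm (A.W' k) 1 σ (fun t x y h => ih σ h) t w v hv
      have h2 := D'.insertion k
      exact (h2 t w _ (InDom.permTailY hv 1 σ)).symm.trans (h1.trans (h2 t w v hv))

end Loop

/-! ### Correlators of sets of points -/

section Points

variable {T : Type*} {F : CurveFamily T} {A : FunctionClass F} {n m : ℕ}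

/-- `W_{k,0}` depends only on the multiset of its arguments. -/
theorem W_eq_of_map_eq (D : LoopInsertionX A) {k k' : ℕ} {t : T} {v : Fin k → ℂ}
    {v' : Fin k' → ℂ} {w : Fin 0 → ℂ} (h : F.InDom t v w)
    (hv : Finset.univ.val.map v' = Finset.univ.val.map v) : F.W k' t v' = F.W k t v := by
  obtain rfl : k' = k := by simpa using congrArg Multiset.card hv
  have hmem : ∀ a, (∃ i, v' i = a) ↔ ∃ i, v i = a := fun a => by
    have h2 : a ∈ Finset.univ.val.map v' ↔ a ∈ Finset.univ.val.map v := by rw [hv]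
    simpa using h2
  have hinj : Function.Injective v := fun i j hij =>
    Sum.inl_injective (h.2.2 (congrArg (F.zx t) hij))
  choose f hf using fun i => (hmem (v' i)).1 ⟨i, rfl⟩
  have hsurj : Function.Surjective f := fun j => by
    obtain ⟨i, hi⟩ := (hmem (v j)).2 ⟨j, rfl⟩
    exact ⟨i, hinj ((hf i).trans hi)⟩
  rw [← W_symm D (Equiv.ofBijective f ⟨Finite.injective_iff_surjective.2 hsurj, hsurj⟩) h]
  congr 1
  exact funext fun i => (hf i).symm

variable (F) in
/-- `W_{|E|,0}` at the `x`-coordinates of the points of `E`, in an arbitrary order. -/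
def WE (E : Finset (Fin n ⊕ Fin m)) : Fun T n m := fun t x y =>
  F.W (E.val.map (F.coord t x y)).toList.length t (E.val.map (F.coord t x y)).toList.get

theorem WE_eq (D : LoopInsertionX A) {E : Finset (Fin n ⊕ Fin m)} {k : ℕ}
    {e : Fin k → Fin n ⊕ Fin m} (he : Finset.univ.val.map e = E.val) {t : T} {x : Fin n → ℂ}
    {y : Fin m → ℂ} (h : F.InDom t x y) :
    WE F E t x y = F.W k t fun i => F.coord t x y (e i) := by
  have hinj : Function.Injective e := by
    have := E.nodup
    rw [← he] at this
    exact Multiset.inj_on_of_nodup_map this |> fun h i j hij => h i (by simp) j (by simp) hij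
  refine W_eq_of_map_eq D (h.coord_comp hinj Fin.elim0) ?_
  rw [Fin.univ_val_map, List.ofFn_get, Multiset.coe_toList, ← he, Multiset.map_map]
  rfl

theorem exists_enumeration {α : Type*} (E : Finset α) :
    ∃ e : Fin E.card → α, Finset.univ.val.map e = E.val := by
  refine ⟨fun i => E.val.toList.get (i.cast (by simp)), ?_⟩
  have h := Fin.univ_val_map (fun i => E.val.toList.get i)
  rw [List.ofFn_get, Multiset.coe_toList] at h
  refine Eq.trans ?_ h
  have hk : E.card = E.val.toList.length := by simp
  have aux : ∀ (k : ℕ) (h : k = E.val.toList.length),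
      (Finset.univ : Finset (Fin k)).val.map (fun i => E.val.toList.get (i.cast h)) =
        (Finset.univ : Finset (Fin E.val.toList.length)).val.map fun i => E.val.toList.get i := by
    rintro _ rfl
    rfl
  exact aux _ hk

theorem injective_of_map_eq {α : Type*} {E : Finset α} {k : ℕ} {e : Fin k → α}
    (he : Finset.univ.val.map e = E.val) : Function.Injective e := by
  have := E.nodup
  rw [← he] at this
  exact fun i j hij => Multiset.inj_on_of_nodup_map this i (by simp) j (by simp) hij

theorem coord_tailX (t : T) (x : Fin (n + 1) → ℂ) (y : Fin m → ℂ) (p) :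
    F.coord t x y (succBox n m p) = F.coord t (Fin.tail x) y p := by
  rcases p with i | j <;> rfl

theorem coord_tailY (t : T) (x : Fin n → ℂ) (y : Fin (m + 1) → ℂ) (p) :
    F.coord t x y (succCirc n m p) = F.coord t x (Fin.tail y) p := by
  rcases p with i | j <;> rfl

theorem WE_tailX (E : Finset (Fin n ⊕ Fin m)) (t : T) (x : Fin (n + 1) → ℂ) (y : Fin m → ℂ) :
    WE F (E.map (succBox n m)) t x y = WE F E t (Fin.tail x) y := by
  rw [WE, WE, Finset.map_val, Multiset.map_map]
  have : F.coord t x y ∘ succBox n m = F.coord t (Fin.tail x) y := funext (coord_tailX t x y)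
  rw [this]

theorem WE_tailY (E : Finset (Fin n ⊕ Fin m)) (t : T) (x : Fin n → ℂ) (y : Fin (m + 1) → ℂ) :
    WE F (E.map (succCirc n m)) t x y = WE F E t x (Fin.tail y) := by
  rw [WE, WE, Finset.map_val, Multiset.map_map]
  have : F.coord t x y ∘ succCirc n m = F.coord t x (Fin.tail y) := funext (coord_tailY t x y)
  rw [this]

theorem WE_pair (D : LoopInsertionX A) {p q : Fin n ⊕ Fin m} (hpq : p ≠ q) {t : T} {x : Fin n → ℂ}
    {y : Fin m → ℂ} (h : F.InDom t x y) :
    WE F {p, q} t x y = F.W 2 t ![F.coord t x y p, F.coord t x y q] := by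
  rw [WE_eq D (e := ![p, q]) _ h]
  · congr 1
    ext i
    fin_cases i <;> rfl
  · rw [Fin.univ_val_map]
    simp [hpq]
    rfl

/-! ### The functions `X(y)` and `Y(x)` -/

theorem hasDerivAt_branch {f : RatFunc ℂ} {P : Set ℂ} (hP : IsOpen P) (hf : Set.InjOn (ev f) P)
    (hu : ∀ z ∈ P, Regular f z ∧ deriv (ev f) z ≠ 0) {a : ℂ} (ha : a ∈ ev f '' P) :
    HasDerivAt (branch f P) (deriv (ev f) (branch f P a))⁻¹ a := by
  have hz := hu _ (branch_mem ha)
  refine HasDerivAt.of_local_left_inverse (continuousAt_branch hP hf hu ha)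
    hz.1.analyticAt.differentiableAt.hasDerivAt hz.2 ?_
  filter_upwards [image_mem_nhds hP hu ha] with b hb
  exact ev_branch hb

theorem hasDerivAt_X {t : T} {y : ℂ} (hy : y ∈ ev (F.curve t).y '' F.P t) :
    HasDerivAt (F.X t) (deriv (ev (F.curve t).x) (F.zy t y) *
      (deriv (ev (F.curve t).y) (F.zy t y))⁻¹) y :=
  ((F.x_unramified t _ (branch_mem hy)).1.analyticAt.differentiableAt.hasDerivAt).comp y
    (hasDerivAt_branch (F.isOpen_P t) (F.y_injOn t) (F.y_unramified t) hy)

theorem W_one {t : T} {v : Fin 1 → ℂ} (hv : v 0 ∈ ev (F.curve t).x '' F.P t) :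
    F.W 1 t v = ev (F.curve t).y (F.zx t (v 0)) :=
  corr_one _ _ _ _ (F.x_unramified t _ (branch_mem hv)).2

theorem W'_one {t : T} {v : Fin 1 → ℂ} (hv : v 0 ∈ ev (F.curve t).y '' F.P t) :
    F.W' 1 t v = F.X t (v 0) :=
  corr_one _ _ _ _ (F.y_unramified t _ (branch_mem hv)).2

theorem dX_W_one {t : T} {v : Fin 1 → ℂ} {w : Fin 0 → ℂ}
    (hv : v 0 ∈ ev (F.curve t).x '' F.P t) :
    dX 0 (fun t x _ => F.W 1 t x : Fun T 1 0) t v w = deriv (ev (F.curve t).y) (F.zx t (v 0)) *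
      (deriv (ev (F.curve t).x) (F.zx t (v 0)))⁻¹ := by
  have h := ((F.y_unramified t _ (branch_mem hv)).1.analyticAt.differentiableAt.hasDerivAt).comp
    (v 0) (hasDerivAt_branch (F.isOpen_P t) (F.x_injOn t) (F.x_unramified t) hv)
  refine (Filter.EventuallyEq.deriv_eq ?_).trans h.deriv
  filter_upwards [image_mem_nhds (F.isOpen_P t) (F.x_unramified t) hv] with s hs
  rw [W_one (by simpa using hs)]
  simp [CurveFamily.zx]

theorem dY_W'_one {t : T} {v : Fin 0 → ℂ} {w : Fin 1 → ℂ}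
    (hw : w 0 ∈ ev (F.curve t).y '' F.P t) :
    dY 0 (fun t _ y => F.W' 1 t y : Fun T 0 1) t v w = deriv (F.X t) (w 0) := by
  refine Filter.EventuallyEq.deriv_eq ?_
  filter_upwards [image_mem_nhds (F.isOpen_P t) (F.y_unramified t) hw] with s hs
  rw [W'_one (by simpa using hs)]
  simp

/-- `W_{0,2}` and `W_{2,0}` are the Bergman kernel in the two kinds of coordinates. -/
theorem W_two_X {t : T} {y₀ y₁ : ℂ} (h₀ : y₀ ∈ ev (F.curve t).y '' F.P t)
    (h₁ : y₁ ∈ ev (F.curve t).y '' F.P t) :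
    F.W' 2 t ![y₀, y₁] =
      deriv (F.X t) y₀ * deriv (F.X t) y₁ * F.W 2 t ![F.X t y₀, F.X t y₁] := by
  rw [(hasDerivAt_X h₀).deriv, (hasDerivAt_X h₁).deriv, CurveFamily.W, CurveFamily.W', corr_two,
    corr_two]
  have e0 : branch (F.curve t).x (F.P t) (F.X t y₀) = F.zy t y₀ := zx_X h₀
  have e1 : branch (F.curve t).x (F.P t) (F.X t y₁) = F.zy t y₁ := zx_X h₁
  have n0 := (F.x_unramified t _ (branch_mem h₀)).2
  have n1 := (F.x_unramified t _ (branch_mem h₁)).2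
  simp only [Matrix.cons_val_zero, Matrix.cons_val_one, e0, e1]
  simp only [CurveFamily.zy] at *
  field_simp

variable (F) in
/-- The function `X(y_j)` of all variables. -/
def XF (j : Fin m) : Fun T n m := fun t _ y => F.X t (y j)

variable (F) in
/-- The `x`-coordinate of one of the `n + m` points, as a function of all variables. -/
def coordF (p : Fin n ⊕ Fin m) : Fun T n m := fun t x y => F.coord t x y p

variable (A) in
theorem XF_adm (j : Fin m) : A.Adm (XF F j : Fun T n m) :=
  A.congr _ _ (FunctionClass.comp (A.W' 0) (n' := n) (m' := m) (a := Fin.elim0) (b := fun _ => j)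
    (fun i => i.elim0) (fun _ _ _ => Subsingleton.elim (α := Fin 1) _ _))
    fun _ _ _ h => W'_one (h.2.1 j)

variable (A) in
theorem coordF_adm (p : Fin n ⊕ Fin m) : A.Adm (coordF F p) := by
  rcases p with i | j
  · exact A.varX i
  · exact XF_adm A j

theorem dY_XF_self (j : Fin m) :
    dY j (XF F j : Fun T n m) = fun t _ y => deriv (F.X t) (y j) := by
  funext t x y
  simp [dY, XF]

theorem dY_XF_of_ne {i j : Fin m} (h : i ≠ j) :
    dY i (XF F j : Fun T n m) = fun _ _ _ => 0 := by
  funext t x y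
  simp [dY, XF, h.symm]

theorem InDom.single {t : T} {x : Fin n → ℂ} {y : Fin m → ℂ} (h : F.InDom t x y) (j : Fin m)
    (w : Fin 0 → ℂ) : F.InDom t w fun _ : Fin 1 => y j := by
  have h1 := CurveFamily.InDom.comp h (n' := 0) (m' := 1) (a := Fin.elim0) (b := fun _ => j)
    (fun i => i.elim0) (fun _ _ _ => Subsingleton.elim (α := Fin 1) _ _)
  convert h1 using 1

/-- `D_x X(y)`, from the derivative of the identity `Y(X(y)) = y`. -/
theorem D_XF_one (D : LoopInsertionX A) : F.EqDom (D.D (XF F 0 : Fun T 0 1))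
    fun t x y => -(deriv (F.X t) (y 0) * F.W 2 t ![x 0, F.X t (y 0)]) := by
  intro t x y h
  let f : Fun T 1 0 := fun t x _ => F.W 1 t x
  have hx : (Fin.cons (x 0) (Fin.tail x) : Fin 1 → ℂ) = x := Fin.cons_self_tail x
  have hdom : ∀ (t : T) (x : Fin 0 → ℂ) (y : Fin 1 → ℂ), F.InDom t x y →
      F.InDom t (fun _ : Fin 1 => F.X t (y 0)) (Fin.elim0 : Fin 0 → ℂ) := fun t x y h =>
    CurveFamily.InDom.coord_comp h (k := 1) (e := fun _ => .inr 0)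
      (fun _ _ _ => Subsingleton.elim _ _) Fin.elim0
  have hd2 : F.InDom t (Fin.cons (x 0) fun _ => F.X t (y 0) : Fin 2 → ℂ) Fin.elim0 := by
    have := CurveFamily.InDom.coord_comp h (k := 2) (e := Fin.cons (.inl 0) fun _ => .inr 0)
      (Fin.cons_injective_iff.2 ⟨by simp, fun _ _ _ => Subsingleton.elim _ _⟩) Fin.elim0
    convert this using 1
    ext i
    exact i.cases rfl fun _ => rfl
  have hW : A.Adm f := A.W 0
  have hb : (fun j => (Fin.elim0 : Fin 0 → Fun T 0 1) j t (Fin.tail x) y) = Fin.elim0 :=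
    funext fun i => i.elim0
  have hdom' : ∀ (t : T) (x : Fin 0 → ℂ) (y : Fin 1 → ℂ), F.InDom t x y →
      F.InDom t (fun _ : Fin 1 => (XF F 0 : Fun T 0 1) t x y)
        (fun j => (Fin.elim0 : Fin 0 → Fun T 0 1) j t x y) := fun t x y h => by
    rw [show (fun j => (Fin.elim0 : Fin 0 → Fun T 0 1) j t x y) = Fin.elim0 from
      funext fun i => i.elim0]
    exact hdom t x y h
  have h1 := D.chain f (fun _ => XF F 0) (Fin.elim0 : Fin 0 → Fun T 0 1) hW
    (fun _ => XF_adm A 0) (fun j => j.elim0) hdom' t (x 0) (Fin.tail x) y (by rwa [hx])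
    (by rw [hb]; exact hd2)
  have hsub : F.EqDom (subst f (fun _ => XF F 0) (Fin.elim0 : Fin 0 → Fun T 0 1))
      fun _ _ y => y 0 := by
    intro t x y h
    refine (W_one (X_mem (h.2.1 0))).trans ?_
    exact (congrArg _ (zx_X (h.2.1 0))).trans (ev_branch (h.2.1 0))
  have h2 := D.congr _ _ (A.subst f (fun _ => XF F 0) Fin.elim0 hW (fun _ => XF_adm A 0)
    (fun j => j.elim0) hdom') (A.varY 0) hsub t x y h
  rw [D.varY 0 t x y h] at h2
  rw [hx, h2, hb] at h1
  have hins := D.insertion 0 t _ _ hd2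
  have hz : F.zx t (F.X t (y 0)) = F.zy t (y 0) := zx_X (h.2.1 0)
  have hdX : subst (dX 0 f) (fun _ => XF F 0) (Fin.elim0 : Fin 0 → Fun T 0 1) t (Fin.tail x) y =
      deriv (ev (F.curve t).y) (F.zy t (y 0)) *
        (deriv (ev (F.curve t).x) (F.zy t (y 0)))⁻¹ := by
    rw [← hz]
    exact dX_W_one (v := fun _ => F.X t (y 0)) (X_mem (h.2.1 0))
  have hins : D.D f t (Fin.cons (x 0) fun _ => (XF F 0 : Fun T 0 1) t (Fin.tail x) y) Fin.elim0 =
      F.W 2 t ![x 0, F.X t (y 0)] := by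
    refine hins.trans (congrArg (F.W 2 t) ?_)
    ext i
    exact i.cases rfl fun i => by rw [Subsingleton.elim i 0]; rfl
  rw [hins] at h1
  beta_reduce
  simp only [Fin.sum_univ_one, Finset.univ_eq_empty, Finset.sum_empty, add_zero] at h1
  rw [hdX] at h1
  rw [(hasDerivAt_X (h.2.1 0)).deriv]
  have n0 := (F.x_unramified t _ (branch_mem (h.2.1 0))).2
  have n1 := (F.y_unramified t _ (branch_mem (h.2.1 0))).2
  simp only [CurveFamily.zy] at *
  have h3 := eq_neg_of_add_eq_zero_right h1.symm
  field_simp at h3 ⊢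
  linear_combination h3

end Points

/-! ### Insertion into the coordinates and into the correlators -/

section Steps

variable {T : Type*} {F : CurveFamily T} {A : FunctionClass F} {n m : ℕ}

/-- The action of `D_x` on `X(y_j)`, among any number of variables. -/
theorem D_XF (D : LoopInsertionX A) (j : Fin m) : F.EqDom (D.D (XF F j : Fun T n m))
    fun t x y => -(deriv (F.X t) (y j) * WE F {.inl 0, .inr j} t x y) := by
  intro t x y h
  let a : Fin 0 → Fun T n m := Fin.elim0
  have hdom : ∀ (t : T) (x : Fin n → ℂ) (y : Fin m → ℂ), F.InDom t x y →
      F.InDom t (fun i => a i t x y) fun _ : Fin 1 => y j := fun t x y h => InDom.single h j _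
  have hx : (Fin.cons (x 0) (Fin.tail x) : Fin (n + 1) → ℂ) = x := Fin.cons_self_tail x
  have hd2 : F.InDom t (Fin.cons (x 0) fun i => a i t (Fin.tail x) y : Fin 1 → ℂ)
      fun _ : Fin 1 => y j := by
    have h1 := CurveFamily.InDom.comp h (n' := 1) (m' := 1) (a := fun _ => 0) (b := fun _ => j)
      (fun _ _ _ => Subsingleton.elim (α := Fin 1) _ _)
      (fun _ _ _ => Subsingleton.elim (α := Fin 1) _ _)
    convert h1 using 1
    ext i
    rw [Subsingleton.elim (α := Fin 1) i 0]
    rfl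
  have h1 := D.chain (XF F 0 : Fun T 0 1) a (fun _ _ _ y => y j) (XF_adm A 0) (fun i => i.elim0)
    (fun _ => A.varY j) hdom t (x 0) (Fin.tail x) y (by rwa [hx]) hd2
  rw [hx] at h1
  have h2 : D.D (fun _ _ y => y j : Fun T n m) t x y = 0 := D.varY j t x y h
  simp only [h2, mul_zero, Finset.sum_const_zero, add_zero, Finset.univ_eq_empty,
    Finset.sum_empty] at h1
  refine Eq.trans h1 ((D_XF_one D t _ _ hd2).trans ?_)
  beta_reduce
  rw [WE_pair D Sum.inl_ne_inr h]
  rfl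

/-- The action of `D̃_y` on `X(y_j) = W_{0,1}(y_j)`, which is `W_{0,2}`, in terms of `W_{2,0}`. -/
theorem D'_XF (D : LoopInsertionX A) (D' : LoopInsertionY A) (j : Fin m) :
    F.EqDom (D'.D (XF F j : Fun T n m)) fun t x y => deriv (F.X t) (y 0) *
      deriv (F.X t) (y j.succ) * WE F {.inr 0, .inr j.succ} t x y := by
  intro t x y h
  let a : Fin 0 → Fun T n m := Fin.elim0
  have hdom : ∀ (t : T) (x : Fin n → ℂ) (y : Fin m → ℂ), F.InDom t x y →
      F.InDom t (fun i => a i t x y) fun _ : Fin 1 => y j := fun t x y h => InDom.single h j _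
  have hy : (Fin.cons (y 0) (Fin.tail y) : Fin (m + 1) → ℂ) = y := Fin.cons_self_tail y
  have hcons : (Fin.cons (y 0) fun _ => Fin.tail y j : Fin 2 → ℂ) = ![y 0, y j.succ] := by
    ext i
    fin_cases i <;> rfl
  have hd2 : F.InDom t (fun i => a i t x (Fin.tail y))
      (Fin.cons (y 0) fun _ : Fin 1 => Fin.tail y j : Fin 2 → ℂ) := by
    have h1 := CurveFamily.InDom.comp h (n' := 0) (m' := 2) (a := Fin.elim0)
      (b := Fin.cons 0 fun _ => j.succ) (fun i => i.elim0)
      (Fin.cons_injective_iff.2 ⟨by simpa using (Fin.succ_ne_zero j).symm,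
        fun _ _ _ => Subsingleton.elim (α := Fin 1) _ _⟩)
    convert h1 using 1
    ext i
    exact i.cases rfl fun _ => rfl
  have h1 := D'.chain (fun t _ y => F.W' 1 t y : Fun T 0 1) a (fun _ _ _ y => y j) (A.W' 0)
    (fun i => i.elim0) (fun _ => A.varY j) hdom t (y 0) x (Fin.tail y) (by rwa [hy]) hd2
  rw [hy] at h1
  have h2 : D'.D (fun _ _ y => y j : Fun T n m) t x y = 0 := D'.varY j t x y h
  simp only [h2, mul_zero, Finset.sum_const_zero, add_zero, Finset.univ_eq_empty,
    Finset.sum_empty] at h1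
  have h3 := D'.congr _ _ (XF_adm A j) (A.subst _ a (fun _ _ _ y => y j) (A.W' 0)
    (fun i => i.elim0) (fun _ => A.varY j) hdom)
    (fun t _ y h => (W'_one (t := t) (v := fun _ => y j) (h.2.1 j)).symm) t x y h
  have h4 := D'.insertion 0 t _ _ hd2
  refine h3.trans (h1.trans (h4.trans ?_))
  beta_reduce
  rw [hcons, W_two_X (h.2.1 0) (h.2.1 j.succ), WE_pair D (by simp [(Fin.succ_ne_zero j).symm]) h]
  rfl

/-- The two expressions for `W_{1,1}` agree: `D̃_y Y(x) = D_x X(y)`. -/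
theorem D'_W_one (D : LoopInsertionX A) (D' : LoopInsertionY A) :
    F.EqDom (D'.D (fun t x _ => F.W 1 t x : Fun T 1 0)) (D.D (XF F 0 : Fun T 0 1)) := by
  intro t x y h
  let f : Fun T 0 1 := fun t _ y => F.W' 1 t y
  let g : Fun T 1 0 := fun t x _ => F.W 1 t x
  let a : Fin 0 → Fun T 1 0 := Fin.elim0
  have hg : ∀ (t : T) (x : Fin 1 → ℂ) (y : Fin 0 → ℂ), F.InDom t x y →
      g t x y ∈ ev (F.curve t).y '' F.P t ∧ F.zy t (g t x y) = F.zx t (x 0) := by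
    intro t x y h
    have h1 : g t x y = ev (F.curve t).y (F.zx t (x 0)) := W_one (h.1 0)
    rw [h1]
    exact ⟨Set.mem_image_of_mem _ (branch_mem (h.1 0)),
      branch_ev (F.y_injOn t) (branch_mem (h.1 0))⟩
  have hdom : ∀ (t : T) (x : Fin 1 → ℂ) (y : Fin 0 → ℂ), F.InDom t x y →
      F.InDom t (fun i => a i t x y) fun _ : Fin 1 => g t x y := by
    intro t x y h
    refine ⟨fun i => i.elim0, fun _ => (hg t x y h).1, ?_⟩
    rintro (i | i) (j | j) _
    · exact i.elim0
    · exact i.elim0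
    · exact j.elim0
    · rw [Subsingleton.elim i j]
  have ht := CurveFamily.InDom.tailY h
  have hy : (Fin.cons (y 0) (Fin.tail y) : Fin 1 → ℂ) = y := Fin.cons_self_tail y
  have hne : F.zy t (y 0) ≠ F.zx t (x 0) := fun h0 => by
    have := @h.2.2 (.inr 0) (.inl 0) h0
    simp at this
  obtain ⟨hgm, hgz⟩ := hg t x (Fin.tail y) ht
  have hd2 : F.InDom t (fun i => a i t x (Fin.tail y))
      (Fin.cons (y 0) fun _ : Fin 1 => g t x (Fin.tail y) : Fin 2 → ℂ) := by
    refine ⟨fun i => i.elim0, fun j => ?_, ?_⟩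
    · refine j.cases ?_ fun j => ?_
      · exact h.2.1 0
      · exact hgm
    · rintro (i | i) (j | j)
      · exact i.elim0
      · exact i.elim0
      · exact j.elim0
      · refine i.cases ?_ (fun i => ?_) <;> refine j.cases ?_ (fun j => ?_) <;> intro hij
        · rfl
        · exact (hne (Eq.trans hij hgz)).elim
        · exact (hne (Eq.trans hij.symm hgz)).elim
        · rw [Subsingleton.elim i j]
  have h1 := D'.chain f a (fun _ => g) (A.W' 0) (fun i => i.elim0) (fun _ => A.W 0) hdom t (y 0) x
    (Fin.tail y) (by rwa [hy]) hd2
  have hsub : F.EqDom (subst f a fun _ => g) fun _ x _ => x 0 := by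
    intro t x y h
    obtain ⟨h2, h3⟩ := hg t x y h
    refine (W'_one (v := fun _ => g t x y) h2).trans ?_
    exact (congrArg (ev (F.curve t).x) h3).trans (ev_branch (h.1 0))
  have h2 := D'.congr _ _ (A.subst f a (fun _ => g) (A.W' 0) (fun i => i.elim0) (fun _ => A.W 0)
    hdom) (A.varX 0) hsub t x y h
  rw [D'.varX 0 t x y h] at h2
  rw [hy, h2] at h1
  have hins := D'.insertion 0 t _ _ hd2
  have hdY : subst (dY 0 f) a (fun _ => g) t x (Fin.tail y) =
      deriv (F.X t) (g t x (Fin.tail y)) := dY_W'_one (w := fun _ => g t x (Fin.tail y)) hgm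
  simp only [Fin.sum_univ_one, Finset.univ_eq_empty, Finset.sum_empty, add_zero] at h1
  have hcons : (Fin.cons (y 0) fun _ => g t x (Fin.tail y) : Fin 2 → ℂ) =
      ![y 0, g t x (Fin.tail y)] := by
    ext i
    fin_cases i <;> rfl
  have hXg : F.X t (g t x (Fin.tail y)) = x 0 := by
    refine (congrArg (ev (F.curve t).x) hgz).trans (ev_branch (h.1 0))
  have hins : D'.D f t (fun i => a i t x (Fin.tail y))
      (Fin.cons (y 0) fun _ => g t x (Fin.tail y)) = deriv (F.X t) (y 0) *
        deriv (F.X t) (g t x (Fin.tail y)) * F.W 2 t ![F.X t (y 0), x 0] := by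
    refine hins.trans ?_
    beta_reduce
    rw [hcons, W_two_X (h.2.1 0) hgm, hXg]
  have hWsymm : F.W 2 t ![F.X t (y 0), x 0] = F.W 2 t ![x 0, F.X t (y 0)] := by
    have h5 := WE_pair D (p := .inr 0) (q := .inl 0) Sum.inr_ne_inl h
    rw [Finset.pair_comm, WE_pair D Sum.inl_ne_inr h] at h5
    exact h5.symm
  have hX0 : deriv (F.X t) (g t x (Fin.tail y)) ≠ 0 := by
    rw [(hasDerivAt_X hgm).deriv]
    exact mul_ne_zero (F.x_unramified t _ (branch_mem hgm)).2
      (inv_ne_zero (F.y_unramified t _ (branch_mem hgm)).2)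
  rw [hins, hdY, hWsymm] at h1
  rw [D_XF_one D t x y h]
  refine mul_left_cancel₀ hX0 ?_
  linear_combination -h1

/-- The chain rule for the derivatives with respect to the variables. -/
theorem dY_subst {k : ℕ} {f : Fun T k 0} (hf : A.Adm f) {c : Fin k → Fun T n m}
    (hc : ∀ i, A.Adm (c i)) (b : Fin 0 → Fun T n m)
    (hdom : ∀ t x y, F.InDom t x y → F.InDom t (fun i => c i t x y) fun j => b j t x y)
    (j : Fin m) : F.EqDom (dY j (subst f c b))
      fun t x y => ∑ i, subst (dX i f) c b t x y * dY j (c i) t x y := by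
  intro t x y h
  have hd := hdom t x y h
  set w : Fin 0 → ℂ := fun j => b j t x y with hw
  have hg := (A.analytic f hf t _ _ hd).differentiableAt.hasFDerivAt
  set L := fderiv ℂ (fun p : (Fin k → ℂ) × (Fin 0 → ℂ) => f t p.1 p.2)
    (fun i => c i t x y, w) with hL
  have hci : HasDerivAt (fun s => ((fun i => c i t x (Function.update y j s)), w))
      (fun i => dY j (c i) t x y, 0) (y j) :=
    (hasDerivAt_pi.2 fun i => (differentiableAt_dY (hc i) h j).hasDerivAt).prodMk
      (hasDerivAt_const _ _)
  have hcomp : HasDerivAt (fun s => f t (fun i => c i t x (Function.update y j s)) w)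
      (L (fun i => dY j (c i) t x y, 0)) (y j) :=
    HasFDerivAt.comp_hasDerivAt (y j)
      (l := fun p : (Fin k → ℂ) × (Fin 0 → ℂ) => f t p.1 p.2) (by simpa using hg) hci
  have hdX : ∀ i, subst (dX i f) c b t x y = L (Pi.single i 1, 0) := by
    intro i
    have h2 : HasDerivAt (fun s => (Function.update (fun i => c i t x y) i s, w))
        (Pi.single i 1, 0) (c i t x y) :=
      (hasDerivAt_update _ i _).prodMk (hasDerivAt_const _ _)
    exact (HasFDerivAt.comp_hasDerivAt (c i t x y)
      (l := fun p : (Fin k → ℂ) × (Fin 0 → ℂ) => f t p.1 p.2) (by simpa using hg) h2).deriv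
  have hL2 : ∀ u : Fin k → ℂ, L (u, 0) = ∑ i, L (Pi.single i 1, 0) * u i := by
    intro u
    have h3 : ((u, 0) : (Fin k → ℂ) × (Fin 0 → ℂ)) = ∑ i, u i • (Pi.single i 1, 0) := by
      refine Prod.ext ?_ (Subsingleton.elim _ _)
      rw [Prod.fst_sum]
      ext i
      simp [Finset.sum_apply, Pi.single_apply]
    rw [h3, map_sum]
    exact Finset.sum_congr rfl fun i _ => by rw [map_smul, smul_eq_mul, mul_comm]
  simp only [hdX, ← hL2]
  refine Eq.trans ?_ hcomp.deriv
  refine congrArg (fun g => deriv g (y j)) ?_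
  funext s
  exact congrArg (f t _) (Subsingleton.elim (α := Fin 0 → ℂ) _ _)

/-- `W_E` as a substitution of coordinates into a correlator. -/
theorem exists_subst (D : LoopInsertionX A) {E : Finset (Fin n ⊕ Fin m)} (hE : E.Nonempty) :
    ∃ (k : ℕ) (e : Fin (k + 1) → Fin n ⊕ Fin m), E.card = k + 1 ∧ Finset.univ.val.map e = E.val ∧
      (∀ t x y, F.InDom t x y → F.InDom t (fun i => coordF F (e i) t x y)
        fun j => (Fin.elim0 : Fin 0 → Fun T n m) j t x y) ∧
      F.EqDom (WE F E) (subst (fun t x _ => F.W (k + 1) t x : Fun T (k + 1) 0)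
        (fun i => coordF F (e i)) Fin.elim0) := by
  obtain ⟨e, he⟩ := exists_enumeration E
  obtain ⟨k, hk⟩ := Nat.exists_eq_succ_of_ne_zero (Finset.card_pos.2 hE).ne'
  have aux : ∀ (l : ℕ) (e : Fin l → Fin n ⊕ Fin m), Finset.univ.val.map e = E.val → l = k + 1 →
      ∃ e : Fin (k + 1) → Fin n ⊕ Fin m, Finset.univ.val.map e = E.val := by
    rintro _ e he rfl
    exact ⟨e, he⟩
  obtain ⟨e, he⟩ := aux _ e he hk
  exact ⟨k, e, hk, he, fun t x y h => CurveFamily.InDom.coord_comp h (injective_of_map_eq he) _,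
    fun t x y h => WE_eq D he h⟩

theorem WE_adm (D : LoopInsertionX A) {E : Finset (Fin n ⊕ Fin m)} (hE : E.Nonempty) :
    A.Adm (WE F E) := by
  obtain ⟨k, e, -, he, hdom, heq⟩ := exists_subst D hE
  exact A.congr _ _ (A.subst _ _ _ (A.W k) (fun i => coordF_adm A (e i)) (fun j => j.elim0) hdom)
    heq.symm

/-- `D_x + ∑_j W_{2,0}(x, X(y_j)) ∂/∂y_j` annihilates all coordinates. -/
theorem twisted_coordX (D : LoopInsertionX A) (p : Fin n ⊕ Fin m) {t : T} {x : Fin (n + 1) → ℂ}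
    {y : Fin m → ℂ} (h : F.InDom t x y) :
    D.D (coordF F p) t x y + ∑ j, WE F {.inl 0, .inr j} t x y *
      dY j (coordF F p) t (Fin.tail x) y = 0 := by
  rcases p with i | k
  · have h1 : D.D (coordF F (.inl i : Fin n ⊕ Fin m)) t x y = 0 := D.varX i t x y h
    have h2 : ∀ j, dY j (coordF F (.inl i : Fin n ⊕ Fin m)) t (Fin.tail x) y = 0 := fun j => by
      simp [dY, coordF, coord]
    simp [h1, h2]
  · have h1 := D_XF D (n := n) k t x y h
    change D.D (XF F k) t x y + ∑ j, _ * dY j (XF F k) t (Fin.tail x) y = 0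
    rw [Finset.sum_eq_single_of_mem k (Finset.mem_univ k) fun j _ hj => by
      rw [dY_XF_of_ne hj, mul_zero], h1, dY_XF_self]
    ring

/-- `D̃_y - ∑_j X'(y) W_{2,0}(X(y), X(y_j)) ∂/∂y_j` annihilates all coordinates. -/
theorem twisted_coordY (D : LoopInsertionX A) (D' : LoopInsertionY A) (p : Fin n ⊕ Fin m) {t : T}
    {x : Fin n → ℂ} {y : Fin (m + 1) → ℂ} (h : F.InDom t x y) :
    D'.D (coordF F p) t x y + ∑ j : Fin m, -deriv (F.X t) (y 0) *
      WE F {.inr 0, .inr j.succ} t x y * dY j (coordF F p) t x (Fin.tail y) = 0 := by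
  rcases p with i | k
  · have h1 : D'.D (coordF F (.inl i : Fin n ⊕ Fin m)) t x y = 0 := D'.varX i t x y h
    have h2 : ∀ j, dY j (coordF F (.inl i : Fin n ⊕ Fin m)) t x (Fin.tail y) = 0 := fun j => by
      simp [dY, coordF, coord]
    simp [h1, h2]
  · have h1 := D'_XF D D' (n := n) k t x y h
    change D'.D (XF F k) t x y + ∑ j : Fin m, _ * dY j (XF F k) t x (Fin.tail y) = 0
    rw [Finset.sum_eq_single_of_mem k (Finset.mem_univ k) fun j _ hj => by
      rw [dY_XF_of_ne hj, mul_zero], h1, dY_XF_self]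
    simp only [Fin.tail]
    ring

theorem map_cons_succBox {E : Finset (Fin n ⊕ Fin m)} {k : ℕ} {e : Fin k → Fin n ⊕ Fin m}
    (he : Finset.univ.val.map e = E.val) :
    Finset.univ.val.map (Fin.cons (.inl 0) fun i => succBox n m (e i) :
      Fin (k + 1) → Fin (n + 1) ⊕ Fin m) = (insert (.inl 0) (E.map (succBox n m))).val := by
  rw [Finset.insert_val_of_notMem (notMem_map succBox_ne E), Finset.map_val, ← he,
    Multiset.map_map, Fin.univ_val_map, Fin.univ_val_map, List.ofFn_succ]
  rfl

theorem inDom_coord_tailY {t : T} {x : Fin n → ℂ} {y : Fin (m + 1) → ℂ} (h : F.InDom t x y) {k : ℕ}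
    {e : Fin k → Fin n ⊕ Fin m} (he : Function.Injective e) :
    F.InDom t (fun i => F.coord t x (Fin.tail y) (e i)) fun _ : Fin 1 => y 0 := by
  have ht := CurveFamily.InDom.tailY h
  refine ⟨fun i => CurveFamily.InDom.coord_mem ht _, fun _ => h.2.1 0, ?_⟩
  have h0 : ∀ i, F.zx t (F.coord t x (Fin.tail y) (e i)) ≠ F.zy t (y 0) := by
    intro i hi
    have h1 : F.zx t (F.coord t x y (succCirc n m (e i))) = F.zx t (F.coord t x y (.inr 0)) := by
      rw [coord_tailY]
      exact hi.trans (zx_X (h.2.1 0)).symm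
    exact succCirc_ne _ (CurveFamily.InDom.injective_coord h h1)
  rintro (i | i) (j | j) hij
  · exact congrArg _ (he (CurveFamily.InDom.injective_coord ht hij))
  · exact (h0 i hij).elim
  · exact (h0 j hij.symm).elim
  · rw [Subsingleton.elim (α := Fin 1) i j]

/-- `D_x` adds the point `x` to `W_E`, up to the transport of the points `X(y_j)`. -/
theorem twisted_WE_X (D : LoopInsertionX A) {E : Finset (Fin n ⊕ Fin m)} (hE : E.Nonempty) :
    F.EqDom (fun t x y => D.D (WE F E) t x y + ∑ j, WE F {.inl 0, .inr j} t x y *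
        dY j (fun t x y => WE F E t (Fin.tail x) y : Fun T (n + 1) m) t x y)
      (WE F (insert (.inl 0) (E.map (succBox n m)))) := by
  intro t x y h
  obtain ⟨k, e, -, he, hdom, heq⟩ := exists_subst D hE
  have ht := CurveFamily.InDom.tailX h
  have hx : (Fin.cons (x 0) (Fin.tail x) : Fin (n + 1) → ℂ) = x := Fin.cons_self_tail x
  let f : Fun T (k + 1) 0 := fun t x _ => F.W (k + 1) t x
  have hca : (Fin.cons (x 0) fun i => coordF F (e i) t (Fin.tail x) y : Fin (k + 2) → ℂ) =
      fun i => F.coord t x y ((Fin.cons (.inl 0) fun i => succBox n m (e i) :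
        Fin (k + 2) → Fin (n + 1) ⊕ Fin m) i) := by
    ext i
    exact i.cases rfl fun i => (coord_tailX t x y _).symm
  have hd2 : F.InDom t (Fin.cons (x 0) fun i => coordF F (e i) t (Fin.tail x) y : Fin (k + 2) → ℂ)
      fun j => (Fin.elim0 : Fin 0 → Fun T n m) j t (Fin.tail x) y := by
    rw [hca]
    exact CurveFamily.InDom.coord_comp h (injective_of_map_eq (map_cons_succBox he)) _
  have h1 := D.chain f (fun i => coordF F (e i)) Fin.elim0 (A.W k) (fun i => coordF_adm A (e i))
    (fun j => j.elim0) hdom t (x 0) (Fin.tail x) y (by rwa [hx]) hd2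
  rw [hx] at h1
  have hadm := A.subst f _ _ (A.W k) (fun i => coordF_adm A (e i)) (fun j => j.elim0) hdom
  have h2 := (D.congr _ _ (WE_adm D hE) hadm heq t x y h).trans h1
  have h3 : ∀ j, dY j (fun t x y => WE F E t (Fin.tail x) y : Fun T (n + 1) m) t x y =
      ∑ i, subst (dX i f) (fun i => coordF F (e i)) Fin.elim0 t (Fin.tail x) y *
        dY j (coordF F (e i)) t (Fin.tail x) y := fun j =>
    (heq.dY j t (Fin.tail x) y ht).trans
      (dY_subst (A.W k) (fun i => coordF_adm A (e i)) Fin.elim0 hdom j t (Fin.tail x) y ht)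
  have h4 : D.D f t (Fin.cons (x 0) fun i => coordF F (e i) t (Fin.tail x) y)
      (fun j => (Fin.elim0 : Fin 0 → Fun T n m) j t (Fin.tail x) y) =
      WE F (insert (.inl 0) (E.map (succBox n m))) t x y := by
    refine (D.insertion k t _ _ hd2).trans ?_
    beta_reduce
    rw [hca, WE_eq D (map_cons_succBox he) h]
  beta_reduce
  rw [h2, h4]
  simp only [Finset.univ_eq_empty, Finset.sum_empty, add_zero, h3, Finset.mul_sum]
  rw [Finset.sum_comm, add_assoc, ← Finset.sum_add_distrib]
  conv_rhs => rw [← add_zero (WE F _ t x y)]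
  congr 1
  -- The remaining terms cancel, since the twisted derivation annihilates the coordinates.
  refine Finset.sum_eq_zero fun i _ => ?_
  have h5 := twisted_coordX D (e i) h
  rw [← mul_zero (subst (dX i f) (fun i => coordF F (e i)) Fin.elim0 t (Fin.tail x) y), ← h5,
    mul_add, Finset.mul_sum]
  congr 1
  exact Finset.sum_congr rfl fun j _ => by ring

/-- `D̃_y` acts on `W_E` by its action on the correlator, up to the transport of the points
`X(y_j)`. -/
theorem twisted_WE_Y (D : LoopInsertionX A) (D' : LoopInsertionY A)
    {E : Finset (Fin n ⊕ Fin m)} (hE : E.Nonempty) {k : ℕ} (hk : E.card = k) {t : T}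
    {x : Fin n → ℂ} {y : Fin (m + 1) → ℂ} (h : F.InDom t x y) :
    ∃ e : Fin k → Fin n ⊕ Fin m, Finset.univ.val.map e = E.val ∧
      D'.D (WE F E) t x y + ∑ j : Fin m, -deriv (F.X t) (y 0) * WE F {.inr 0, .inr j.succ} t x y *
        dY j.succ (fun t x y => WE F E t x (Fin.tail y) : Fun T n (m + 1)) t x y =
      D'.D (fun t x _ => F.W k t x : Fun T k 0) t (fun i => F.coord t x (Fin.tail y) (e i))
        fun _ => y 0 := by
  obtain ⟨k, e, hk', he, hdom, heq⟩ := exists_subst D hE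
  obtain rfl := hk'.symm.trans hk
  have ht := CurveFamily.InDom.tailY h
  have hy : (Fin.cons (y 0) (Fin.tail y) : Fin (m + 1) → ℂ) = y := Fin.cons_self_tail y
  let f : Fun T (k + 1) 0 := fun t x _ => F.W (k + 1) t x
  have hb : (Fin.cons (y 0) fun j => (Fin.elim0 : Fin 0 → Fun T n m) j t x (Fin.tail y) :
      Fin 1 → ℂ) = fun _ => y 0 := by
    ext i
    rw [Subsingleton.elim (α := Fin 1) i 0]
    rfl
  have hd2 : F.InDom t (fun i => coordF F (e i) t x (Fin.tail y))
      (Fin.cons (y 0) fun j => (Fin.elim0 : Fin 0 → Fun T n m) j t x (Fin.tail y) :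
        Fin 1 → ℂ) := by
    rw [hb]
    exact inDom_coord_tailY h (injective_of_map_eq he)
  have h1 := D'.chain f (fun i => coordF F (e i)) Fin.elim0 (A.W k) (fun i => coordF_adm A (e i))
    (fun j => j.elim0) hdom t (y 0) x (Fin.tail y) (by rwa [hy]) hd2
  rw [hy, hb] at h1
  have hadm := A.subst f _ _ (A.W k) (fun i => coordF_adm A (e i)) (fun j => j.elim0) hdom
  have h2 := (D'.congr _ _ (WE_adm D hE) hadm heq t x y h).trans h1
  have h3 : ∀ j : Fin m, dY j.succ (fun t x y => WE F E t x (Fin.tail y) : Fun T n (m + 1)) t x y =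
      ∑ i, subst (dX i f) (fun i => coordF F (e i)) Fin.elim0 t x (Fin.tail y) *
        dY j (coordF F (e i)) t x (Fin.tail y) := fun j => by
    refine Eq.trans ?_ ((heq.dY j t x (Fin.tail y) ht).trans
      (dY_subst (A.W k) (fun i => coordF_adm A (e i)) Fin.elim0 hdom j t x (Fin.tail y) ht))
    simp only [dY, Fin.tail_update_succ]
    rfl
  refine ⟨e, he, ?_⟩
  rw [h2]
  simp only [Finset.univ_eq_empty, Finset.sum_empty, add_zero, h3, Finset.mul_sum]
  rw [Finset.sum_comm, add_assoc, ← Finset.sum_add_distrib]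
  conv_rhs => rw [← add_zero (D'.D _ t _ _)]
  congr 1
  -- The remaining terms cancel, since the twisted derivation annihilates the coordinates.
  refine Finset.sum_eq_zero fun i _ => ?_
  have h5 := twisted_coordY D D' (e i) h
  rw [← mul_zero (subst (dX i f) (fun i => coordF F (e i)) Fin.elim0 t x (Fin.tail y)), ← h5,
    mul_add, Finset.mul_sum]
  congr 1
  exact Finset.sum_congr rfl fun j _ => by ring

end Steps

/-! ### Insertion of one variable into the sum over hypertrees -/

section TreeFunctions

variable {T : Type*} {F : CurveFamily T} {A : FunctionClass F} {n m : ℕ}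

variable (F) in
/-- The function `-dX(y_k)/dy_k` of all variables. -/
def negDX (k : Fin m) : Fun T n m := fun t _ y => -deriv (F.X t) (y k)

variable (F) in
/-- `∏_k (-dX(y_k)/dy_k) ∏_{E ∈ H} W_E`. -/
def preWt (H : Finset (Finset (Fin n ⊕ Fin m))) : Fun T n m := fun t x y =>
  (∏ k, negDX F k t x y) * ∏ E ∈ H, WE F E t x y

/-- The number `r_j - 1` of derivatives with respect to `y_j`. -/
def expo (H : Finset (Finset (Fin n ⊕ Fin m))) (j : Fin m) : ℕ := deg H (.inr j) - 1

variable (F) in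
/-- The weight of a hypertree. -/
def wt (H : Finset (Finset (Fin n ⊕ Fin m))) : Fun T n m :=
  iterNegDY (List.finRange m) (expo H) (preWt F H)

variable (F) in
/-- The sum of the weights of all hypertrees whose `□`-vertices have degree one. -/
def treeFun (n m : ℕ) : Fun T n m := fun t x y => ∑ H ∈ boxTrees n m, wt F H t x y

theorem negDX_eq (k : Fin m) : (negDX F k : Fun T n m) = negDY k (XF F k) := by
  rw [negDY, dY_XF_self]
  rfl

variable (A) in
theorem negDX_adm (k : Fin m) : A.Adm (negDX F k : Fun T n m) := by
  rw [negDX_eq]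
  exact negDY_adm (XF_adm A k) k

theorem preWt_adm (D : LoopInsertionX A) {H : Finset (Finset (Fin n ⊕ Fin m))}
    (hH : ∀ E ∈ H, E.Nonempty) : A.Adm (preWt F H) :=
  A.mul _ _ (A.prod fun k _ => negDX_adm A k) (A.prod fun E hE => WE_adm D (hH E hE))

theorem wt_adm (D : LoopInsertionX A) {H : Finset (Finset (Fin n ⊕ Fin m))}
    (hH : ∀ E ∈ H, E.Nonempty) : A.Adm (wt F H) :=
  iterNegDY_adm (preWt_adm D hH) _ _

theorem IsHypertree.nonempty {α : Type*} [Fintype α] {H : Finset (Finset α)} (hH : IsHypertree H) :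
    ∀ E ∈ H, E.Nonempty :=
  fun E hE => Finset.card_pos.1 (by have := hH.two_le E hE; omega)

theorem treeFun_adm (D : LoopInsertionX A) (n m : ℕ) : A.Adm (treeFun F n m) :=
  A.sum fun _ hH => wt_adm D (mem_boxTrees.1 hH).1.nonempty

theorem prod_WE_buildX (K π : Finset (Finset (Fin n ⊕ Fin m))) (t : T) (x : Fin (n + 1) → ℂ)
    (y : Fin m → ℂ) : preWt F (build (succBox n m) (.inl 0) K π) t x y =
      (∏ B ∈ π, WE F (insert (Sum.inl 0) (B.map (succBox n m))) t x y) *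
        preWt F K t (Fin.tail x) y := by
  rw [preWt, prod_build succBox_ne]
  simp only [WE_tailX]
  rw [preWt]
  have : ∀ k, negDX F k t x y = negDX F k t (Fin.tail x) y := fun _ => rfl
  simp only [this]
  ring

theorem prod_WE_buildY (K π : Finset (Finset (Fin n ⊕ Fin m))) (t : T) (x : Fin n → ℂ)
    (y : Fin (m + 1) → ℂ) : preWt F (build (succCirc n m) (.inr 0) K π) t x y =
      (negDX F 0 t x y * ∏ B ∈ π, WE F (insert (Sum.inr 0) (B.map (succCirc n m))) t x y) *
        preWt F K t x (Fin.tail y) := by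
  rw [preWt, prod_build succCirc_ne, Fin.prod_univ_succ]
  simp only [WE_tailY]
  rw [preWt]
  have : ∀ k : Fin m, negDX F k.succ t x y = negDX F k t x (Fin.tail y) := fun _ => rfl
  simp only [this]
  ring

/-- The action of `D_x` on the product of correlators of a hypertree. -/
theorem D_preWt (D : LoopInsertionX A) {H : Finset (Finset (Fin n ⊕ Fin m))}
    (hH : ∀ E ∈ H, E.Nonempty) : F.EqDom (D.D (preWt F H)) fun t x y =>
      ∑ E ∈ H, preWt F (build (succBox n m) (.inl 0) (H.erase E) {E}) t x y +
        ∑ j, negDY j (preWt F (build (succBox n m) (.inl 0) H {{Sum.inr j}})) t x y := by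
  have hM : ∀ j : Fin m, A.Adm (WE F {Sum.inl 0, Sum.inr j} : Fun T (n + 1) m) := fun j =>
    WE_adm D (by simp)
  have hδa : ∀ k : Fin m, F.EqDom (D.D (negDX F k : Fun T n m)) (dY k fun t x y =>
      -(WE F {Sum.inl 0, Sum.inr k} t x y * negDX F k t (Fin.tail x) y)) := by
    intro k
    rw [negDX_eq]
    refine (D.isInsertion.negDY (XF_adm A k) k).trans
      ((negDY_congr (D_XF D k) k).trans fun t x y h => ?_)
    rw [negDY, ← dY_neg, ← negDX_eq]
    refine congrFun (congrFun (congrFun (congrArg (dY k) ?_) t) x) y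
    funext t x y
    simp only [negDX, Pi.neg_apply]
    ring
  have key := D.isInsertion.prod_mul_prod (a := negDX F) (w := WE F) (H := H)
    (M := fun j => WE F {Sum.inl 0, Sum.inr j})
    (s := fun E => WE F (insert (Sum.inl 0) (E.map (succBox n m))))
    (negDX_adm A) (fun E hE => WE_adm D (hH E hE)) hM hδa
    (fun j k hjk t x y _ => by simp [dY, negDX, hjk.symm])
    (fun E hE => twisted_WE_X D (hH E hE))
  refine key.trans fun t x y h => ?_
  have h1 : ∀ E ∈ H, WE F (insert (Sum.inl 0) (E.map (succBox n m))) t x y *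
      ((∏ k, negDX F k t (Fin.tail x) y) * ∏ E' ∈ H.erase E, WE F E' t (Fin.tail x) y) =
      preWt F (build (succBox n m) (.inl 0) (H.erase E) {E}) t x y := fun E _ => by
    rw [prod_WE_buildX, Finset.prod_singleton]
    rfl
  have h2 : ∀ j, (fun t x y => WE F {Sum.inl 0, Sum.inr j} t x y *
      ((∏ k, negDX F k t (Fin.tail x) y) * ∏ E ∈ H, WE F E t (Fin.tail x) y)) =
      preWt F (build (succBox n m) (.inl 0) H {{Sum.inr j}}) := fun j => by
    funext t x y
    rw [prod_WE_buildX, Finset.prod_singleton]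
    rfl
  beta_reduce
  rw [Finset.sum_congr rfl h1]
  simp only [h2]
  rfl

theorem deg_pos_of_mem_boxTrees (h : 2 ≤ n + m) {H : Finset (Finset (Fin n ⊕ Fin m))}
    (hH : H ∈ boxTrees n m) (a : Fin n ⊕ Fin m) : 0 < deg H a :=
  have := nontrivial_vertices h
  (mem_boxTrees.1 hH).1.deg_pos a

theorem iterNegDY_add_sum {ι κ : Type*} {s : Finset ι} {s' : Finset κ} {f : ι → Fun T n m}
    {g : κ → Fun T n m} (hf : ∀ i ∈ s, A.Adm (f i)) (hg : ∀ i ∈ s', A.Adm (g i))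
    (l : List (Fin m)) (r : Fin m → ℕ) :
    F.EqDom (iterNegDY l r fun t x y => ∑ i ∈ s, f i t x y + ∑ i ∈ s', g i t x y)
      (fun t x y => ∑ i ∈ s, iterNegDY l r (f i) t x y + ∑ i ∈ s', iterNegDY l r (g i) t x y) := by
  have h := iterNegDY_sum (A := A) (s := s.disjSum s') (f := Sum.elim f g) (by
    rintro (i | i) hi
    · exact hf i (by simpa using hi)
    · exact hg i (by simpa using hi)) l r
  simpa only [Finset.sum_disjSum, Sum.elim_inl, Sum.elim_inr] using h

/-- The action of `D_x` on the weight of a hypertree. -/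
theorem D_wt (h2 : 2 ≤ n + m) (D : LoopInsertionX A) {H : Finset (Finset (Fin n ⊕ Fin m))}
    (hH : H ∈ boxTrees n m) : F.EqDom (D.D (wt F H)) fun t x y =>
      ∑ E ∈ H, wt F (build (succBox n m) (.inl 0) (H.erase E) {E}) t x y +
        ∑ j, wt F (build (succBox n m) (.inl 0) H {{Sum.inr j}}) t x y := by
  have hne := (mem_boxTrees.1 hH).1.nonempty
  have hb : ∀ K π : Finset (Finset (Fin n ⊕ Fin m)), K ⊆ H →
      A.Adm (preWt F (build (succBox n m) (.inl 0) K π)) := fun K π hK => preWt_adm D fun e he => by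
    rcases mem_build.1 he with ⟨B, hB, rfl⟩ | ⟨B, hB, rfl⟩
    · exact (hne B (hK hB)).map
    · exact Finset.insert_nonempty _ _
  have hD : ∀ (j : Fin m) (f : Fun T n m), A.Adm f →
      F.EqDom (D.D (negDY j f)) (negDY (id j) (D.D f)) := fun j f hf => D.isInsertion.negDY hf j
  have h1 := iterNegDY_transfer (Φ := D.D) hD (r := expo H) (r' := expo H) (fun _ => rfl)
    (List.finRange m) (preWt_adm D hne)
  rw [List.map_id] at h1
  refine h1.trans ((iterNegDY_congr (D_preWt D hne) _ _).trans ((iterNegDY_add_sum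
    (fun E _ => hb _ {E} (Finset.erase_subset E H))
    (fun j _ => negDY_adm (hb H {{Sum.inr j}} (Finset.Subset.refl H)) j) _ _).trans ?_))
  intro t x y h
  refine congrArg₂ (· + ·) (Finset.sum_congr rfl fun E hE => ?_)
    (Finset.sum_congr rfl fun j _ => ?_)
  · -- The degrees of the `○`-vertices do not change.
    rw [wt]
    refine congrFun (congrFun (congrFun (iterNegDY_congr_exponent (fun j _ => ?_) _) t) x) y
    rw [expo, expo, ← succBox_inr, deg_build succBox_ne,
      deg_split hE (singleton_mem_parts (hne E hE))]
  · -- The degree of the `j`-th `○`-vertex grows by one.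
    refine (iterNegDY_negDY (List.nodup_finRange m) (List.mem_finRange j) (fun i => ?_)
      (hb H {{Sum.inr j}} (Finset.Subset.refl H)) t x y h).symm
    have hpos := deg_pos_of_mem_boxTrees h2 hH (.inr i)
    rw [expo, expo, ← succBox_inr, deg_build succBox_ne, deg_singleton_singleton]
    simp only [Sum.inr.injEq]
    omega

/-- `D_x` adds a `□`-vertex to the sum over hypertrees. -/
theorem D_treeFun (h2 : 2 ≤ n + m) (D : LoopInsertionX A) :
    F.EqDom (D.D (treeFun F n m)) (treeFun F (n + 1) m) := by
  refine (D.isInsertion.sum fun H hH => wt_adm D (mem_boxTrees.1 hH).1.nonempty).trans ?_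
  intro t x y h
  rw [treeFun, sum_boxTrees_succ h2]
  exact Finset.sum_congr rfl fun H hH => D_wt h2 D hH t x y h

theorem expo_two {H : Finset (Finset (Fin n ⊕ Fin m))} (hH : H = {Finset.univ}) : expo H = 0 := by
  subst hH
  funext j
  simp [expo, deg, Finset.filter_singleton]

theorem iterNegDY_zero (l : List (Fin m)) (f : Fun T n m) : iterNegDY l 0 f = f := by
  induction l with
  | nil => rfl
  | cons j l ih => exact ih

theorem treeFun_of_two (h : n + m = 2) : treeFun F n m = preWt F {Finset.univ} := by
  funext t x y
  rw [treeFun, boxTrees_of_two h, Finset.sum_singleton, wt, expo_two rfl, iterNegDY_zero]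

theorem D_XF_eq_treeFun (D : LoopInsertionX A) :
    F.EqDom (D.D (XF F 0 : Fun T 0 1)) (treeFun F 1 1) := by
  intro t x y h
  have h1 := D_XF D (0 : Fin 1) t x y h
  rw [treeFun_of_two rfl, preWt, h1, Finset.prod_singleton, Fin.prod_univ_one]
  have : (Finset.univ : Finset (Fin 1 ⊕ Fin 1)) = {.inl 0, .inr 0} := by decide
  rw [this]
  simp [negDX]

theorem W_two_eq_treeFun (D : LoopInsertionX A) :
    F.EqDom (fun t x _ => F.W 2 t x) (treeFun F 2 0) := by
  intro t x y h
  rw [treeFun_of_two rfl, preWt, Finset.prod_singleton]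
  have : (Finset.univ : Finset (Fin 2 ⊕ Fin 0)) = {.inl 0, .inl 1} := by decide
  rw [this, WE_pair D (by simp) h]
  simp only [Finset.univ_eq_empty, Finset.prod_empty, one_mul]
  congr 1
  ext i
  fin_cases i <;> rfl

theorem W'_two_eq_treeFun (D : LoopInsertionX A) :
    F.EqDom (fun t _ y => F.W' 2 t y) (treeFun F 0 2) := by
  intro t x y h
  rw [treeFun_of_two rfl, preWt, Finset.prod_singleton, Fin.prod_univ_two]
  have : (Finset.univ : Finset (Fin 0 ⊕ Fin 2)) = {.inr 0, .inr 1} := by decide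
  rw [this, WE_pair D (by simp) h]
  have hy : y = ![y 0, y 1] := by
    ext i
    fin_cases i <;> rfl
  refine (congrArg (F.W' 2 t) hy).trans ((W_two_X (h.2.1 0) (h.2.1 1)).trans ?_)
  simp only [negDX, neg_mul_neg]
  rfl

/-- `W_{k,1} = D̃_y W_{k,0}` is the sum over hypertrees with one `○`-vertex, because `D̃_y` commutes
with the operators `D_x` that generate `W_{k,0}`. -/
theorem D'_W (D : LoopInsertionX A) (D' : LoopInsertionY A) (hcomm : LoopCommute D D') (k : ℕ) :
    F.EqDom (D'.D (fun t x _ => F.W (k + 1) t x : Fun T (k + 1) 0)) (treeFun F (k + 1) 1) := by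
  induction k with
  | zero => exact (D'_W_one D D').trans (D_XF_eq_treeFun D)
  | succ k ih =>
    have hW := A.W k
    refine (D'.congr _ _ (A.W (k + 1)) (D.adm _ hW) (D.insertion k).symm).trans ?_
    refine EqDom.trans (hcomm _ hW).symm ?_
    exact (D.congr _ _ (D'.adm _ hW) (treeFun_adm D _ _) ih).trans (D_treeFun (by omega) D)

theorem sum_parts_map {α β M : Type*} [DecidableEq α] [DecidableEq β] [AddCommMonoid M] (ι : α ↪ β)
    (E : Finset α) (f : Finset (Finset β) → M) :
    ∑ π ∈ parts (E.map ι), f π = ∑ π ∈ parts E, f (π.image fun B => B.map ι) := by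
  refine (Finset.sum_bij (fun π _ => π.image fun B => B.map ι) ?_ ?_ ?_ fun _ _ => rfl).symm
  · intro π hπ
    obtain ⟨h1, h2, h3⟩ := mem_parts.1 hπ
    refine mem_parts.2 ⟨?_, ?_, ?_⟩
    · intro B hB
      obtain ⟨B', hB', rfl⟩ := Finset.mem_image.1 hB
      exact Finset.map_subset_map.2 (h1 B' hB')
    · intro h
      obtain ⟨B, hB, h⟩ := Finset.mem_image.1 h
      exact h2 (Finset.map_eq_empty.1 h ▸ hB)
    · intro a ha
      obtain ⟨a', ha', rfl⟩ := Finset.mem_map.1 ha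
      rw [deg_image_map, h3 a' ha']
  · intro π _ π' _ h
    exact Finset.image_injective (Finset.map_injective ι) h
  · intro π hπ
    obtain ⟨h1, h2, h3⟩ := mem_parts.1 hπ
    let down : Finset β → Finset α := fun e => E.filter fun a => ι a ∈ e
    have hdown : ∀ B ∈ π, (down B).map ι = B := by
      intro B hB
      ext b
      simp only [down, Finset.mem_map, Finset.mem_filter]
      constructor
      · rintro ⟨a, ⟨-, ha⟩, rfl⟩
        exact ha
      · intro hb
        obtain ⟨a, ha, rfl⟩ := Finset.mem_map.1 (h1 B hB hb)
        exact ⟨a, ⟨ha, hb⟩, rfl⟩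
    have himg : (π.image down).image (fun B => B.map ι) = π := by
      rw [Finset.image_image]
      conv_rhs => rw [← Finset.image_id (s := π)]
      exact Finset.image_congr hdown
    refine ⟨π.image down, mem_parts.2 ⟨?_, ?_, ?_⟩, himg⟩
    · intro B hB
      obtain ⟨B, hB, rfl⟩ := Finset.mem_image.1 hB
      exact Finset.filter_subset _ _
    · intro h
      obtain ⟨B, hB, h⟩ := Finset.mem_image.1 h
      refine h2 ?_
      rw [← hdown B hB, h, Finset.map_empty] at hB
      exact hB
    · intro a ha
      rw [← deg_image_map ι, himg]
      exact h3 _ (Finset.mem_map_of_mem ι ha)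

variable (F) in
/-- The factors of the weight that involve the new variable, if the hyperedges at the new
`○`-vertex are obtained from the blocks of `π`. -/
def blockWt (π : Finset (Finset (Fin n ⊕ Fin m))) : Fun T n (m + 1) := fun t x y =>
  negDX F 0 t x y * ∏ B ∈ π, WE F (insert (Sum.inr 0) (B.map (succCirc n m))) t x y

/-- `W_{k,1}` at the points of a set `E` of `k` points, as a sum over the partitions of `E`. -/
theorem treeFun_one_coord {k : ℕ} (hk : 2 ≤ k) {E : Finset (Fin n ⊕ Fin m)}
    {e : Fin k → Fin n ⊕ Fin m} (he : Finset.univ.val.map e = E.val) (t : T) (x : Fin n → ℂ)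
    (y : Fin (m + 1) → ℂ) :
    treeFun F k 1 t (fun i => F.coord t x (Fin.tail y) (e i)) (fun _ => y 0) =
      ∑ π ∈ parts E, (negDY 0)^[π.card - 1] (blockWt F π) t x y := by
  let e' : Fin k ↪ Fin n ⊕ Fin m := ⟨e, injective_of_map_eq he⟩
  have hE : Finset.univ.map e' = E := Finset.val_injective (by rw [Finset.map_val]; exact he)
  rw [treeFun, sum_boxTrees_one hk, ← hE, sum_parts_map]
  refine Finset.sum_congr rfl fun π _ => ?_
  rw [Finset.card_image_of_injective _ (Finset.map_injective e')]
  -- The substituted coordinates do not depend on the new variable, so the substitution commutes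
  -- with the derivative.
  let Φ : Fun T k 1 → Fun T n (m + 1) := fun g t x y =>
    g t (fun i => F.coord t x (Fin.tail y) (e i)) fun _ => y 0
  have hΦ : ∀ g, negDY 0 (Φ g) = Φ (negDY 0 g) := by
    intro g
    funext t x y
    simp only [negDY, Pi.neg_apply, dY, Φ, Fin.tail_update_zero, Function.update_self]
    congr 2
    funext s
    congr 1
    funext j
    rw [Subsingleton.elim j 0, Function.update_self]
  have hΦk : ∀ (l : ℕ) g, (negDY 0)^[l] (Φ g) = Φ ((negDY 0)^[l] g) := by
    intro l g
    induction l with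
    | zero => rfl
    | succ l ih => rw [Function.iterate_succ_apply', Function.iterate_succ_apply', ih, hΦ]
  have hdeg : expo (build (boxes k 1) (.inr 0) ∅ π) 0 = π.card - 1 := by
    rw [expo, deg_build_new fun a => boxes_ne a 0]
  have hWE : ∀ B : Finset (Fin k), Φ (WE F (insert (Sum.inr 0) (B.map (boxes k 1)))) =
      WE F (insert (Sum.inr 0) ((B.map e').map (succCirc n m))) := by
    intro B
    funext t x y
    have hm : Multiset.map (F.coord t (fun i => F.coord t x (Fin.tail y) (e i)) fun _ => y 0)
        (insert (Sum.inr 0) (B.map (boxes k 1))).val = Multiset.map (F.coord t x y)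
          (insert (Sum.inr 0) ((B.map e').map (succCirc n m))).val := by
      rw [Finset.insert_val_of_notMem (notMem_map (fun a => boxes_ne a 0) B),
        Finset.insert_val_of_notMem (notMem_map succCirc_ne _), Multiset.map_cons,
        Multiset.map_cons]
      refine congrArg₂ _ rfl ?_
      rw [Finset.map_val, Finset.map_val, Finset.map_val, Multiset.map_map, Multiset.map_map,
        Multiset.map_map]
      refine Multiset.map_congr rfl fun i _ => ?_
      exact (coord_tailY t x y (e i)).symm
    simp only [Φ, WE]
    rw [hm]
  have hpre : Φ (preWt F (build (boxes k 1) (.inr 0) ∅ π)) =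
      blockWt F (π.image fun B => B.map e') := by
    funext t x y
    have h1 := prod_build (fun a => boxes_ne a (0 : Fin 1)) ∅ π (M := ℂ) fun E =>
      WE F E t (fun i => F.coord t x (Fin.tail y) (e i)) fun _ => y 0
    rw [Finset.prod_empty, one_mul] at h1
    simp only [Φ, preWt, h1, Fin.prod_univ_one, blockWt]
    rw [Finset.prod_image (Finset.map_injective e').injOn]
    refine congrArg₂ _ rfl (Finset.prod_congr rfl fun B _ => ?_)
    exact congrFun (congrFun (congrFun (hWE B) t) x) y
  rw [← hpre, hΦk, ← hdeg]
  rfl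

theorem iterate_negDY_mul_const (f R : Fun T n (m + 1))
    (hR : ∀ t x y s, R t x (Function.update y 0 s) = R t x y) (k : ℕ) :
    (negDY 0)^[k] (fun t x y => f t x y * R t x y) =
      fun t x y => (negDY 0)^[k] f t x y * R t x y := by
  induction k with
  | zero => rfl
  | succ k ih =>
    rw [Function.iterate_succ_apply', ih, Function.iterate_succ_apply']
    funext t x y
    simp only [negDY, Pi.neg_apply, dY, hR]
    rw [deriv_mul_const_field, neg_mul]

/-- The action of `D̃_y` on the product of correlators of a hypertree. -/
theorem D'_preWt (D : LoopInsertionX A) (D' : LoopInsertionY A) (hcomm : LoopCommute D D')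
    {H : Finset (Finset (Fin n ⊕ Fin m))} (hH : IsHypertree H) :
    F.EqDom (D'.D (preWt F H)) fun t x y => ∑ E ∈ H, ∑ π ∈ parts E, (negDY 0)^[π.card - 1]
        (preWt F (build (succCirc n m) (.inr 0) (H.erase E) π)) t x y +
      ∑ a : Fin m,
        negDY a.succ (preWt F (build (succCirc n m) (.inr 0) H {{Sum.inr a}})) t x y := by
  let M : Fin m → Fun T n (m + 1) := fun j t x y =>
    -deriv (F.X t) (y 0) * WE F {.inr 0, .inr j.succ} t x y
  have hM : ∀ j, A.Adm (M j) := fun j => A.mul _ _ (negDX_adm A 0) (WE_adm D (by simp))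
  have hδa : ∀ k : Fin m, F.EqDom (D'.D (negDX F k : Fun T n m)) (dY k.succ fun t x y =>
      -(M k t x y * negDX F k t x (Fin.tail y))) := by
    intro k
    rw [negDX_eq]
    refine (D'.isInsertion.negDY (XF_adm A k) k).trans
      ((negDY_congr (D'_XF D D' k) k.succ).trans fun t x y h => ?_)
    rw [negDY, ← dY_neg, ← negDX_eq]
    refine congrFun (congrFun (congrFun (congrArg (dY k.succ) ?_) t) x) y
    funext t x y
    simp only [negDX, Pi.neg_apply, M, Fin.tail]
    ring
  have key := D'.isInsertion.prod_mul_prod (a := negDX F) (w := WE F) (H := H) (M := M)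
    (s := fun E t x y => ∑ π ∈ parts E, (negDY 0)^[π.card - 1] (blockWt F π) t x y)
    (negDX_adm A) (fun E hE => WE_adm D (hH.nonempty E hE)) hM hδa
    (fun j k hjk t x y _ => by simp [dY, negDX, Fin.tail_update_succ, hjk.symm])
    (fun E hE t x y h => by
      obtain ⟨k, hk⟩ := Nat.exists_eq_add_of_le (hH.two_le E hE)
      obtain ⟨e, he, h1⟩ := twisted_WE_Y D D' (hH.nonempty E hE) (k := k + 1 + 1) (by omega) h
      refine h1.trans ?_
      beta_reduce
      rw [← treeFun_one_coord (by omega) he]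
      exact D'_W D D' hcomm (k + 1) t _ _ (inDom_coord_tailY h (injective_of_map_eq he)))
  refine key.trans fun t x y h => ?_
  have h1 : ∀ E ∈ H, (∑ π ∈ parts E, (negDY 0)^[π.card - 1] (blockWt F π) t x y) *
      ((∏ k, negDX F k t x (Fin.tail y)) * ∏ E' ∈ H.erase E, WE F E' t x (Fin.tail y)) =
      ∑ π ∈ parts E, (negDY 0)^[π.card - 1]
        (preWt F (build (succCirc n m) (.inr 0) (H.erase E) π)) t x y := fun E _ => by
    rw [Finset.sum_mul]
    refine Finset.sum_congr rfl fun π _ => ?_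
    have h3 := iterate_negDY_mul_const (blockWt F π)
      (fun t x y => preWt F (H.erase E) t x (Fin.tail y))
      (fun t x y s => by rw [Fin.tail_update_zero]) (π.card - 1)
    have h4 : (fun t x y => blockWt F π t x y * preWt F (H.erase E) t x (Fin.tail y)) =
        preWt F (build (succCirc n m) (.inr 0) (H.erase E) π) := by
      funext t x y
      rw [prod_WE_buildY]
      rfl
    rw [h4] at h3
    rw [h3]
    rfl
  have h2 : ∀ j, (fun t x y => M j t x y *
      ((∏ k, negDX F k t x (Fin.tail y)) * ∏ E ∈ H, WE F E t x (Fin.tail y))) =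
      preWt F (build (succCirc n m) (.inr 0) H {{Sum.inr j}}) := fun j => by
    funext t x y
    rw [prod_WE_buildY, Finset.prod_singleton]
    rfl
  beta_reduce
  rw [Finset.sum_congr rfl h1]
  simp only [h2]

/-- The action of `D̃_y` on the weight of a hypertree. -/
theorem D'_wt (h2 : 2 ≤ n + m) (D : LoopInsertionX A) (D' : LoopInsertionY A)
    (hcomm : LoopCommute D D') {H : Finset (Finset (Fin n ⊕ Fin m))} (hH : H ∈ boxTrees n m) :
    F.EqDom (D'.D (wt F H)) fun t x y =>
      ∑ E ∈ H, ∑ π ∈ parts E, wt F (build (succCirc n m) (.inr 0) (H.erase E) π) t x y +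
        ∑ j, wt F (build (succCirc n m) (.inr 0) H {{Sum.inr j}}) t x y := by
  have hH' := (mem_boxTrees.1 hH).1
  have hne := hH'.nonempty
  have hb : ∀ K π : Finset (Finset (Fin n ⊕ Fin m)), K ⊆ H →
      A.Adm (preWt F (build (succCirc n m) (.inr 0) K π)) := fun K π hK =>
    preWt_adm D fun e he => by
      rcases mem_build.1 he with ⟨B, hB, rfl⟩ | ⟨B, hB, rfl⟩
      · exact (hne B (hK hB)).map
      · exact Finset.insert_nonempty _ _
  -- No derivative acts with respect to the new variable yet.
  let r : Fin (m + 1) → ℕ := Fin.cons 0 (expo H)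
  have hD : ∀ (j : Fin m) (f : Fun T n m), A.Adm f →
      F.EqDom (D'.D (negDY j f)) (negDY j.succ (D'.D f)) := fun j f hf => D'.isInsertion.negDY hf j
  have h1 := iterNegDY_transfer (Φ := D'.D) hD (r := expo H) (r' := r) (fun _ => rfl)
    (List.finRange m) (preWt_adm D hne)
  have hl : ∀ f : Fun T n (m + 1), iterNegDY ((List.finRange m).map Fin.succ) r f =
      iterNegDY (List.finRange (m + 1)) r f := fun f => by
    rw [List.finRange_succ]
    rfl
  rw [hl] at h1
  refine h1.trans ((iterNegDY_congr (D'_preWt D D' hcomm hH') _ _).trans ((iterNegDY_add_sum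
    (f := fun E t x y => ∑ π ∈ parts E, (negDY 0)^[π.card - 1]
      (preWt F (build (succCirc n m) (.inr 0) (H.erase E) π)) t x y)
    (fun E _ => A.sum fun π _ => iterate_negDY_adm (hb _ π (Finset.erase_subset E H)) _ _)
    (fun j _ => negDY_adm (hb H {{Sum.inr j}} (Finset.Subset.refl H)) _) _ _).trans ?_))
  intro t x y h
  refine congrArg₂ (· + ·) (Finset.sum_congr rfl fun E hE => ?_)
    (Finset.sum_congr rfl fun j _ => ?_)
  · -- The degrees of the old vertices do not change, the new vertex has degree `|π|`.
    refine (iterNegDY_sum (fun π _ => iterate_negDY_adm (hb _ π (Finset.erase_subset E H)) _ _)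
      _ _ t x y h).trans (Finset.sum_congr rfl fun π hπ => ?_)
    refine (iterNegDY_iterate (List.nodup_finRange _) (List.mem_finRange 0) _ (fun i => ?_)
      (hb _ π (Finset.erase_subset E H)) t x y h).symm
    refine i.cases ?_ fun i => ?_
    · rw [expo, deg_build_new succCirc_ne]
      simp [r]
    · rw [expo, ← succCirc_inr, deg_build succCirc_ne, deg_split hE hπ]
      simp [r, expo, Fin.succ_ne_zero]
  · -- The degree of the `j`-th old `○`-vertex grows by one, the new vertex has degree one.
    refine (iterNegDY_negDY (List.nodup_finRange _) (List.mem_finRange j.succ) (fun i => ?_)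
      (hb H {{Sum.inr j}} (Finset.Subset.refl H)) t x y h).symm
    refine i.cases ?_ fun i => ?_
    · rw [expo, deg_build_new succCirc_ne]
      simp [r, (Fin.succ_ne_zero j).symm]
    · have hpos := deg_pos_of_mem_boxTrees h2 hH (.inr i)
      rw [expo, ← succCirc_inr, deg_build succCirc_ne, deg_singleton_singleton]
      simp only [Sum.inr.injEq, Fin.succ_inj, r, Fin.cons_succ, expo]
      omega

/-- `D̃_y` adds a `○`-vertex to the sum over hypertrees without `□`-vertices. -/
theorem D'_treeFun (h2 : 2 ≤ m) (D : LoopInsertionX A) (D' : LoopInsertionY A)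
    (hcomm : LoopCommute D D') : F.EqDom (D'.D (treeFun F 0 m)) (treeFun F 0 (m + 1)) := by
  refine (D'.isInsertion.sum fun H hH => wt_adm D (mem_boxTrees.1 hH).1.nonempty).trans ?_
  intro t x y h
  rw [treeFun, sum_boxTrees_zero_succ (by omega)]
  exact Finset.sum_congr rfl fun H hH => D'_wt (by omega) D D' hcomm hH t x y h

end TreeFunctions

/-! ### The sum over trees as a sum over hypertrees -/

section TreeSum

variable {T : Type*} {F : CurveFamily T} {A : FunctionClass F} {n m : ℕ}

theorem map_append_orderEmbOfFin (I : Finset (Fin n)) (J : Finset (Fin m)) :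
    Finset.univ.val.map (Fin.append (fun i => (.inl (I.orderEmbOfFin rfl i) : Fin n ⊕ Fin m))
      fun j => .inr (J.orderEmbOfFin rfl j)) = (I.disjSum J).val := by
  have hI := congrArg Finset.val (Finset.map_orderEmbOfFin_univ I rfl)
  have hJ := congrArg Finset.val (Finset.map_orderEmbOfFin_univ J rfl)
  rw [Finset.map_val] at hI hJ
  rw [Fin.univ_val_map, List.ofFn_fin_append, ← Multiset.coe_add, ← Fin.univ_val_map,
    ← Fin.univ_val_map, Finset.val_disjSum, Multiset.disjSum, ← hI, ← hJ, Multiset.map_map,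
    Multiset.map_map]
  rfl

theorem WE_disjSum (D : LoopInsertionX A) (I : Finset (Fin n)) (J : Finset (Fin m)) {t : T}
    {x : Fin n → ℂ} {y : Fin m → ℂ} (h : F.InDom t x y) :
    WE F (I.disjSum J) t x y = F.W (I.card + J.card) t
      (Fin.append (fun i => x (I.orderEmbOfFin rfl i))
        (fun j => F.X t (y (J.orderEmbOfFin rfl j)))) := by
  rw [WE_eq D (map_append_orderEmbOfFin I J) h]
  refine congrArg _ (funext fun i => ?_)
  refine Fin.addCases (fun i => ?_) (fun j => ?_) i
  · simp [coord]
  · simp [coord]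

theorem hyperedges_eq_image (S : DecoratedTree n m) :
    S.hyperedges = S.doubleSets.image fun p => p.1.disjSum p.2 := by
  rw [DecoratedTree.hyperedges, DecoratedTree.doubleSets, Finset.image_image]
  refine Finset.image_congr fun k _ => ?_
  ext a
  rcases a with i | j <;> simp [mem_nbhd, white]

theorem preweight_eqDom (D : LoopInsertionX A) (S : DecoratedTree n m) :
    F.EqDom (F.preweight S) (preWt F S.hyperedges) := by
  intro t x y h
  have hinj : Function.Injective fun p : Finset (Fin n) × Finset (Fin m) => p.1.disjSum p.2 := by
    rintro ⟨I, J⟩ ⟨I', J'⟩ h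
    have h1 := congrArg Finset.toLeft h
    have h2 := congrArg Finset.toRight h
    simp only [Finset.toLeft_disjSum, Finset.toRight_disjSum] at h1 h2
    rw [h1, h2]
  rw [preWt, hyperedges_eq_image, Finset.prod_image hinj.injOn]
  exact congrArg₂ _ rfl (Finset.prod_congr rfl fun p _ => (WE_disjSum D p.1 p.2 h).symm)

theorem weight_eqDom [Nonempty (Fin n ⊕ Fin m)] (D : LoopInsertionX A) (S : DecoratedTree n m) :
    F.EqDom (F.weight S) (wt F S.hyperedges) := by
  have h1 : F.weight S = iterNegDY (List.finRange m) (expo S.hyperedges) (F.preweight S) := by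
    have : expo S.hyperedges = fun j => S.r j - 1 := funext fun j => by
      rw [expo, DecoratedTree.deg_hyperedges]
      rfl
    rw [this]
    rfl
  rw [h1]
  exact iterNegDY_congr (preweight_eqDom D S) _ _

theorem treeSum_eqDom (h : 1 ≤ n + m) (D : LoopInsertionX A) :
    F.EqDom (F.treeSum n m) (treeFun F n m) := by
  intro t x y hd
  have : Nonempty (Fin n ⊕ Fin m) := by
    rw [← Fintype.card_pos_iff, Fintype.card_sum, Fintype.card_fin, Fintype.card_fin]
    exact h
  refine DecoratedTree.finsum_trees (fun S => 1 / (S.aut : ℂ) * F.weight S t x y) _ fun S => ?_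
  rw [S.aut_eq_one, Nat.cast_one, div_one, one_mul]
  exact weight_eqDom D S t x y hd

end TreeSum

/-! ### Symmetry of the sum over hypertrees -/

section Relabelling

variable {α β : Type*} [DecidableEq α] [DecidableEq β]

omit [DecidableEq α] in
theorem IsHypertree.image_map [Fintype α] [Fintype β] {H : Finset (Finset α)} (hH : IsHypertree H)
    (e : α ≃ β) : IsHypertree (H.image fun E => E.map e.toEmbedding) where
  two_le := by
    intro E hE
    obtain ⟨B, hB, rfl⟩ := Finset.mem_image.1 hE
    rw [Finset.card_map]
    exact hH.two_le B hB
  conn := by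
    intro p hp a b ha
    have h := hH.conn (fun a => p (e a)) (fun E hE a ha b hb =>
      hp _ (Finset.mem_image_of_mem _ hE) _ (Finset.mem_map_of_mem _ ha) _
        (Finset.mem_map_of_mem _ hb)) (e.symm a) (e.symm b)
    rw [e.apply_symm_apply, e.apply_symm_apply] at h
    exact h ha
  card := by
    rw [Finset.sum_image (Finset.map_injective _).injOn,
      Finset.card_image_of_injective _ (Finset.map_injective _), ← Fintype.card_congr e]
    simpa only [Finset.card_map] using hH.card

variable {T : Type*} {F : CurveFamily T} {n m : ℕ}

/-- The relabelling of the `□`-vertices by a permutation. -/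
def relabel (σ : Equiv.Perm (Fin n)) (H : Finset (Finset (Fin n ⊕ Fin m))) :
    Finset (Finset (Fin n ⊕ Fin m)) :=
  H.image fun E => E.map (σ.sumCongr (Equiv.refl (Fin m))).toEmbedding

theorem relabel_relabel_symm (σ : Equiv.Perm (Fin n)) (H : Finset (Finset (Fin n ⊕ Fin m))) :
    relabel σ (relabel σ⁻¹ H) = H := by
  rw [relabel, relabel, Finset.image_image]
  conv_rhs => rw [← Finset.image_id (s := H)]
  refine Finset.image_congr fun E _ => ?_
  ext a
  rcases a with i | j
  · simp [← Equiv.Perm.inv_def]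
  · simp

theorem deg_relabel (σ : Equiv.Perm (Fin n)) (H : Finset (Finset (Fin n ⊕ Fin m)))
    (a : Fin n ⊕ Fin m) : deg (relabel σ H) (a.map σ id) = deg H a :=
  deg_image_map _ H a

theorem relabel_mem_boxTrees (σ : Equiv.Perm (Fin n)) {H : Finset (Finset (Fin n ⊕ Fin m))}
    (hH : H ∈ boxTrees n m) : relabel σ H ∈ boxTrees n m := by
  obtain ⟨h1, h2⟩ := mem_boxTrees.1 hH
  refine mem_boxTrees.2 ⟨h1.image_map _, fun i => ?_⟩
  have h := deg_relabel σ H (.inl (σ.symm i))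
  rw [Sum.map_inl, σ.apply_symm_apply] at h
  rw [h, h2]

theorem preWt_comp (σ : Equiv.Perm (Fin n)) (H : Finset (Finset (Fin n ⊕ Fin m))) (t : T)
    (x : Fin n → ℂ) (y : Fin m → ℂ) :
    preWt F H t (fun i => x (σ i)) y = preWt F (relabel σ H) t x y := by
  rw [preWt, preWt, relabel, Finset.prod_image (Finset.map_injective _).injOn]
  refine congrArg₂ _ rfl (Finset.prod_congr rfl fun E _ => ?_)
  have : F.coord t x y ∘ (σ.sumCongr (Equiv.refl (Fin m))).toEmbedding =
      F.coord t (fun i => x (σ i)) y := by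
    funext p
    rcases p with i | j <;> rfl
  rw [WE, WE, Finset.map_val, Multiset.map_map, this]

theorem wt_comp (σ : Equiv.Perm (Fin n)) (H : Finset (Finset (Fin n ⊕ Fin m))) (t : T)
    (x : Fin n → ℂ) (y : Fin m → ℂ) :
    wt F H t (fun i => x (σ i)) y = wt F (relabel σ H) t x y := by
  have hiter : ∀ (l : List (Fin m)) (r : Fin m → ℕ) (f : Fun T n m),
      (fun t (x : Fin n → ℂ) y => iterNegDY l r f t (fun i => x (σ i)) y) =
        iterNegDY l r fun t x y => f t (fun i => x (σ i)) y := by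
    intro l r f
    induction l with
    | nil => rfl
    | cons j l ih =>
      change _ = (negDY j)^[r j] (iterNegDY l r fun t x y => f t (fun i => x (σ i)) y)
      rw [← ih]
      change (fun t (x : Fin n → ℂ) y =>
        (negDY j)^[r j] (iterNegDY l r f) t (fun i => x (σ i)) y) = _
      generalize iterNegDY l r f = g
      induction r j with
      | zero => rfl
      | succ k ihk => rw [Function.iterate_succ_apply', Function.iterate_succ_apply', ← ihk]; rfl
  have hexpo : expo H = expo (relabel σ H) := funext fun j => by
    rw [expo, expo, ← deg_relabel σ H (.inr j)]
    rfl
  refine (congrFun (congrFun (congrFun (hiter _ _ _) t) x) y).trans ?_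
  rw [wt, hexpo]
  refine congrFun (congrFun (congrFun (congrArg _ ?_) t) x) y
  funext t x y
  exact preWt_comp σ H t x y

/-- The sum over hypertrees is symmetric in the variables `x_i`. -/
theorem treeFun_comp (σ : Equiv.Perm (Fin n)) (t : T) (x : Fin n → ℂ) (y : Fin m → ℂ) :
    treeFun F n m t (fun i => x (σ i)) y = treeFun F n m t x y := by
  rw [treeFun, treeFun]
  refine Finset.sum_nbij' (relabel σ) (relabel σ⁻¹) (fun H hH => relabel_mem_boxTrees σ hH)
    (fun H hH => relabel_mem_boxTrees σ⁻¹ hH) (fun H _ => ?_)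
    (fun H _ => relabel_relabel_symm σ H) fun H _ => wt_comp σ H t x y
  conv_rhs => rw [← relabel_relabel_symm σ⁻¹ H, inv_inv]

end Relabelling

/-! ### The intermediate correlators -/

section Intermediate

variable {T : Type*} {F : CurveFamily T} {A : FunctionClass F} {n m : ℕ}

theorem iterYY_adm (D' : LoopInsertionY A) (m : ℕ) : A.Adm (iterYY D' m) := by
  induction m with
  | zero => exact A.W' 0
  | succ m ih => exact D'.adm _ ih

theorem iterYY_eqDom (D' : LoopInsertionY A) (m : ℕ) :
    F.EqDom (iterYY D' m) fun t _ y => F.W' (m + 1) t y := by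
  induction m with
  | zero => exact EqDom.refl _
  | succ m ih => exact (D'.congr _ _ (iterYY_adm D' m) (A.W' m) ih).trans (D'.insertion m)

theorem W'_eq_treeFun (D : LoopInsertionX A) (D' : LoopInsertionY A) (hcomm : LoopCommute D D')
    (m : ℕ) : F.EqDom (fun t _ y => F.W' (m + 2) t y) (treeFun F 0 (m + 2)) := by
  induction m with
  | zero => exact W'_two_eq_treeFun D
  | succ m ih =>
    exact (D'.insertion (m + 1)).symm.trans
      ((D'.congr _ _ (A.W' (m + 1)) (treeFun_adm D _ _) ih).trans
        (D'_treeFun (by omega) D D' hcomm))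

/-- One insertion of a variable `x` into `W_{0,m+1}`. -/
theorem D_iterYY (D : LoopInsertionX A) (D' : LoopInsertionY A) (hcomm : LoopCommute D D')
    (m : ℕ) : F.EqDom (D.D (iterYY D' m)) (treeFun F 1 (m + 1)) := by
  refine (D.congr _ _ (iterYY_adm D' m) (A.W' m) (iterYY_eqDom D' m)).trans ?_
  cases m with
  | zero =>
    exact (D.congr _ _ (A.W' 0) (XF_adm A 0) fun t x y h => W'_one (h.2.1 0)).trans
      (D_XF_eq_treeFun D)
  | succ m =>
    exact (D.congr _ _ (A.W' (m + 1)) (treeFun_adm D _ _) (W'_eq_treeFun D D' hcomm m)).trans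
      (D_treeFun (by omega) D)

theorem iterY_adm (D : LoopInsertionX A) (D' : LoopInsertionY A) (m n : ℕ) :
    A.Adm (iterY D D' m n) := by
  induction n with
  | zero => exact iterYY_adm D' m
  | succ n ih => exact D.adm _ ih

theorem iterY_eq_treeFun (D : LoopInsertionX A) (D' : LoopInsertionY A)
    (hcomm : LoopCommute D D') (h : 2 ≤ n + (m + 1)) :
    F.EqDom (iterY D D' m n) (treeFun F n (m + 1)) := by
  induction n with
  | zero =>
    obtain ⟨m, rfl⟩ := Nat.exists_eq_succ_of_ne_zero (show m ≠ 0 by omega)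
    exact (iterYY_eqDom D' (m + 1)).trans (W'_eq_treeFun D D' hcomm m)
  | succ n ih =>
    rcases Nat.eq_zero_or_pos n with rfl | hn
    · exact D_iterYY D D' hcomm m
    · exact (D.congr _ _ (iterY_adm D D' m n) (treeFun_adm D _ _) (ih (by omega))).trans
        (D_treeFun (by omega) D)

/-- `D̃_{y₁} … D̃_{y_m} W_{1,0}` for `m ≥ 1`, from `D̃_y Y(x) = D_x X(y)` and the commutation of the
operators. -/
theorem iterYX_eqDom (D : LoopInsertionX A) (D' : LoopInsertionY A) (hcomm : LoopCommute D D')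
    (m : ℕ) : F.EqDom (iterYX D' (m + 1)) (D.D (iterYY D' m)) := by
  induction m with
  | zero =>
    exact (D'_W_one D D').trans
      (D.congr _ _ (A.W' 0) (XF_adm A 0) fun t x y h => W'_one (h.2.1 0)).symm
  | succ m ih =>
    have hadm : ∀ k, A.Adm (iterYX D' k) := fun k => by
      induction k with
      | zero => exact A.W 0
      | succ k ih => exact D'.adm _ ih
    exact (D'.congr _ _ (hadm _) (D.adm _ (iterYY_adm D' m)) ih).trans
      (EqDom.symm (hcomm _ (iterYY_adm D' m)))

theorem iterX_adm (D : LoopInsertionX A) (D' : LoopInsertionY A) (m n : ℕ) :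
    A.Adm (iterX D D' m n) := by
  induction n with
  | zero =>
    induction m with
    | zero => exact A.W 0
    | succ m ih => exact D'.adm _ ih
  | succ n ih => exact D.adm _ ih

theorem iterX_eq_treeFun (D : LoopInsertionX A) (D' : LoopInsertionY A)
    (hcomm : LoopCommute D D') (h : 2 ≤ n + 1 + m) :
    F.EqDom (iterX D D' m n) (treeFun F (n + 1) m) := by
  induction n with
  | zero =>
    obtain ⟨m, rfl⟩ := Nat.exists_eq_succ_of_ne_zero (show m ≠ 0 by omega)
    exact (iterYX_eqDom D D' hcomm m).trans (D_iterYY D D' hcomm m)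
  | succ n ih =>
    by_cases hn : 2 ≤ n + 1 + m
    · exact (D.congr _ _ (iterX_adm D D' m n) (treeFun_adm D _ _) (ih hn)).trans
        (D_treeFun hn D)
    · obtain ⟨rfl, rfl⟩ : n = 0 ∧ m = 0 := by omega
      exact (D.insertion 0).trans (W_two_eq_treeFun D)

/-- `D_{x₁} … D_{xₙ} W_{0,m+1}` is symmetric in the variables `y_j`. -/
theorem iterY_symm (D : LoopInsertionX A) (D' : LoopInsertionY A) (τ : Equiv.Perm (Fin (m + 1))) :
    F.EqDom (fun t x y => iterY D D' m n t x fun j => y (τ j)) (iterY D D' m n) := by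
  induction n with
  | zero =>
    intro t x y h
    have h' : F.InDom t x fun j => y (τ j) := h.comp Function.injective_id τ.injective
    exact (iterYY_eqDom D' m t x _ h').trans
      ((W'_symm D' τ h).trans (iterYY_eqDom D' m t x y h).symm)
  | succ n ih =>
    intro t x y h
    have h1 := D.symm (iterY_adm D D' m n) (Equiv.refl _) τ ih t x y h
    have hx : (Fin.cons (x 0) fun i => Fin.tail x (Equiv.refl (Fin n) i) : Fin (n + 1) → ℂ) = x :=
      Fin.cons_self_tail x
    beta_reduce at h1
    rw [hx] at h1
    exact h1

end Intermediate

end XYSymmetry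

end

theorem mainTheorem1 {T : Type*} (F : XYSymmetry.CurveFamily T) (A : XYSymmetry.FunctionClass F)
    (D : XYSymmetry.LoopInsertionX A) (D' : XYSymmetry.LoopInsertionY A)
    (hcomm : XYSymmetry.LoopCommute D D') :
    (∀ n m : ℕ, 2 ≤ n + 1 + m →
      F.EqDom (XYSymmetry.corrFromX D D' n m) (F.treeSum (n + 1) m)) ∧
    (∀ n m : ℕ, 2 ≤ n + (m + 1) →
      F.EqDom (XYSymmetry.corrFromY D D' n m) (F.treeSum n (m + 1))) := by
  constructor
  · intro n m h t x y hd
    have hr : F.InDom t (fun i => x (finRotate (n + 1) i)) y :=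
      hd.comp (finRotate (n + 1)).injective Function.injective_id
    rw [XYSymmetry.treeSum_eqDom (by omega) D t x y hd,
      ← XYSymmetry.treeFun_comp (finRotate (n + 1)) t x y]
    exact XYSymmetry.iterX_eq_treeFun D D' hcomm h t _ y hr
  · intro n m h t x y hd
    rw [XYSymmetry.treeSum_eqDom (by omega) D t x y hd]
    exact (XYSymmetry.iterY_symm D D' (finRotate (m + 1)) t x y hd).trans
      (XYSymmetry.iterY_eq_treeFun D D' hcomm h t x y hd)
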